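/- Let $m\ge 0$, $R>0$, and let $\Omega\subset B(0,R)\subset\mathbb C$ be a simply connected domain. For $u\in\Omega$ let $G^{(m)}_\Omega(u,\cdot)$ be the massive Green function of $\Omega$, i.e. the unique locally integrable function on $\Omega$, continuous on $\Omega\smallsetminus\{u\}$, which tends to $0$ at every point of $\partial\Omega$ and satisfies $(-\tfrac14(\partial_x^2+\partial_y^2)+m^2)\,G^{(m)}_\Omega(u,\cdot)=\delta_u$ in the sense of distributions in $\Omega$. (So $G^{(m)}_\Omega$ is the kernel of $(-\Delta+m^2)^{-1}$ with Dirichlet boundary conditions, where the Laplacian is normalized as $\Delta=\tfrac14(\partial_x^2+\partial_y^2)$, the limit of the discrete Laplacian $(4\delta^2)^{-1}\sum_{v_1\sim v}(\phi(v_1)-\phi(v))$ on $\delta\mathbb Z^2$.) A simply connected discrete domain $\Omega^\delta$ is a subgraph of $\delta\mathbb Z^2$ spanned by a set $V(\Omega^\delta)$ of vertices, connected, and such that the polygonal domain $\widehat\Omega^\delta$, the union of the open $2\delta\times2\delta$ squares centered at the vertices of $\Omega^\delta$, is simply connected. For vertices $p,q$ of $\Omega^\delta$ put $$Z^{(m)}_{\Omega^\delta}(p,q)=\sum_{\pi}\bigl(\tfrac14(1-m^2\delta^2)\bigr)^{\#\pi},$$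 where the sum is over all nearest-neighbour lattice paths $\pi$ from $p$ to $q$ in $\Omega^\delta$ and $\#\pi$ is the number of edges of $\pi$. Let $\Omega^\delta\subset B(0,R)$ be simply connected discrete domains, with mesh $\delta\to0$, that converge to $\Omega$ in the Carathéodory sense: each $z\in\Omega$ has a neighbourhood contained in $\widehat\Omega^\delta$ for all small enough $\delta$, and each $\zeta\in\partial\Omega$ is a limit of points $\zeta^\delta\in\partial\widehat\Omega^\delta$. Then, for small $\delta$, the series defining $Z^{(m)}_{\Omega^\delta}$ converge, and for any two distinct points $u,v\in\Omega$ and any vertices $u^\delta,v^\delta$ of $\delta\mathbb Z^2$ with $u^\delta\to u$, $v^\delta\to v$ (such vertices belong to $\Omega^\delta$ once $\delta$ is small), $$Z^{(m)}_{\Omega^\delta}(u^\delta,v^\delta)\to G^{(m)}_\Omega(u,v)\qquad\text{as }\delta\to0.$$ Moreover, for each $r>0$ this convergence is uniform over all pairs $u,v\in\Omega$ with $|u-v|\ge r$ that are jointly $r$-inside $\Omega$ (i.e. connected by a path $L\subset\Omega$ with $\mathrm{dist}(L,\partial\Omega)>r$): for each $\varepsilon>0$ there is $\eta>0$ such that,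 for all small enough $\delta$, all such $u,v$ and all vertices $u^\delta,v^\delta$ of $\delta\mathbb Z^2$ with $|u^\delta-u|<\eta$, $|v^\delta-v|<\eta$, one has $u^\delta,v^\delta\in V(\Omega^\delta)$ and $|Z^{(m)}_{\Omega^\delta}(u^\delta,v^\delta)-G^{(m)}_\Omega(u,v)|<\varepsilon$. -/

import Mathlib

open Filter Topology MeasureTheory
open scoped ContDiff

noncomputable section

/-- The vertex of the square grid `δℤ²` with integer coordinates `p`, as a point of the plane. -/
def gridPoint (δ : ℝ) (p : ℤ × ℤ) : ℂ := ⟨δ * p.1, δ * p.2⟩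

/-- The subgraph of the square grid spanned by the vertex set `V`: two vertices of `V` are adjacent
if they are nearest neighbours on the grid. Vertices outside `V` are isolated. -/
def gridGraph (V : Set (ℤ × ℤ)) : SimpleGraph (ℤ × ℤ) where
  Adj p q := p ∈ V ∧ q ∈ V ∧ |p.1 - q.1| + |p.2 - q.2| = 1
  symm := ⟨fun p q h => ⟨h.2.1, h.1, by
    rw [abs_sub_comm q.1, abs_sub_comm q.2]; exact h.2.2⟩⟩
  loopless := ⟨fun p h => by simpa using h.2.2⟩

/-- The polygonal domain of a set of vertices of `δℤ²`: the union of the open `2δ × 2δ` squares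
centred at these vertices. -/
def polygonalDomain (δ : ℝ) (V : Set (ℤ × ℤ)) : Set ℂ :=
  {z | ∃ p ∈ V, |z.re - δ * p.1| < δ ∧ |z.im - δ * p.2| < δ}

/-- `V` is the set of (interior) vertices of a simply connected discrete domain on `δℤ²`: the
subgraph spanned by `V` is connected and its polygonal domain is simply connected. -/
structure IsSimplyConnectedDiscreteDomain (δ : ℝ) (V : Set (ℤ × ℤ)) : Prop where
  connected : ∀ p ∈ V, ∀ q ∈ V, (gridGraph V).Reachable p q
  simplyConnected : IsSimplyConnected (polygonalDomain δ V)

/-- The weight `(¼(1 - m²δ²))^#π` of a lattice path `π` staying in `V`, where `#π` is the number of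
edges of `π`. -/
def walkWeight (m δ : ℝ) (V : Set (ℤ × ℤ)) {p q : ℤ × ℤ} (π : (gridGraph V).Walk p q) : ℝ :=
  ((1 - m ^ 2 * δ ^ 2) / 4) ^ π.length

/-- The partition function of massive random walks running from `p` to `q` in `V` (the discrete
massive Green function): the sum of the weights of all lattice paths from `p` to `q` in `V`. -/
def walkPartition (m δ : ℝ) (V : Set (ℤ × ℤ)) (p q : ℤ × ℤ) : ℝ :=
  ∑' π : (gridGraph V).Walk p q, walkWeight m δ V π

/-- Carathéodory (kernel) convergence of the domains `D i` to the domain `Ω` along the filter `l`: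
a neighbourhood of each point of `Ω` is contained in `D i` for all late `i`, and each boundary point
of `Ω` is a limit of boundary points of `D i`. (Since `Ω` is connected, these conditions are the same
for all choices of the marked point in `Ω`.) -/
structure CaratheodoryConverges {ι : Type*} (l : Filter ι) (D : ι → Set ℂ) (Ω : Set ℂ) : Prop where
  interior : ∀ z ∈ Ω, ∃ U ∈ 𝓝 z, ∀ᶠ i in l, U ⊆ D i
  boundary : ∀ ζ ∈ frontier Ω, ∀ ε > 0, ∀ᶠ i in l, ∃ ξ ∈ frontier (D i), dist ξ ζ < ε

/-- `u` and `v` are jointly `r`-inside `Ω`: they are connected by a path in `Ω` whose distance to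
`∂Ω` is greater than `r`. -/
def JointlyInside (r : ℝ) (Ω : Set ℂ) (u v : ℂ) : Prop :=
  JoinedIn {z | z ∈ Ω ∧ r < Metric.infDist z (frontier Ω)} u v

/-- `g` is a massive Green function of `Ω` with pole at `u`: a function continuous off `u`, with
Dirichlet boundary conditions, which solves `(-¼(∂ₓ² + ∂ᵧ²) + m²) g = δ_u` in the sense of
distributions on `Ω`. Here `¼(∂ₓ² + ∂ᵧ²)` is the limit, as `δ → 0`, of the discrete Laplacian
`(4δ²)⁻¹ ∑_{v₁ ∼ v} (φ(v₁) - φ(v))` of the simple random walk on `δℤ²`. -/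
structure IsMassiveGreen (m : ℝ) (Ω : Set ℂ) (u : ℂ) (g : ℂ → ℝ) : Prop where
  continuousOn : ContinuousOn g (Ω \ {u})
  locallyIntegrableOn : LocallyIntegrableOn g Ω volume
  dirichlet : ∀ ζ ∈ frontier Ω, Tendsto g (𝓝[Ω] ζ) (𝓝 0)
  equation : ∀ φ : ℂ → ℝ, ContDiff ℝ ∞ φ → HasCompactSupport φ → tsupport φ ⊆ Ω →
    ∫ z in Ω, g z * (m ^ 2 * φ z - 1 / 4 * Laplacian.laplacian φ z) = φ u

open Classical in
/-- The massive Green function `G^{(m)}_Ω(u, v)`, i.e. the kernel of `(-¼(∂ₓ² + ∂ᵧ²) + m²)⁻¹` in `Ω`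
with Dirichlet boundary conditions: the value at `v` of the massive Green function of `Ω` with pole
at `u` (and `0` if there is none). -/
def massiveGreen (m : ℝ) (Ω : Set ℂ) (u v : ℂ) : ℝ :=
  if h : ∃ g, IsMassiveGreen m Ω u g then h.choose v else 0

end

/-! The path sum is symmetric, so it is studied as a function `Z(·, p)` of one endpoint with the
pole `p` fixed. Splitting off the first step (`IsBoundedMesh.walkPartition_eq`) shows that `Z(·, p)`
vanishes off `V` and that, inside, it equals the indicator of `p` plus `1 - m²δ²` times its average
over the four neighbours: it is a discrete massive Green function. Convergence comes from
compactness together with uniqueness of the limit.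

Compactness rests on three bounds uniform in the mesh. An explicit logarithmic supersolution,
`logMajorant`, dominates `Z`; it makes the series converge and bounds `Z` away from the pole. A
reflection argument gives a discrete gradient estimate, hence equicontinuity
(`IsBoundedMesh.abs_walkPartition_sub_le`). A weak Beurling estimate makes `Z` small near the
boundary at a geometric rate in the scale (`IsBoundedMesh.walkPartition_le_near_boundary`).

The Beurling estimate is where simple connectedness enters. If the vertex `c` is not in the domain,
`z - c` has a continuous square root there, so the domain lifts to a single sheet of the double
cover branched at `c`. A subharmonic function on that sheet, added to its mirror image in the axis,
is at most `2M` off the cut but at most `M` on it, because the two sides of the cut belong to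
different sheets. Comparison with a superharmonic function gives a definite loss on the opposite
half axis, and iteration over scales gives a power of `decayConst`.

Every subsequential limit is a massive Green function: the bounds pass to the limit, and summation
by parts against a test function, with domination by `cellMajorant`, yields the distributional
equation (`IsLimit.equation`). Two Green functions agree off the pole by a maximum principle for
mollifications (`IsMassiveGreen.le`). Existence of the Green function and convergence of the whole
family follow, and uniformity is a compactness argument on pairs of points. -/

noncomputable section

/-! ### Discrete maximum principle and gradient estimates -/

/-- The average of a lattice function over the four nearest neighbours. -/
def nbrAvg (f : ℤ → ℤ → ℝ) (x y : ℤ) : ℝ :=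
  (f (x + 1) y + f (x - 1) y + f x (y + 1) + f x (y - 1)) / 4

/-- Maximum principle. Among the points of `A` with maximal value, take a rightmost one: its right
neighbour is strictly smaller and the other three are no larger, so the mean-value inequality fails
if the maximum is positive. No connectedness of `A` is needed. -/
theorem nonpos_of_le_nbrAvg {f : ℤ → ℤ → ℝ} {A : ℤ → ℤ → Prop}
    (hA : {p : ℤ × ℤ | A p.1 p.2}.Finite)
    (hsub : ∀ x y, A x y → f x y ≤ nbrAvg f x y)
    (hbd : ∀ x y, ¬ A x y → (A (x + 1) y ∨ A (x - 1) y ∨ A x (y + 1) ∨ A x (y - 1)) → f x y ≤ 0)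
    (x y : ℤ) (hxy : A x y) : f x y ≤ 0 := by
  classical
  by_contra! hpos
  obtain ⟨p, hp, hpmax⟩ := Finset.exists_max_image hA.toFinset (fun p => f p.1 p.2)
    ⟨(x, y), by simpa using hxy⟩
  obtain ⟨q, hq, hqmax⟩ := Finset.exists_max_image
    (hA.toFinset.filter (fun q => f q.1 q.2 = f p.1 p.2)) (fun q => q.1)
    ⟨p, by simpa using hp⟩
  simp only [Finset.mem_filter, Set.Finite.mem_toFinset, Set.mem_ofPred_eq, and_imp] at *
  have hm : 0 < f p.1 p.2 := lt_of_lt_of_le hpos (hpmax (x, y) hxy)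
  obtain ⟨hqA, hqe⟩ := hq
  have key : ∀ x' y', (A (x' + 1) y' ∨ A (x' - 1) y' ∨ A x' (y' + 1) ∨ A x' (y' - 1)) →
      f x' y' ≤ f p.1 p.2 := by
    intro x' y' h
    by_cases h' : A x' y'
    · exact hpmax (x', y') h'
    · exact (hbd x' y' h' h).trans hm.le
  have h1 : f (q.1 + 1) q.2 < f p.1 p.2 := by
    by_cases h' : A (q.1 + 1) q.2
    · refine lt_of_le_of_ne (hpmax (q.1 + 1, q.2) h') fun he => ?_
      have := hqmax (q.1 + 1, q.2) h' he
      simp at this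
    · exact (hbd _ _ h' (by simp [hqA])).trans_lt hm
  have h2 := key (q.1 - 1) q.2 (by simp [hqA])
  have h3 := key q.1 (q.2 + 1) (by simp [hqA])
  have h4 := key q.1 (q.2 - 1) (by simp [hqA])
  have h5 := hsub _ _ hqA
  unfold nbrAvg at h5
  linarith

theorem finite_box (P : ℤ → ℤ → Prop) (B : ℤ) (h : ∀ x y, P x y → |x| ≤ B ∧ |y| ≤ B) :
    {p : ℤ × ℤ | P p.1 p.2}.Finite := by
  refine (Set.finite_Icc ((-B, -B) : ℤ × ℤ) (B, B)).subset fun p hp => ?_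
  obtain ⟨h1, h2⟩ := h _ _ hp
  rw [abs_le] at h1 h2
  exact ⟨⟨h1.1, h2.1⟩, ⟨h1.2, h2.2⟩⟩

/-- Discrete gradient estimate at the centre of a box, by reflection. -/
theorem abs_sub_right_le {h : ℤ → ℤ → ℝ} {N : ℕ} (hN : 1 ≤ N) {M C : ℝ}
    (hM : ∀ x y : ℤ, |x| ≤ N → |y| ≤ N → |h x y| ≤ M)
    (hC : ∀ x y : ℤ, |x| < N → |y| < N → |h x y - nbrAvg h x y| ≤ C) :
    |h 1 0 - h 0 0| ≤ 4 * M / N + 8 * C * N := by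
  have hNpos : (0 : ℝ) < N := by exact_mod_cast hN
  have hM0 : 0 ≤ M := (abs_nonneg _).trans (hM 0 0 (by simp) (by simp))
  have hC0 : 0 ≤ C := (abs_nonneg _).trans (hC 0 0 (by simp; omega) (by simp; omega))
  -- `w` is odd under the reflection `x ↦ 1 - x`, and `w 1 0` is the increment to be bounded. Its
  -- absolute value on the right half, extended by `0`, is subharmonic up to an error `2 * C`.
  set w : ℤ → ℤ → ℝ := fun x y => h x y - h (1 - x) y with hw
  set v : ℤ → ℤ → ℝ := fun x y => if 1 ≤ x then |w x y| else 0 with hv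
  have hv0 : ∀ x y, 0 ≤ v x y := fun x y => by
    simp only [hv]; split_ifs; exacts [abs_nonneg _, le_rfl]
  have hvw : ∀ x y, 1 ≤ x → v x y = |w x y| := fun x y hx => by simp [hv, hx]
  have hvM : ∀ x y : ℤ, x ≤ N → |y| ≤ N → v x y ≤ 2 * M := by
    intro x y hx hy
    by_cases h1 : 1 ≤ x
    · rw [hvw _ _ h1]
      have := hM x y (by rw [abs_le]; omega) hy
      have := hM (1 - x) y (by rw [abs_le]; omega) hy
      calc |w x y| ≤ |h x y| + |h (1 - x) y| := abs_sub _ _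
        _ ≤ 2 * M := by linarith
    · simp [hv, h1, hM0]
  -- Barrier: the first term is discrete harmonic, nonnegative on `x = 0` and at least `2 * M` on
  -- the three other sides; the second has Laplacian `-2 * C`, which absorbs the error. Its value at
  -- `(1, 0)` is of order `M / N + C * N`.
  set ψ : ℤ → ℤ → ℝ := fun x y => 2 * M * (y ^ 2 + 2 * N * x - x ^ 2) / N ^ 2
    + 4 * C * (2 * N * x - x ^ 2) with hψ
  have hψavg : ∀ x y, nbrAvg ψ x y = ψ x y - 2 * C := by
    intro x y
    simp only [nbrAvg, hψ]
    push_cast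
    field_simp
    ring
  have hvsub : ∀ x y : ℤ, 1 ≤ x → x < N → |y| < N → v x y ≤ nbrAvg v x y + 2 * C := by
    intro x y hx hxN hy
    have e1 := hC x y (by rw [abs_lt]; omega) hy
    have e2 := hC (1 - x) y (by rw [abs_lt]; omega) hy
    have e3 : |w x y - nbrAvg w x y| ≤ 2 * C := by
      have : w x y - nbrAvg w x y = (h x y - nbrAvg h x y) - (h (1 - x) y - nbrAvg h (1 - x) y) := by
        simp only [hw, nbrAvg]
        rw [show 1 - (x + 1) = 1 - x - 1 by ring, show 1 - (x - 1) = 1 - x + 1 by ring]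
        ring
      rw [this]
      exact (abs_sub _ _).trans (by linarith)
    rw [hvw _ _ hx]
    rcases eq_or_lt_of_le hx with rfl | hx
    -- Next to the reflection axis the left neighbour carries `-w 1 y`; replacing it by `0` errs in
    -- the favourable direction.
    · have e4 : w (1 - 1) y = - w 1 y := by simp [hw]
      simp only [nbrAvg, e4] at e3
      have e5 : v (1 - 1) y = 0 := by simp [hv]
      simp only [nbrAvg, e5]
      rw [hvw _ _ (by norm_num), hvw _ _ le_rfl, hvw _ _ le_rfl]
      have a1 := le_abs_self (w (1 + 1) y)
      have a2 := le_abs_self (w 1 (y + 1))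
      have a3 := le_abs_self (w 1 (y - 1))
      have b1 := neg_le_abs (w (1 + 1) y)
      have b2 := neg_le_abs (w 1 (y + 1))
      have b3 := neg_le_abs (w 1 (y - 1))
      obtain ⟨e3, e3'⟩ := abs_le.1 e3
      generalize w (1 + 1) y = α at *
      generalize w 1 (y + 1) = β at *
      generalize w 1 (y - 1) = γ at *
      rcases abs_cases (w 1 y) with ⟨hh, hs⟩ | ⟨hh, hs⟩ <;> rw [hh] <;> linarith
    · simp only [nbrAvg]
      rw [hvw _ _ (by omega), hvw _ _ (by omega), hvw _ _ (by omega), hvw _ _ (by omega)]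
      have a0 := le_abs_self (w (x - 1) y)
      have b0 := neg_le_abs (w (x - 1) y)
      have a1 := le_abs_self (w (x + 1) y)
      have a2 := le_abs_self (w x (y + 1))
      have a3 := le_abs_self (w x (y - 1))
      have b1 := neg_le_abs (w (x + 1) y)
      have b2 := neg_le_abs (w x (y + 1))
      have b3 := neg_le_abs (w x (y - 1))
      rw [abs_le] at e3
      simp only [nbrAvg] at e3
      rcases abs_cases (w x y) with ⟨hh, hs⟩ | ⟨hh, hs⟩ <;> rw [hh] <;> linarith [e3.1, e3.2]
  have hle : v 1 0 ≤ ψ 1 0 := by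
    -- For `N = 1` the open half box is empty and the trivial bound `2 * M` suffices.
    rcases eq_or_lt_of_le hN with hN1 | hN1
    · refine (hvM 1 0 (by omega) (by simp)).trans ?_
      simp only [hψ, ← hN1]; push_cast; linarith
    have := nonpos_of_le_nbrAvg (f := fun x y => v x y - ψ x y)
      (A := fun x y => 1 ≤ x ∧ x < N ∧ |y| < N)
      (finite_box _ N fun x y (hA : 1 ≤ x ∧ x < N ∧ |y| < N) => ⟨by rw [abs_le]; omega, hA.2.2.le⟩) ?_ ?_ 1 0 ?_
    · linarith
    · rintro x y ⟨h1, h2, h3⟩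
      have e1 := hvsub x y h1 h2 h3
      have e2 := hψavg x y
      simp only [nbrAvg] at e1 e2 ⊢
      linarith
    · rintro x y hn hA
      simp only [abs_lt] at hn hA
      have hx0 : 0 ≤ x := by omega
      have hxN : x ≤ N := by omega
      have hyN : |y| ≤ N := by rw [abs_le]; omega
      have hx0' : (0 : ℝ) ≤ x := by exact_mod_cast hx0
      have hxN' : (x : ℝ) ≤ N := by exact_mod_cast hxN
      have hq : 0 ≤ 2 * (N : ℝ) * x - x ^ 2 := by nlinarith
      have hq2 : 0 ≤ 4 * C * (2 * N * x - x ^ 2) := by positivity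
      rcases eq_or_lt_of_le hx0 with h0 | h0
      · subst h0
        have : v 0 y = 0 := by simp [hv]
        simp only [this, hψ]
        have : 0 ≤ 2 * M * ((y : ℝ) ^ 2 + 2 * N * (0 : ℤ) - (0 : ℤ) ^ 2) / N ^ 2 := by
          refine div_nonneg (mul_nonneg (by positivity) ?_) (by positivity)
          push_cast; linarith [sq_nonneg (y : ℝ)]
        linarith
      · have e1 := hvM x y hxN hyN
        have : 2 * M ≤ 2 * M * ((y : ℝ) ^ 2 + 2 * N * x - x ^ 2) / N ^ 2 := by
          rw [le_div_iff₀ (by positivity)]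
          apply mul_le_mul_of_nonneg_left _ (by positivity)
          have hc : x = N ∨ y = N ∨ y = -N := by omega
          rcases hc with hc | hc | hc
          · subst hc; push_cast; nlinarith [sq_nonneg (y : ℝ)]
          · subst hc; push_cast; linarith
          · subst hc; push_cast; linarith
        simp only [hψ]
        linarith
    · simp only [abs_zero]; omega
  have e1 : v 1 0 = |h 1 0 - h 0 0| := by simp [hv, hw]
  rw [← e1]
  refine hle.trans ?_
  have e2 : ψ 1 0 = 4 * M / N - 2 * M / N ^ 2 + (8 * C * N - 4 * C) := by
    simp only [hψ]; push_cast; field_simp; ring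
  have : 0 ≤ 2 * M / (N : ℝ) ^ 2 := by positivity
  rw [e2]; linarith

theorem abs_sub_up_le {h : ℤ → ℤ → ℝ} {N : ℕ} (hN : 1 ≤ N) {M C : ℝ}
    (hM : ∀ x y : ℤ, |x| ≤ N → |y| ≤ N → |h x y| ≤ M)
    (hC : ∀ x y : ℤ, |x| < N → |y| < N → |h x y - nbrAvg h x y| ≤ C) :
    |h 0 1 - h 0 0| ≤ 4 * M / N + 8 * C * N := by
  refine abs_sub_right_le (h := fun x y => h y x) hN (fun x y hx hy => hM y x hy hx)
    fun x y hx hy => ?_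
  convert hC y x hy hx using 2
  simp only [nbrAvg]; ring

/-- Discrete Lipschitz estimate in a box. -/
theorem abs_sub_le_of_nbrAvg {h : ℤ → ℤ → ℝ} {N : ℕ} (hN : 1 ≤ N) {M C : ℝ} {a b a' b' : ℤ} {n : ℕ}
    (hM : ∀ x y : ℤ, |x - a| ≤ N + n → |y - b| ≤ N + n → |h x y| ≤ M)
    (hC : ∀ x y : ℤ, |x - a| < N + n → |y - b| < N + n → |h x y - nbrAvg h x y| ≤ C)
    (ha : |a' - a| ≤ n) (hb : |b' - b| ≤ n) :
    |h a' b' - h a b| ≤ (4 * M / N + 8 * C * N) * (|a' - a| + |b' - b| : ℤ) := by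
  set K := 4 * M / N + 8 * C * N with hK
  -- A box of radius `N` about any point within `n` of the centre stays in the large box, so each
  -- unit step costs at most `K`; the steps are then summed along an L-shaped path.
  have stepx : ∀ x y : ℤ, |x - a| ≤ n → |y - b| ≤ n → |h (x + 1) y - h x y| ≤ K := by
    intro x y hx hy
    have := abs_sub_right_le (h := fun s t => h (x + s) (y + t)) hN (M := M) (C := C)
      (fun s t hs ht => hM _ _ (by rw [abs_le] at *; omega) (by rw [abs_le] at *; omega))
      (fun s t hs ht => by
        have := hC (x + s) (y + t) (by rw [abs_le] at hx; rw [abs_lt] at *; omega)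
          (by rw [abs_le] at hy; rw [abs_lt] at *; omega)
        simpa only [nbrAvg, add_assoc, add_sub_assoc] using this)
    simpa using this
  have stepy : ∀ x y : ℤ, |x - a| ≤ n → |y - b| ≤ n → |h x (y + 1) - h x y| ≤ K := by
    intro x y hx hy
    have := abs_sub_up_le (h := fun s t => h (x + s) (y + t)) hN (M := M) (C := C)
      (fun s t hs ht => hM _ _ (by rw [abs_le] at *; omega) (by rw [abs_le] at *; omega))
      (fun s t hs ht => by
        have := hC (x + s) (y + t) (by rw [abs_le] at hx; rw [abs_lt] at *; omega)
          (by rw [abs_le] at hy; rw [abs_lt] at *; omega)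
        simpa only [nbrAvg, add_assoc, add_sub_assoc] using this)
    simpa using this
  have line : ∀ (f : ℤ → ℝ) (c : ℤ), (∀ x, |x - c| ≤ n → |f (x + 1) - f x| ≤ K) →
      ∀ k : ℕ, k ≤ n → |f (c + k) - f c| ≤ K * k ∧ |f (c - k) - f c| ≤ K * k := by
    intro f c hf k
    induction k with
    | zero => simp
    | succ k ih =>
      intro hk
      obtain ⟨i1, i2⟩ := ih (by omega)
      have j1 := hf (c + k) (by rw [abs_le]; omega)
      have j2 := hf (c - (k + 1)) (by rw [abs_le]; omega)
      rw [show c - (k + 1) + 1 = c - (k : ℤ) by ring, abs_sub_comm] at j2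
      push_cast
      rw [← add_assoc]
      constructor
      · have := abs_sub_le (f (c + k + 1)) (f (c + k)) (f c)
        linarith
      · have := abs_sub_le (f (c - (k + 1))) (f (c - k)) (f c)
        linarith
  have line' : ∀ (f : ℤ → ℝ) (c c' : ℤ), (∀ x, |x - c| ≤ n → |f (x + 1) - f x| ≤ K) →
      |c' - c| ≤ n → |f c' - f c| ≤ K * |c' - c| := by
    intro f c c' hf hc
    have := line f c hf (c' - c).natAbs (by rw [abs_le] at hc; omega)
    have hcast : (((c' - c).natAbs : ℕ) : ℝ) = |((c' - c : ℤ) : ℝ)| := by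
      rw [Nat.cast_natAbs]; push_cast; rfl
    rw [hcast] at this
    rcases le_total 0 (c' - c) with h0 | h0
    · rw [show c + ((c' - c).natAbs : ℤ) = c' by omega] at this
      exact_mod_cast this.1
    · rw [show c - ((c' - c).natAbs : ℤ) = c' by omega] at this
      exact_mod_cast this.2
  have l1 := line' (fun x => h x b) a a' (fun x hx => stepx x b hx (by simp)) ha
  have l2 := line' (fun y => h a' y) b b' (fun y hy => stepy a' y ha hy) hb
  have := abs_sub_le (h a' b') (h a' b) (h a b)
  push_cast
  push_cast at l1 l2
  linarith

end

/-! ### Barriers and comparison for superharmonic functions -/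

noncomputable section

/-- A nonnegative superharmonic function in a half box that is at least `c` on the bottom side. -/
theorem le_of_le_bottom {S : ℤ → ℤ → ℝ} {a : ℤ} {L : ℕ} (hL : 1 ≤ L) {c : ℝ} (hc : 0 ≤ c)
    (hS : ∀ x y : ℤ, |x - a| ≤ L → 0 ≤ y → y ≤ L → 0 ≤ S x y)
    (hsup : ∀ x y : ℤ, |x - a| < L → 0 < y → y < L → nbrAvg S x y ≤ S x y)
    (hseg : ∀ x : ℤ, |x - a| ≤ L → c ≤ S x 0) (x y : ℤ) (hx : |x - a| ≤ L) (hy : 0 ≤ y)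
    (hyL : y ≤ L) :
    c * ((1 - y / L) ^ 2 - ((x - a) / L) ^ 2) ≤ S x y := by
  have hLpos : (0 : ℝ) < L := by exact_mod_cast hL
  -- The quadratic barrier is discrete harmonic, at most `c` on the bottom side and nonpositive on
  -- the other three, so only the boundary needs inspection.
  have hb : ∀ x y : ℤ, |x - a| ≤ L → 0 ≤ y → y ≤ L → ¬ (|x - a| < L ∧ 0 < y ∧ y < L) →
      c * ((1 - y / L) ^ 2 - ((x - a) / L) ^ 2) ≤ S x y := by
    intro x y hx hy hyL hn
    have h0 := hS x y hx hy hyL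
    rcases hy.eq_or_lt with rfl | hy0
    · refine le_trans ?_ (hseg x hx)
      have := sq_nonneg (((x : ℝ) - a) / L)
      rw [Int.cast_zero, zero_div]
      nlinarith
    · refine le_trans (mul_nonpos_of_nonneg_of_nonpos hc ?_) h0
      rcases hyL.eq_or_lt with rfl | hyL'
      · have := sq_nonneg (((x : ℝ) - a) / L)
        push_cast
        rw [div_self hLpos.ne']; linarith
      · have : x - a = L ∨ x - a = -L := by rw [abs_le] at hx; simp only [abs_lt] at hn; omega
        have h1 : (((x : ℝ) - a) / L) ^ 2 = 1 := by
          rw [div_pow, div_eq_one_iff_eq (by positivity)]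
          rcases this with h | h
          · have : (x : ℝ) - a = L := by exact_mod_cast h
            rw [this]
          · have : (x : ℝ) - a = -L := by exact_mod_cast h
            rw [this]; ring
        have h2 : (0 : ℝ) ≤ y / L := by positivity
        have h3 : (y : ℝ) / L ≤ 1 := by rw [div_le_one hLpos]; exact_mod_cast hyL
        nlinarith
  by_cases hA : |x - a| < L ∧ 0 < y ∧ y < L
  · have := nonpos_of_le_nbrAvg
      (f := fun x y => c * ((1 - y / L) ^ 2 - ((x - a) / L) ^ 2) - S x y)
      (A := fun x y => |x - a| < L ∧ 0 < y ∧ y < L)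
      (finite_box _ (|a| + L) fun x y (hA : |x - a| < L ∧ 0 < y ∧ y < L) => by
        constructor
        · have := abs_add_le (x - a) a
          rw [sub_add_cancel] at this; omega
        · have := abs_nonneg a
          rw [abs_le]; omega) ?_ ?_ x y hA
    · linarith
    · rintro x y ⟨h1, h2, h3⟩
      have e1 := hsup x y h1 h2 h3
      simp only [nbrAvg] at e1 ⊢
      push_cast
      have e2 : c * ((1 - y / L) ^ 2 - ((x - a) / L) ^ 2) =
        (c * ((1 - y / L) ^ 2 - ((x + 1 - a) / L) ^ 2) + c * ((1 - y / L) ^ 2 - ((x - 1 - a) / L) ^ 2)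
        + c * ((1 - (y + 1) / L) ^ 2 - ((x - a) / L) ^ 2)
        + c * ((1 - (y - 1) / L) ^ 2 - ((x - a) / L) ^ 2)) / 4 := by
        field_simp; ring
      linarith
    · intro x y hn hA
      have := hb x y (by simp only [abs_lt, abs_le] at *; omega) (by omega) (by omega) hn
      linarith
  · exact hb x y hx hy hyL hA

theorem le_log_of_four {a b c d n : ℝ} (ha : 0 < a) (hb : 0 < b) (hc : 0 < c) (hd : 0 < d)
    (h : a * b * c * d ≤ n ^ 4) :
    (Real.log a + Real.log b + Real.log c + Real.log d) / 4 ≤ Real.log n := by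
  have := Real.log_le_log (by positivity) h
  rw [Real.log_mul (by positivity) hd.ne', Real.log_mul (by positivity) hc.ne',
    Real.log_mul ha.ne' hb.ne', Real.log_pow] at this
  push_cast at this
  linarith

theorem log_le_of_four {a b c d n : ℝ} (ha : 0 < a) (hb : 0 < b) (hc : 0 < c) (hd : 0 < d)
    (hn : 0 < n) (h : n ^ 4 ≤ a * b * c * d) :
    Real.log n ≤ (Real.log a + Real.log b + Real.log c + Real.log d) / 4 := by
  have := Real.log_le_log (by positivity) h
  rw [Real.log_mul (by positivity) hd.ne', Real.log_mul (by positivity) hc.ne',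
    Real.log_mul ha.ne' hb.ne', Real.log_pow] at this
  push_cast at this
  linarith

/-- The function `log (|p|² - 1)` is superharmonic on the grid off a small ball. -/
theorem log_sub_one_superharmonic {x y : ℤ} (h : 9 ≤ x ^ 2 + y ^ 2) :
    nbrAvg (fun x y => Real.log ((x : ℝ) ^ 2 + (y : ℝ) ^ 2 - 1)) x y ≤
      Real.log ((x : ℝ) ^ 2 + (y : ℝ) ^ 2 - 1) := by
  have h' : (9 : ℝ) ≤ (x : ℝ) ^ 2 + (y : ℝ) ^ 2 := by exact_mod_cast h
  simp only [nbrAvg]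
  push_cast
  generalize (x : ℝ) = X at *
  generalize (y : ℝ) = Y at *
  have p1 : 0 < (X + 1) ^ 2 + Y ^ 2 - 1 := by nlinarith [sq_nonneg (X + 3), sq_nonneg (X + 2), sq_nonneg Y]
  have p2 : 0 < (X - 1) ^ 2 + Y ^ 2 - 1 := by nlinarith [sq_nonneg (X - 3), sq_nonneg (X - 2), sq_nonneg Y]
  have p3 : 0 < X ^ 2 + (Y + 1) ^ 2 - 1 := by nlinarith [sq_nonneg (Y + 3), sq_nonneg (Y + 2), sq_nonneg X]
  have p4 : 0 < X ^ 2 + (Y - 1) ^ 2 - 1 := by nlinarith [sq_nonneg (Y - 3), sq_nonneg (Y - 2), sq_nonneg X]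
  apply le_log_of_four p1 p2 p3 p4
  -- After exponentiating, the claim is that this difference is nonnegative. With `s = X ^ 2 + Y ^
  -- 2`, the bound `16 * X ^ 2 * Y ^ 2 ≤ 4 * s ^ 2` leaves at least `2 * s ^ 2 - 4 * s + 1`.
  have e : (X ^ 2 + Y ^ 2 - 1) ^ 4 - ((X + 1) ^ 2 + Y ^ 2 - 1) * ((X - 1) ^ 2 + Y ^ 2 - 1) *
      (X ^ 2 + (Y + 1) ^ 2 - 1) * (X ^ 2 + (Y - 1) ^ 2 - 1) =
      6 * (X ^ 2 + Y ^ 2) ^ 2 - 4 * (X ^ 2 + Y ^ 2) + 1 - 16 * X ^ 2 * Y ^ 2 := by ring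
  have e2 : 4 * (X ^ 2 + Y ^ 2) ^ 2 - 16 * X ^ 2 * Y ^ 2 = 4 * (X ^ 2 - Y ^ 2) ^ 2 := by ring
  nlinarith [sq_nonneg (X ^ 2 - Y ^ 2)]

/-- The loss in the comparison of a superharmonic function on a ball and on the five times larger
ball. -/
def ballConst : ℝ := Real.log (36 / 25) / Real.log 108

theorem ballConst_pos : 0 < ballConst :=
  div_pos (Real.log_pos (by norm_num)) (Real.log_pos (by norm_num))

theorem ballConst_le_one : ballConst ≤ 1 :=
  (div_le_one (Real.log_pos (by norm_num))).2 (Real.log_le_log (by norm_num) (by norm_num))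

/-- Comparison with the subharmonic function `log (36 t²) - log (|p|² - 1)` on the annulus outside
the ball of radius `t`. It is nonpositive at the outer boundary, at most `log 108` at the inner one,
and at least `log (36 / 25)` where `|p| ≤ 5 t`; the ratio is `ballConst`. -/
theorem le_of_le_ball {S : ℤ → ℤ → ℝ} {t : ℕ} (ht : 3 ≤ t) {c : ℝ} (hc : 0 ≤ c)
    (hS : ∀ x y : ℤ, |x| ≤ 6 * t + 1 → |y| ≤ 6 * t + 1 → 0 ≤ S x y)
    (hsup : ∀ x y : ℤ, |x| ≤ 6 * t → |y| ≤ 6 * t → nbrAvg S x y ≤ S x y)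
    (hball : ∀ x y : ℤ, x ^ 2 + y ^ 2 ≤ t ^ 2 → c ≤ S x y) (x y : ℤ)
    (hxy : x ^ 2 + y ^ 2 ≤ (5 * t) ^ 2) : c * ballConst ≤ S x y := by
  have ht' : (3 : ℝ) ≤ t := by exact_mod_cast ht
  have htz : (3 : ℤ) ≤ t := by exact_mod_cast ht
  have hl : 0 < Real.log 108 := Real.log_pos (by norm_num)
  by_cases hin : x ^ 2 + y ^ 2 ≤ (t : ℤ) ^ 2
  · exact (mul_le_of_le_one_right hc ballConst_le_one).trans (hball x y hin)
  set b : ℤ → ℤ → ℝ := fun x y => Real.log (36 * t ^ 2) - Real.log ((x : ℝ) ^ 2 + (y : ℝ) ^ 2 - 1)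
    with hb
  have hbox : ∀ x y : ℤ, x ^ 2 + y ^ 2 - 1 < 36 * (t : ℤ) ^ 2 → |x| ≤ 6 * t ∧ |y| ≤ 6 * t := by
    intro x y h
    constructor <;> apply abs_le_of_sq_le_sq _ (by positivity) <;> nlinarith
  have hfin := finite_box (fun x y => (t : ℤ) ^ 2 < x ^ 2 + y ^ 2 ∧ x ^ 2 + y ^ 2 - 1 < 36 * (t : ℤ) ^ 2)
    (6 * t) fun x y hA => hbox x y hA.2
  have := nonpos_of_le_nbrAvg (f := fun x y => c / Real.log 108 * b x y - S x y)
    (A := fun x y => (t : ℤ) ^ 2 < x ^ 2 + y ^ 2 ∧ x ^ 2 + y ^ 2 - 1 < 36 * (t : ℤ) ^ 2)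
    hfin ?_ ?_ x y ⟨by omega, by nlinarith⟩
  · have hlow : Real.log (36 / 25) ≤ b x y := by
      have hxy' : (x : ℝ) ^ 2 + (y : ℝ) ^ 2 ≤ (5 * t) ^ 2 := by exact_mod_cast hxy
      have hin' : (t : ℝ) ^ 2 < (x : ℝ) ^ 2 + (y : ℝ) ^ 2 := by exact_mod_cast not_le.1 hin
      have hp : 0 < (x : ℝ) ^ 2 + (y : ℝ) ^ 2 - 1 := by nlinarith
      simp only [hb]
      rw [← Real.log_div (by positivity) hp.ne']
      apply Real.log_le_log (by norm_num)
      rw [le_div_iff₀ hp]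
      nlinarith
    have : c / Real.log 108 * Real.log (36 / 25) ≤ c / Real.log 108 * b x y :=
      mul_le_mul_of_nonneg_left hlow (by positivity)
    have e : c * ballConst = c / Real.log 108 * Real.log (36 / 25) := by
      simp only [ballConst]; ring
    linarith
  · rintro x y ⟨h1, h2⟩
    have e1 := hsup x y (hbox x y h2).1 (hbox x y h2).2
    have e2 := log_sub_one_superharmonic (x := x) (y := y) (by nlinarith)
    have e3 : b x y ≤ nbrAvg b x y := by
      simp only [nbrAvg, hb] at e2 ⊢
      linarith
    have e4 := mul_le_mul_of_nonneg_left e3 (show 0 ≤ c / Real.log 108 by positivity)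
    simp only [nbrAvg] at e1 e4 ⊢
    linarith
  · intro x y hn hA
    -- A lattice step enters the ball by at most one unit, so inner boundary points have modulus at
    -- least `t - 1`. Then `36 t² / ((t - 1)² - 1) ≤ 108` because `t ≥ 3`; this is the source of
    -- `108`.
    have hin2 : ∀ x' : ℤ, ∀ y' : ℤ, (t : ℤ) ^ 2 < (x' + 1) ^ 2 + y' ^ 2 ∨
        (t : ℤ) ^ 2 < (x' - 1) ^ 2 + y' ^ 2 → ((t : ℤ) - 1) ^ 2 ≤ x' ^ 2 + y' ^ 2 := by
      intro x' y' h
      by_contra! hlt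
      have : |x'| < (t : ℤ) - 1 := abs_lt_of_sq_lt_sq (by nlinarith) (by omega)
      rw [abs_lt] at this
      rcases h with h | h <;> nlinarith
    have hsm : ((t : ℤ) - 1) ^ 2 ≤ x ^ 2 + y ^ 2 := by
      rcases hA with h | h | h | h
      · exact hin2 x y (Or.inl h.1)
      · exact hin2 x y (Or.inr h.1)
      · rw [add_comm]; exact hin2 y x (Or.inl (by linarith [h.1]))
      · rw [add_comm]; exact hin2 y x (Or.inr (by linarith [h.1]))
    have hsm' : ((t : ℝ) - 1) ^ 2 ≤ (x : ℝ) ^ 2 + (y : ℝ) ^ 2 := by exact_mod_cast hsm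
    have hp : 0 < (x : ℝ) ^ 2 + (y : ℝ) ^ 2 - 1 := by nlinarith
    by_cases hxt : x ^ 2 + y ^ 2 ≤ (t : ℤ) ^ 2
    · have e1 := hball x y hxt
      have e2 : b x y ≤ Real.log 108 := by
        simp only [hb]
        rw [← Real.log_div (by positivity) hp.ne']
        apply Real.log_le_log (by positivity)
        rw [div_le_iff₀ hp]
        nlinarith
      have := mul_le_mul_of_nonneg_left e2 (show 0 ≤ c / Real.log 108 by positivity)
      rw [div_mul_cancel₀ _ hl.ne'] at this
      linarith
    · have hout : 36 * (t : ℤ) ^ 2 ≤ x ^ 2 + y ^ 2 - 1 := by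
        by_contra! h; exact hn ⟨by omega, h⟩
      have hout' : 36 * (t : ℝ) ^ 2 ≤ (x : ℝ) ^ 2 + (y : ℝ) ^ 2 - 1 := by exact_mod_cast hout
      have e2 : b x y ≤ 0 := by
        simp only [hb]
        have := Real.log_le_log (by positivity) hout'
        linarith
      have e3 : 0 ≤ S x y := by
        have : |x| ≤ 6 * t + 1 ∧ |y| ≤ 6 * t + 1 := by
          simp only [abs_le]
          rcases hA with h | h | h | h <;> have := hbox _ _ h.2 <;> simp only [abs_le] at this <;>
            omega
        exact hS x y this.1 this.2
      have := mul_nonpos_of_nonneg_of_nonpos (show 0 ≤ c / Real.log 108 by positivity) e2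
      linarith

/-- The loss in the comparison of a superharmonic function on a half axis and on the opposite half
axis. -/
def axisConst : ℝ := min (1 / 16) (ballConst / 2)

theorem axisConst_pos : 0 < axisConst := lt_min (by norm_num) (half_pos ballConst_pos)

/-- Half boxes above and below the segment `[0, 8t]` of the axis give `S ≥ M / 2` on the ball of
radius `t` about `(4t, 0)`; the five times larger concentric ball contains `(-t, 0)`. -/
theorem le_opposite_axis {S : ℤ → ℤ → ℝ} {N : ℕ} {M : ℝ} (hM : 0 ≤ M)
    (hS : ∀ x y : ℤ, |x| ≤ N → |y| ≤ N → 0 ≤ S x y)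
    (hsup : ∀ x y : ℤ, |x| < N → |y| < N → nbrAvg S x y ≤ S x y)
    (hax : ∀ x : ℤ, 0 ≤ x → x ≤ N → M ≤ S x 0) (t : ℕ) (ht : 16 * t ≤ N) :
    axisConst * M ≤ S (-t) 0 := by
  have hc16 : axisConst * M ≤ 1 / 16 * M := mul_le_mul_of_nonneg_right (min_le_left _ _) hM
  have h0 : M ≤ S 0 0 := hax 0 le_rfl (by positivity)
  have nb : ∀ k : ℕ, k + 1 < N → S (-k) 0 / 4 ≤ S (-(k + 1)) 0 := by
    intro k hk
    have e := hsup (-(k + 1)) 0 (by rw [abs_lt]; omega) (by rw [abs_lt]; omega)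
    have e1 := hS (-(k + 1) - 1) 0 (by rw [abs_le]; omega) (by rw [abs_le]; omega)
    have e2 := hS (-(k + 1)) (0 + 1) (by rw [abs_le]; omega) (by rw [abs_le]; omega)
    have e3 := hS (-(k + 1)) (0 - 1) (by rw [abs_le]; omega) (by rw [abs_le]; omega)
    simp only [nbrAvg] at e
    rw [show (-(k + 1) + 1 : ℤ) = -k by ring] at e
    generalize S (-(k + 1) - 1) 0 = α at *
    generalize S (-(k + 1)) (0 + 1) = β at *
    generalize S (-(k + 1)) (0 - 1) = γ at *
    linarith
  -- The logarithmic barrier needs `t ≥ 3`. Closer to the origin, each step to the left loses only a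
  -- factor `4`, whence the `1 / 16` in `axisConst`.
  by_cases ht3 : t < 3
  · interval_cases t
    · simp; linarith
    · have := nb 0 (by omega)
      simp at this ⊢; linarith
    · have h1 := nb 0 (by omega)
      have h2 := nb 1 (by omega)
      norm_num at h1 h2 ⊢; linarith
  push Not at ht3
  have ht' : (3 : ℝ) ≤ t := by exact_mod_cast ht3
  have up := le_of_le_bottom (S := S) (a := 4 * t) (L := 4 * t) (by omega) hM
    (fun x y hx hy hyL => hS x y (by rw [abs_le] at *; omega) (by rw [abs_le]; omega))
    (fun x y hx hy hyL => hsup x y (by rw [abs_lt] at *; omega) (by rw [abs_lt]; omega))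
    (fun x hx => hax x (by rw [abs_le] at hx; omega) (by rw [abs_le] at hx; omega))
  have dn := le_of_le_bottom (S := fun x y => S x (-y)) (a := 4 * t) (L := 4 * t) (by omega) hM
    (fun x y hx hy hyL => hS x (-y) (by rw [abs_le] at *; omega) (by rw [abs_le]; omega))
    (fun x y hx hy hyL => by
      have := hsup x (-y) (by rw [abs_lt] at *; omega) (by rw [abs_lt]; omega)
      simp only [nbrAvg] at this ⊢
      rw [neg_add, neg_sub', ← sub_eq_add_neg, sub_neg_eq_add]; linarith)
    (fun x hx => by simpa using hax x (by rw [abs_le] at hx; omega) (by rw [abs_le] at hx; omega))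
  -- Here `1 / 2 = (3 / 4) ^ 2 - (1 / 4) ^ 2`, the ball of radius `t` seen in half boxes of size `4
  -- * t`.
  have small : ∀ X Y : ℝ, 0 ≤ Y → X ^ 2 + Y ^ 2 ≤ t ^ 2 →
      1 / 2 ≤ (1 - Y / (4 * t)) ^ 2 - (X / (4 * t)) ^ 2 := by
    intro X Y hY h
    have hY' : Y ≤ t := abs_le_of_sq_le_sq' (by nlinarith [sq_nonneg X]) (by positivity) |>.2
    have e1 : Y / (4 * t) ≤ 1 / 4 := by rw [div_le_iff₀ (by positivity)]; linarith
    have e2 : (X / (4 * t)) ^ 2 ≤ 1 / 16 := by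
      rw [div_pow, div_le_iff₀ (by positivity)]; nlinarith [sq_nonneg Y]
    nlinarith
  have hball : ∀ x y : ℤ, x ^ 2 + y ^ 2 ≤ (t : ℤ) ^ 2 → M / 2 ≤ S (4 * t + x) y := by
    intro x y h
    have h' : (x : ℝ) ^ 2 + (y : ℝ) ^ 2 ≤ (t : ℝ) ^ 2 := by exact_mod_cast h
    have hx : |x| ≤ t := abs_le_of_sq_le_sq (by nlinarith [sq_nonneg y]) (by positivity)
    have hy : |y| ≤ t := abs_le_of_sq_le_sq (by nlinarith [sq_nonneg x]) (by positivity)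
    rw [abs_le] at hx hy
    rcases le_total 0 y with h0 | h0
    · have e := up (4 * t + x) y (by rw [abs_le]; push_cast; omega) h0 (by push_cast; omega)
      have s := small x y (by exact_mod_cast h0) h'
      have := mul_le_mul_of_nonneg_left s hM
      push_cast at e
      rw [add_sub_cancel_left] at e
      linarith
    · have e := dn (4 * t + x) (-y) (by rw [abs_le]; push_cast; omega) (by omega)
        (by push_cast; omega)
      have h0' : (y : ℝ) ≤ 0 := by exact_mod_cast h0
      have s := small x (-y) (by linarith) (by rw [neg_sq]; exact h')
      have := mul_le_mul_of_nonneg_left s hM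
      push_cast at e
      rw [add_sub_cancel_left, neg_neg] at e
      linarith
  have := le_of_le_ball (S := fun x y => S (4 * t + x) y) ht3 (c := M / 2) (by positivity)
    (fun x y hx hy => hS _ y (by rw [abs_le] at *; omega) (by rw [abs_le] at *; omega))
    (fun x y hx hy => by
      have := hsup (4 * t + x) y (by rw [abs_le] at *; rw [abs_lt]; omega)
        (by rw [abs_le] at *; rw [abs_lt]; omega)
      simpa only [nbrAvg, add_assoc, add_sub_assoc] using this)
    hball (-(5 * t)) 0 (by ring_nf; rfl)
  rw [show (4 * t + -(5 * t) : ℤ) = -t by ring] at this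
  refine le_trans ?_ this
  have : axisConst * M ≤ ballConst / 2 * M := mul_le_mul_of_nonneg_right (min_le_right _ _) hM
  linarith

end

/-! ### Weak Beurling estimate on the double cover -/

noncomputable section

/-- `P` selects a sheet of the double cover of the grid branched at the origin over the support of
`h`, where the two sheets are exchanged on crossing the positive half axis from below. -/
structure IsSheet (h : ℤ → ℤ → ℝ) (P : ℤ → ℤ → Prop) : Prop where
  right : ∀ x y, h x y ≠ 0 → h (x + 1) y ≠ 0 → (P x y ↔ P (x + 1) y)
  up : ∀ x y, h x y ≠ 0 → h x (y + 1) ≠ 0 → ¬ (y = -1 ∧ 0 < x) → (P x y ↔ P x (y + 1))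
  cut : ∀ x, 0 < x → h x (-1) ≠ 0 → h x 0 ≠ 0 → (P x (-1) ↔ ¬ P x 0)

theorem IsSheet.compl {h : ℤ → ℤ → ℝ} {P : ℤ → ℤ → Prop} (hP : IsSheet h P) :
    IsSheet h (fun x y => ¬ P x y) where
  right x y h1 h2 := not_congr (hP.right x y h1 h2)
  up x y h1 h2 h3 := not_congr (hP.up x y h1 h2 h3)
  cut x h0 h1 h2 := not_congr (hP.cut x h0 h1 h2)

/-- Reflection carries the cut to the negative half axis. Exchanging the sheets in the lower half
plane toggles the cut along the whole line, so it moves back to the positive half axis. The crossing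
over the origin itself imposes nothing, since `h` vanishes there. -/
theorem IsSheet.reflect {h : ℤ → ℤ → ℝ} {P : ℤ → ℤ → Prop} (hP : IsSheet h P) (h00 : h 0 0 = 0) :
    IsSheet (fun x y => h (-x) y) (fun x y => P (-x) y ↔ 0 ≤ y) where
  right x y h1 h2 := by
    have := hP.right (-(x + 1)) y h2 (by simpa using h1)
    rw [show -(x + 1) + 1 = -x by ring] at this
    rw [this]
  up x y h1 h2 h3 := by
    by_cases hy : y = -1
    · subst hy
      have h2' : h (-x) 0 ≠ 0 := by simpa using h2
      have hx : 0 < -x := by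
        rcases lt_trichotomy x 0 with h | h | h
        · omega
        · subst h; simp [h00] at h2'
        · exact absurd ⟨rfl, h⟩ h3
      have := hP.cut (-x) hx h1 h2'
      simp only [neg_add_cancel, le_refl, iff_true]
      have e : ¬ (0 : ℤ) ≤ -1 := by norm_num
      tauto
    · have := hP.up (-x) y h1 h2 (fun h => hy h.1)
      have e : 0 ≤ y ↔ 0 ≤ y + 1 := by omega
      rw [this, e]
  cut x hx h1 h2 := by
    have := hP.up (-x) (-1) h1 (by simpa using h2) (by omega)
    rw [neg_add_cancel] at this
    have e : ¬ (0 : ℤ) ≤ -1 := by norm_num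
    simp only [le_refl, iff_true]
    tauto

-- This is the gain at the branch point. The part of `h` on one sheet is added to its mirror image
-- in the horizontal axis. On the cut the two contributions come from opposite sheets and add up to
-- `h ≤ M` instead of `2 * M`; on the negative axis they coincide and give `2 * h`. Thus `2 * M`
-- minus the sum is superharmonic off the cut and at least `M` on it, and `le_opposite_axis`
-- applies.
open Classical in
theorem IsSheet.le_neg_axis {h : ℤ → ℤ → ℝ} {P : ℤ → ℤ → Prop} (hP : IsSheet h P) {N : ℕ} {M : ℝ}
    (h0 : ∀ x y, 0 ≤ h x y) (h00 : h 0 0 = 0)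
    (hM : ∀ x y : ℤ, |x| ≤ N → |y| ≤ N → h x y ≤ M)
    (hsub : ∀ x y : ℤ, |x| < N → |y| < N → h x y ≤ nbrAvg h x y) (t : ℕ) (ht : 16 * t ≤ N)
    (hPt : P (-t) 0) : h (-t) 0 ≤ (1 - axisConst / 2) * M := by
  have hM0 : 0 ≤ M := (h0 0 0).trans (hM 0 0 (by simp) (by simp))
  set F : ℤ → ℤ → ℝ := fun x y => if P x y then h x y else 0 with hF
  have hF0 : ∀ x y, 0 ≤ F x y := fun x y => by
    simp only [hF]; split_ifs; exacts [h0 x y, le_rfl]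
  have hFh : ∀ x y, F x y ≤ h x y := fun x y => by
    simp only [hF]; split_ifs; exacts [le_rfl, h0 x y]
  -- Where `F` is nonzero, a neighbour not across the cut is on the same sheet or is a zero of `h`.
  -- So `F` dominates `h` there, and subharmonicity passes from `h` to `F`.
  have move : ∀ x y x' y', F x y ≠ 0 → (h x y ≠ 0 → h x' y' ≠ 0 → (P x y ↔ P x' y')) →
      h x' y' ≤ F x' y' := by
    intro x y x' y' hne hiff
    by_cases h' : h x' y' = 0
    · rw [h']; exact hF0 _ _
    · have hp : P x y := by by_contra hp; simp [hF, hp] at hne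
      have hh : h x y ≠ 0 := fun e => by simp [hF, hp, e] at hne
      have : P x' y' := (hiff hh h').1 hp
      simp [hF, this]
  have mr : ∀ x y, F x y ≠ 0 → h (x + 1) y ≤ F (x + 1) y := fun x y hne =>
    move x y _ _ hne (hP.right x y)
  have ml : ∀ x y, F x y ≠ 0 → h (x - 1) y ≤ F (x - 1) y := fun x y hne =>
    move x y _ _ hne fun h1 h2 => by
      have := hP.right (x - 1) y h2 (by simpa using h1)
      rw [sub_add_cancel] at this; exact this.symm
  have mu : ∀ x y, ¬ (y = -1 ∧ 0 < x) → F x y ≠ 0 → h x (y + 1) ≤ F x (y + 1) := fun x y hn hne =>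
    move x y _ _ hne fun h1 h2 => hP.up x y h1 h2 hn
  have md : ∀ x y, ¬ (y = 0 ∧ 0 < x) → F x y ≠ 0 → h x (y - 1) ≤ F x (y - 1) := fun x y hn hne =>
    move x y _ _ hne fun h1 h2 => by
      have := hP.up x (y - 1) h2 (by simpa using h1) (by omega)
      rw [sub_add_cancel] at this; exact this.symm
  have mc : ∀ x, 0 < x → F x (-1) ≠ 0 → h x 0 ≤ h x 0 - F x 0 := by
    intro x hx hne
    by_cases h' : h x 0 = 0
    · have := hFh x 0; linarith
    · have hp : P x (-1) := by by_contra hp; simp [hF, hp] at hne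
      have hh : h x (-1) ≠ 0 := fun e => by simp [hF, hp, e] at hne
      have : ¬ P x 0 := (hP.cut x hx hh h').1 hp
      simp [hF, this]
  have Fsub : ∀ x y, F x y ≠ 0 → |x| < N → |y| < N → F x y ≤ nbrAvg h x y := fun x y _ hx hy =>
    (hFh x y).trans (hsub x y hx hy)
  have subU : ∀ x y : ℤ, |x| < N → |y| < N → (0 < y ∨ y = 0 ∧ x < 0) →
      F x y ≤ nbrAvg F x y := by
    intro x y hx hy hy0
    by_cases hne : F x y = 0
    · rw [hne]; unfold nbrAvg
      have := hF0 (x + 1) y; have := hF0 (x - 1) y; have := hF0 x (y + 1); have := hF0 x (y - 1)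
      positivity
    · have := Fsub x y hne hx hy
      have := mr x y hne; have := ml x y hne
      have := mu x y (by omega) hne; have := md x y (by omega) hne
      unfold nbrAvg at *; linarith
  -- `E` continues `F` from below across the cut: on the nonnegative half axis it takes the value on
  -- the other sheet.
  set E : ℤ → ℤ → ℝ := fun x y => if y = 0 ∧ 0 ≤ x then h x 0 - F x 0 else F x y with hE
  have hE0 : ∀ x y, 0 ≤ E x y := fun x y => by
    simp only [hE]; split_ifs
    · linarith [hFh x 0]
    · exact hF0 x y
  have subD : ∀ x y : ℤ, |x| < N → |y| < N → y < 0 → F x y ≤ nbrAvg E x y := by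
    intro x y hx hy hy0
    by_cases hne : F x y = 0
    · rw [hne]; unfold nbrAvg
      have := hE0 (x + 1) y; have := hE0 (x - 1) y; have := hE0 x (y + 1); have := hE0 x (y - 1)
      positivity
    · have := Fsub x y hne hx hy
      have i1 := mr x y hne
      have i2 := ml x y hne
      have i3 := md x y (by omega) hne
      have e1 : E (x + 1) y = F (x + 1) y := by simp only [hE]; rw [if_neg (by omega)]
      have e2 : E (x - 1) y = F (x - 1) y := by simp only [hE]; rw [if_neg (by omega)]
      have e3 : E x (y - 1) = F x (y - 1) := by simp only [hE]; rw [if_neg (by omega)]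
      have i4 : h x (y + 1) ≤ E x (y + 1) := by
        by_cases hc : y = -1 ∧ 0 ≤ x
        · obtain ⟨rfl, hx0⟩ := hc
          simp only [hE]; rw [if_pos (by omega)]
          rcases hx0.eq_or_lt with rfl | hx0
          · have := hFh 0 0
            norm_num [h00] at this ⊢; linarith
          · exact mc x hx0 hne
        · simp only [hE]; rw [if_neg (by omega)]
          exact mu x y (by omega) hne
      unfold nbrAvg at *; rw [e1, e2, e3]; linarith
  -- On the nonnegative half axis, `h` is the upper value `F` plus the continuation `E` from below;
  -- this is what makes `Q` subharmonic right up to the cut.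
  set Q : ℤ → ℤ → ℝ := fun x y => if y = 0 ∧ 0 ≤ x then h x 0 else F x y + F x (-y) with hQ
  have Qneg : ∀ x y, Q x (-y) = Q x y := by
    intro x y
    simp only [hQ, neg_eq_zero, neg_neg, add_comm]
  have Qpos : ∀ x y : ℤ, 0 < y → Q x y = F x y + F x (-y) := fun x y hy => by
    simp only [hQ]; rw [if_neg (by omega)]
  have QE : ∀ x y : ℤ, 0 ≤ y → F x y + E x (-y) ≤ Q x y := by
    intro x y hy
    simp only [hQ, hE]
    by_cases hc : y = 0 ∧ 0 ≤ x
    · obtain ⟨rfl, hx⟩ := hc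
      simp [hx]
    · rw [if_neg (by omega), if_neg hc]
  have QsubU : ∀ x y : ℤ, |x| < N → |y| < N → 0 < y → Q x y ≤ nbrAvg Q x y := by
    intro x y hx hy hy0
    have e1 := subU x y hx hy (Or.inl hy0)
    have e2 := subD x (-y) hx (by simpa using hy) (by omega)
    have q1 := QE (x + 1) y hy0.le
    have q2 := QE (x - 1) y hy0.le
    have q3 := QE x (y + 1) (by omega)
    have q4 := QE x (y - 1) (by omega)
    rw [Qpos x y hy0]
    unfold nbrAvg at *
    rw [show -(y + 1) = -y - 1 by ring] at q3
    rw [show -(y - 1) = -y + 1 by ring] at q4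
    linarith
  have Qsub : ∀ x y : ℤ, |x| < N → |y| < N → ¬ (y = 0 ∧ 0 ≤ x) → Q x y ≤ nbrAvg Q x y := by
    intro x y hx hy hc
    rcases lt_trichotomy y 0 with h | rfl | h
    · have := QsubU x (-y) hx (by simpa using hy) (by omega)
      unfold nbrAvg at *
      rw [show -y + 1 = -(y - 1) by ring, show -y - 1 = -(y + 1) by ring] at this
      simp only [Qneg] at this
      linarith
    · have hx0 : x < 0 := by omega
      have e1 := subU x 0 hx hy (Or.inr ⟨rfl, hx0⟩)
      have q0 : Q x 0 = F x 0 + F x 0 := by simp [hQ, hx0]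
      have q1 : Q x (0 + 1) = F x (0 + 1) + F x (0 - 1) := by
        rw [Qpos _ _ (by norm_num)]; norm_num
      have q2 : Q x (0 - 1) = F x (0 + 1) + F x (0 - 1) := by
        rw [← q1, show (0 : ℤ) - 1 = -(0 + 1) by norm_num, Qneg]
      have q3 : ∀ x', x' ≤ 0 → F x' 0 + F x' 0 ≤ Q x' 0 := by
        intro x' hx'
        rcases hx'.eq_or_lt with rfl | hx'
        · have := hFh 0 0
          simp [hQ, h00] at this ⊢; linarith
        · simp only [hQ]; rw [if_neg (by omega), neg_zero]
      have q4 := q3 (x + 1) (by omega)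
      have q5 := q3 (x - 1) (by omega)
      unfold nbrAvg at *
      rw [q0, q1, q2]; linarith
    · exact QsubU x y hx hy h
  have Q2M : ∀ x y : ℤ, |x| ≤ N → |y| ≤ N → Q x y ≤ 2 * M := by
    intro x y hx hy
    simp only [hQ]; split_ifs
    · linarith [hM x 0 hx (by simp)]
    · have := hM x y hx hy
      have := hM x (-y) hx (by simpa using hy)
      have := hFh x y
      have := hFh x (-y)
      linarith
  -- Truncation at `M` makes `S` superharmonic on the cut too, since there it equals its maximum.
  set S : ℤ → ℤ → ℝ := fun x y => if y = 0 ∧ 0 ≤ x then M else min (2 * M - Q x y) M with hS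
  have SM : ∀ x y, S x y ≤ M := fun x y => by
    simp only [hS]; split_ifs; exacts [le_rfl, min_le_right _ _]
  have SQ : ∀ x y : ℤ, |x| ≤ N → |y| ≤ N → S x y ≤ 2 * M - Q x y := by
    intro x y hx hy
    simp only [hS]; split_ifs with hc
    · obtain ⟨rfl, hc⟩ := hc
      have := hM x 0 hx hy
      simp only [hQ, hc, and_self, if_true]; linarith
    · exact min_le_left _ _
  have := le_opposite_axis (S := S) (N := N) hM0 ?_ ?_ ?_ t ht
  · rcases Nat.eq_zero_or_pos t with rfl | htp
    · simp [h00]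
      have : axisConst ≤ 1 / 16 := min_le_left _ _
      exact mul_nonneg (by linarith) hM0
    · have e : S (-t) 0 ≤ 2 * M - (F (-t) 0 + F (-t) 0) := by
        have := SQ (-t) 0 (by rw [abs_le]; omega) (by simp)
        simp only [hQ] at this
        rwa [if_neg (by omega), neg_zero] at this
      have : F (-t) 0 = h (-t) 0 := by simp [hF, hPt]
      linarith
  · intro x y hx hy
    simp only [hS]; split_ifs
    · exact hM0
    · exact le_min (by linarith [Q2M x y hx hy]) hM0
  · intro x y hx hy
    have s1 := SM (x + 1) y
    have s2 := SM (x - 1) y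
    have s3 := SM x (y + 1)
    have s4 := SM x (y - 1)
    by_cases hc : y = 0 ∧ 0 ≤ x
    · have : S x y = M := by simp [hS, hc]
      unfold nbrAvg; linarith
    · have e : S x y = min (2 * M - Q x y) M := by simp only [hS]; rw [if_neg hc]
      rw [e]
      rw [abs_lt] at hx hy
      apply le_min
      · have q1 := SQ (x + 1) y (by rw [abs_le]; omega) (by rw [abs_le]; omega)
        have q2 := SQ (x - 1) y (by rw [abs_le]; omega) (by rw [abs_le]; omega)
        have q3 := SQ x (y + 1) (by rw [abs_le]; omega) (by rw [abs_le]; omega)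
        have q4 := SQ x (y - 1) (by rw [abs_le]; omega) (by rw [abs_le]; omega)
        have := Qsub x y (by rw [abs_lt]; omega) (by rw [abs_lt]; omega) hc
        unfold nbrAvg at *; linarith
      · unfold nbrAvg; linarith
  · intro x hx _
    simp [hS, hx]

/-- The factor gained in the decay of subharmonic functions near a branch point. -/
def decayConst : ℝ := 1 - axisConst / 8

theorem decayConst_lt_one : decayConst < 1 := by
  have := axisConst_pos
  unfold decayConst; linarith

theorem decayConst_nonneg : 0 ≤ decayConst := by
  have : axisConst ≤ 1 / 16 := min_le_left _ _
  unfold decayConst; linarith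

/-- The gain holds on both half axes up to distance `4 * n`, using the complementary sheet and the
reflected one. Half boxes of size `2 * n` resting on the axis spread it to all heights up to `n`, at
the price of a factor `(1 - 1 / 2) ^ 2 = 1 / 4`. -/
theorem IsSheet.le_decayConst_mul {h : ℤ → ℤ → ℝ} {P : ℤ → ℤ → Prop} (hP : IsSheet h P) {n : ℕ}
    {M : ℝ} (h0 : ∀ x y, 0 ≤ h x y) (h00 : h 0 0 = 0)
    (hM : ∀ x y : ℤ, |x| ≤ 64 * n → |y| ≤ 64 * n → h x y ≤ M)
    (hsub : ∀ x y : ℤ, |x| < 64 * n → |y| < 64 * n → h x y ≤ nbrAvg h x y) (x y : ℤ)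
    (hx : |x| ≤ n) (hy : |y| ≤ n) : h x y ≤ decayConst * M := by
  have hM0 : 0 ≤ M := (h0 0 0).trans (hM 0 0 (by simp) (by simp))
  have h00' : (fun x y => h (-x) y) 0 0 = 0 := by simpa using h00
  have half : ∀ g : ℤ → ℤ → ℝ, ∀ P, IsSheet g P → (∀ x y, 0 ≤ g x y) → g 0 0 = 0 →
      (∀ x y : ℤ, |x| ≤ 64 * n → |y| ≤ 64 * n → g x y ≤ M) →
      (∀ x y : ℤ, |x| < 64 * n → |y| < 64 * n → g x y ≤ nbrAvg g x y) →
      ∀ t : ℕ, t ≤ 4 * n → g (-t) 0 ≤ (1 - axisConst / 2) * M := by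
    intro g P hP g0 g00 gM gsub t ht
    by_cases hPt : P (-t) 0
    · exact hP.le_neg_axis (N := 64 * n) g0 g00 (by exact_mod_cast gM) (by exact_mod_cast gsub) t
        (by omega) hPt
    · exact hP.compl.le_neg_axis (N := 64 * n) g0 g00 (by exact_mod_cast gM)
        (by exact_mod_cast gsub) t (by omega) hPt
  have axis : ∀ x : ℤ, |x| ≤ 4 * n → h x 0 ≤ (1 - axisConst / 2) * M := by
    intro x hx
    rw [abs_le] at hx
    rcases le_total x 0 with hx0 | hx0
    · have := half h P hP h0 h00 hM hsub x.natAbs (by omega)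
      rwa [show (-(x.natAbs : ℤ)) = x by omega] at this
    · have := half (fun x y => h (-x) y) _ (hP.reflect h00) (fun x y => h0 _ _) h00'
        (fun x y hx hy => hM _ _ (by simpa using hx) hy)
        (fun x y hx hy => by
          have := hsub (-x) y (by simpa using hx) hy
          simp only [nbrAvg] at *
          rw [neg_add', neg_sub, sub_eq_neg_add 1 x]
          linarith) x.natAbs (by omega)
      simp only [neg_neg] at this
      rwa [show (x.natAbs : ℤ) = x by omega] at this
  rcases Nat.eq_zero_or_pos n with rfl | hn
  · obtain rfl : x = 0 := by simpa using hx
    obtain rfl : y = 0 := by simpa using hy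
    rw [h00]; exact mul_nonneg decayConst_nonneg hM0
  have hc : 0 ≤ axisConst / 2 * M := mul_nonneg (half_pos axisConst_pos).le hM0
  have hn' : (0 : ℝ) < n := by exact_mod_cast hn
  have fin : ∀ g : ℤ → ℤ → ℝ, (∀ x : ℤ, |x| ≤ 4 * n → g x 0 ≤ (1 - axisConst / 2) * M) →
      (∀ x y : ℤ, |x| ≤ 64 * n → |y| ≤ 64 * n → g x y ≤ M) →
      (∀ x y : ℤ, |x| < 64 * n → |y| < 64 * n → g x y ≤ nbrAvg g x y) →
      ∀ x y : ℤ, |x| ≤ n → 0 ≤ y → y ≤ n → g x y ≤ decayConst * M := by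
    intro g gax gM gsub x y hx hy0 hyn
    rw [abs_le] at hx
    have := le_of_le_bottom (S := fun x y => M - g x y) (a := x) (L := 2 * n) (by omega) hc
      (fun x y hx hy hyL => sub_nonneg.2 (gM x y (by rw [abs_le] at *; omega)
        (by rw [abs_le]; omega)))
      (fun x y hx hy hyL => by
        have := gsub x y (by rw [abs_lt] at *; omega) (by rw [abs_lt]; omega)
        unfold nbrAvg at *; linarith)
      (fun x hx => by
        have := gax x (by rw [abs_le] at *; omega)
        linarith) x y (by simp) hy0 (by omega)
    have e : (1 : ℝ) / 4 ≤ (1 - y / ((2 * n : ℕ) : ℝ)) ^ 2 - ((x - x) / ((2 * n : ℕ) : ℝ)) ^ 2 := by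
      push_cast
      have : (y : ℝ) / (2 * n) ≤ 1 / 2 := by
        rw [div_le_iff₀ (by positivity)]
        have : (y : ℝ) ≤ n := by exact_mod_cast hyn
        linarith
      rw [sub_self, zero_div]
      nlinarith
    have := mul_le_mul_of_nonneg_left e hc
    unfold decayConst
    linarith
  rw [abs_le] at hy
  rcases le_total 0 y with hy0 | hy0
  · exact fin h axis hM hsub x y hx hy0 hy.2
  · have := fin (fun x y => h x (-y)) (fun x hx => by simpa using axis x hx)
      (fun x y hx hy => hM _ _ hx (by simpa using hy))
      (fun x y hx hy => by
        have := hsub x (-y) hx (by simpa using hy)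
        simp only [nbrAvg] at *
        rw [neg_add', neg_sub, sub_eq_neg_add 1 y]
        linarith) x (-y) hx (by omega) (by omega)
    simpa using this

/-- Weak Beurling estimate: a nonnegative subharmonic function whose support has a two-valued square
root sheet at a zero decays near that zero. -/
theorem IsSheet.le_decayConst_pow_mul {h : ℤ → ℤ → ℝ} {P : ℤ → ℤ → Prop} (hP : IsSheet h P) {n : ℕ}
    {M : ℝ} (h0 : ∀ x y, 0 ≤ h x y) (h00 : h 0 0 = 0) (k : ℕ)
    (hM : ∀ x y : ℤ, |x| ≤ 64 ^ k * n → |y| ≤ 64 ^ k * n → h x y ≤ M)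
    (hsub : ∀ x y : ℤ, |x| < 64 ^ k * n → |y| < 64 ^ k * n → h x y ≤ nbrAvg h x y) (x y : ℤ)
    (hx : |x| ≤ n) (hy : |y| ≤ n) : h x y ≤ decayConst ^ k * M := by
  induction k generalizing M with
  | zero => simpa using hM x y (by simpa using hx) (by simpa using hy)
  | succ k ih =>
    have e : (64 : ℤ) ^ (k + 1) * n = 64 * ((64 ^ k * n : ℕ) : ℤ) := by push_cast; ring
    have hle : (64 : ℤ) ^ k * n ≤ 64 ^ (k + 1) * n := by
      rw [e]; push_cast; nlinarith [show (0 : ℤ) ≤ 64 ^ k * n by positivity]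
    rw [e] at hM hsub
    have := ih (M := decayConst * M)
      (fun x y hx hy => hP.le_decayConst_mul h0 h00 hM hsub x y (by exact_mod_cast hx)
        (by exact_mod_cast hy))
      (fun x y hx hy => hsub x y ((hx.trans_le hle).trans_eq e) ((hy.trans_le hle).trans_eq e))
    rwa [← mul_assoc, ← pow_succ] at this

end

/-! ### The square root sheet of a simply connected discrete domain -/

noncomputable section

theorem gridPoint_mem_polygonalDomain {δ : ℝ} (hδ : 0 < δ) {V : Set (ℤ × ℤ)} {p : ℤ × ℤ} :
    gridPoint δ p ∈ polygonalDomain δ V ↔ p ∈ V := by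
  constructor
  · rintro ⟨q, hq, h1, h2⟩
    simp only [gridPoint, ← mul_sub, abs_mul, abs_of_pos hδ] at h1 h2
    rw [mul_lt_iff_lt_one_right hδ] at h1 h2
    have e1 : |p.1 - q.1| < 1 := by exact_mod_cast h1
    have e2 : |p.2 - q.2| < 1 := by exact_mod_cast h2
    rw [Int.abs_lt_one_iff, sub_eq_zero] at e1 e2
    rwa [Prod.ext e1 e2]
  · intro hp
    exact ⟨p, hp, by simp [gridPoint, hδ], by simp [gridPoint, hδ]⟩

theorem isOpen_polygonalDomain (δ : ℝ) (V : Set (ℤ × ℤ)) : IsOpen (polygonalDomain δ V) := by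
  have : polygonalDomain δ V = ⋃ p ∈ V, {z : ℂ | |z.re - δ * p.1| < δ ∧ |z.im - δ * p.2| < δ} := by
    ext z; simp only [polygonalDomain, Set.mem_iUnion, exists_prop]; rfl
  rw [this]
  refine isOpen_biUnion fun p _ => ?_
  exact (isOpen_lt (Complex.continuous_re.sub continuous_const).abs continuous_const).inter
    (isOpen_lt (Complex.continuous_im.sub continuous_const).abs continuous_const)

theorem segment_subset_polygonalDomain {δ : ℝ} (hδ : 0 < δ) {V : Set (ℤ × ℤ)} {p q : ℤ × ℤ}
    (hp : p ∈ V) (hq : q ∈ V) (h1 : |q.1 - p.1| ≤ 1) (h2 : |q.2 - p.2| ≤ 1) :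
    segment ℝ (gridPoint δ p) (gridPoint δ q) ⊆ polygonalDomain δ V := by
  rintro z ⟨a, b, ha, hb, hab, rfl⟩
  rcases ha.eq_or_lt with rfl | ha'
  · rw [zero_add] at hab
    subst hab
    simpa using (gridPoint_mem_polygonalDomain hδ).2 hq
  · have hb1 : b < 1 := by linarith
    have h1' : |(q.1 : ℝ) - p.1| ≤ 1 := by exact_mod_cast h1
    have h2' : |(q.2 : ℝ) - p.2| ≤ 1 := by exact_mod_cast h2
    have key : ∀ s t : ℝ, |s - t| ≤ 1 → |a * (δ * t) + b * (δ * s) - δ * t| < δ := by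
      intro s t hst
      rw [show a * (δ * t) + b * (δ * s) - δ * t = δ * (b * (s - t)) by
        rw [show a = 1 - b by linarith]; ring, abs_mul, abs_of_pos hδ, abs_mul, abs_of_nonneg hb]
      have : b * |s - t| ≤ b * 1 := mul_le_mul_of_nonneg_left hst hb
      nlinarith
    exact ⟨p, hp, by simpa [gridPoint] using key _ _ h1', by simpa [gridPoint] using key _ _ h2'⟩

/-- The number `τ * f z` has square `τ ^ 2 * (z - c)`, whose real part is positive on the segment. A
purely imaginary number has nonpositive square, so the real part of `τ * f z` never vanishes there
and keeps its sign. -/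
theorem sign_const_of_segment {D : Set ℂ} {f : ℂ → ℂ} {c τ z₁ z₂ : ℂ} (hf : ContinuousOn f D)
    (hfc : ∀ z, f z ^ 2 = z - c) (hD : segment ℝ z₁ z₂ ⊆ D)
    (h1 : 0 < (τ ^ 2 * (z₁ - c)).re) (h2 : 0 < (τ ^ 2 * (z₂ - c)).re) :
    0 < (τ * f z₁).re ↔ 0 < (τ * f z₂).re := by
  have hne : ∀ z ∈ segment ℝ z₁ z₂, (τ * f z).re ≠ 0 := by
    rintro z ⟨a, b, ha, hb, hab, rfl⟩ h0
    have e : (τ ^ 2 * (a • z₁ + b • z₂ - c)).re =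
        a * (τ ^ 2 * (z₁ - c)).re + b * (τ ^ 2 * (z₂ - c)).re := by
      have : a • z₁ + b • z₂ - c = a * (z₁ - c) + b * (z₂ - c) := by
        have : (a : ℂ) + b = 1 := by exact_mod_cast hab
        simp only [Complex.real_smul]
        linear_combination c * this
      rw [this, ← Complex.re_ofReal_mul, ← Complex.re_ofReal_mul, ← Complex.add_re]
      congr 1; ring
    have e2 : (τ ^ 2 * (a • z₁ + b • z₂ - c)).re ≤ 0 := by
      rw [← hfc, ← mul_pow, sq, Complex.mul_re, h0]
      nlinarith [sq_nonneg (τ * f (a • z₁ + b • z₂)).im]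
    rw [e] at e2
    rcases ha.eq_or_lt with rfl | ha'
    · rw [zero_add] at hab; subst hab; linarith
    · have := mul_pos ha' h1
      have := mul_nonneg hb h2.le
      linarith
  have hpre : IsPreconnected ((fun z => (τ * f z).re) '' segment ℝ z₁ z₂) := by
    refine (convex_segment z₁ z₂).isPreconnected.image _ ?_
    exact Complex.continuous_re.comp_continuousOn (continuousOn_const.mul (hf.mono hD))
  have hord := hpre.ordConnected
  have m1 : (τ * f z₁).re ∈ (fun z => (τ * f z).re) '' segment ℝ z₁ z₂ :=
    ⟨z₁, left_mem_segment ℝ _ _, rfl⟩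
  have m2 : (τ * f z₂).re ∈ (fun z => (τ * f z).re) '' segment ℝ z₁ z₂ :=
    ⟨z₂, right_mem_segment ℝ _ _, rfl⟩
  constructor
  · intro h
    by_contra! h'
    obtain ⟨z, hz, hz0⟩ := hord.out m2 m1 ⟨h', h.le⟩
    exact hne z hz hz0
  · intro h
    by_contra! h'
    obtain ⟨z, hz, hz0⟩ := hord.out m1 m2 ⟨h', h.le⟩
    exact hne z hz hz0

/-- The choice of a square root of points of the plane, continuous off the positive half axis and
across this half axis from above. -/
def upperSign (w : ℂ) : Prop := 0 < w.im ∨ (w.im = 0 ∧ 0 < w.re)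

/-- This lemma and the next four turn `upperSign w` into the sign of a linear form in `w`, one for
each half plane or quadrant containing `w ^ 2`. Note that `w.re ^ 2 - w.im ^ 2` and `2 * (w.re *
w.im)` are the coordinates of `w ^ 2`. -/
theorem upperSign_iff_re {w : ℂ} (hx : 0 < w.re ^ 2 - w.im ^ 2) (hy : 0 ≤ w.re * w.im) :
    upperSign w ↔ 0 < w.re := by
  unfold upperSign
  constructor
  · rintro (h | h)
    · by_contra! h'
      have : w.re = 0 := by
        by_contra h0; nlinarith [mul_pos_of_neg_of_neg (lt_of_le_of_ne h' h0) (neg_lt_zero.2 h)]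
      rw [this] at hx; nlinarith [sq_nonneg w.im]
    · exact h.2
  · intro h
    have : 0 ≤ w.im := by by_contra! h'; nlinarith
    rcases this.eq_or_lt with h0 | h0
    · exact Or.inr ⟨h0.symm, h⟩
    · exact Or.inl h0

theorem upperSign_iff_not_re {w : ℂ} (hy : w.re * w.im < 0) :
    upperSign w ↔ ¬ 0 < w.re := by
  unfold upperSign
  constructor
  · rintro (h | h)
    · intro h'; nlinarith
    · rw [h.1] at hy; simp at hy
  · intro h
    push Not at h
    left; by_contra! h'
    nlinarith

theorem upperSign_iff_im {w : ℂ} (hx : w.re ^ 2 - w.im ^ 2 < 0) : upperSign w ↔ 0 < w.im := by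
  unfold upperSign
  constructor
  · rintro (h | h)
    · exact h
    · rw [h.1] at hx; nlinarith [sq_nonneg w.re]
  · exact Or.inl

theorem upperSign_iff_add {w : ℂ} (hy : 0 < w.re * w.im) : upperSign w ↔ 0 < w.re + w.im := by
  unfold upperSign
  constructor
  · rintro (h | h)
    · have := pos_of_mul_pos_left hy h.le; linarith
    · rw [h.1] at hy; simp at hy
  · intro h
    left; by_contra! h'
    have : 0 < w.re := by linarith
    nlinarith

theorem upperSign_iff_sub {w : ℂ} (hy : w.re * w.im < 0) : upperSign w ↔ 0 < w.im - w.re := by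
  unfold upperSign
  constructor
  · rintro (h | h)
    · have : w.re < 0 := by by_contra! h'; nlinarith
      linarith
    · rw [h.1] at hy; simp at hy
  · intro h
    left; by_contra! h'
    have : w.re < 0 := by linarith
    nlinarith

/-- A simply connected discrete domain carries a sheet of the double cover of the grid branched at
any vertex off the domain. -/
theorem exists_isSheet {δ : ℝ} (hδ : 0 < δ) {V : Set (ℤ × ℤ)}
    (hV : IsSimplyConnected (polygonalDomain δ V)) {p₀ : ℤ × ℤ} (hp₀ : p₀ ∉ V)
    {h : ℤ × ℤ → ℝ} (hh : ∀ p, p ∉ V → h p = 0) :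
    ∃ P, IsSheet (fun x y => h (p₀.1 + x, p₀.2 + y)) P := by
  set c := gridPoint δ p₀ with hc
  -- Simple connectedness supplies a continuous branch of the square root of `z - c`, because `c` is
  -- not in the polygonal domain.
  obtain ⟨f, hf, hfc⟩ := Complex.exists_continuousOn_pow_eq hV (isOpen_polygonalDomain δ V)
    (g := fun z => z - c) (by fun_prop) (by
      rintro ⟨z, hz, hz0⟩
      rw [sub_eq_zero] at hz0
      rw [hz0] at hz
      exact hp₀ ((gridPoint_mem_polygonalDomain hδ).1 hz)) two_ne_zero
  set pt : ℤ → ℤ → ℤ × ℤ := fun x y => (p₀.1 + x, p₀.2 + y) with hpt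
  set s : ℤ → ℤ → ℂ := fun x y => f (gridPoint δ (pt x y)) with hs
  have hsq : ∀ x y : ℤ, (s x y).re ^ 2 - (s x y).im ^ 2 = δ * x ∧ 2 * ((s x y).re * (s x y).im) = δ * y := by
    intro x y
    have := hfc (gridPoint δ (pt x y))
    have e : gridPoint δ (pt x y) - c = ⟨δ * x, δ * y⟩ := by
      apply Complex.ext <;> simp [hc, gridPoint, hpt] <;> ring
    rw [e] at this
    have r := congrArg Complex.re this
    have i := congrArg Complex.im this
    simp only [sq, Complex.mul_re, Complex.mul_im] at r i
    constructor
    · rw [← r]; ring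
    · rw [← i]; ring
  have hmem : ∀ x y, h (pt x y) ≠ 0 → pt x y ∈ V := fun x y hne => by
    by_contra hn; exact hne (hh _ hn)
  have hne0 : ∀ x y, pt x y ∈ V → ¬ (x = 0 ∧ y = 0) := by
    rintro x y hv ⟨rfl, rfl⟩
    simp only [hpt, add_zero] at hv
    exact hp₀ hv
  have hcoord : ∀ x y : ℤ, gridPoint δ (pt x y) - c = δ * ((x : ℂ) + y * Complex.I) := by
    intro x y
    apply Complex.ext <;> simp [hc, gridPoint, hpt] <;> ring
  -- The choices `1`, `-I`, `1 - I`, `-1 - I` of `τ` have squares `1`, `-1`, `-2I`, `2I`, and so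
  -- serve the right, left, upper and lower half planes.
  have sgn : ∀ (τ : ℂ) (x y x' y' : ℤ), pt x y ∈ V → pt x' y' ∈ V → |x' - x| ≤ 1 → |y' - y| ≤ 1 →
      0 < (τ ^ 2 * ((x : ℂ) + y * Complex.I)).re → 0 < (τ ^ 2 * ((x' : ℂ) + y' * Complex.I)).re →
      (0 < (τ * s x y).re ↔ 0 < (τ * s x' y').re) := by
    intro τ x y x' y' hv hv' h1 h2 p1 p2
    refine sign_const_of_segment hf hfc
      (segment_subset_polygonalDomain hδ hv hv' (by simpa [hpt] using h1) (by simpa [hpt] using h2))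
      ?_ ?_
    · rw [hcoord, mul_left_comm, Complex.re_ofReal_mul]; positivity
    · rw [hcoord, mul_left_comm, Complex.re_ofReal_mul]; positivity
  have sR : ∀ x y x' y' : ℤ, pt x y ∈ V → pt x' y' ∈ V → |x' - x| ≤ 1 → |y' - y| ≤ 1 →
      0 < x → 0 < x' → (0 < (s x y).re ↔ 0 < (s x' y').re) := by
    intro x y x' y' hv hv' h1 h2 p1 p2
    simpa using sgn 1 x y x' y' hv hv' h1 h2 (by simpa using p1) (by simpa using p2)
  have sL : ∀ x y x' y' : ℤ, pt x y ∈ V → pt x' y' ∈ V → |x' - x| ≤ 1 → |y' - y| ≤ 1 →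
      x < 0 → x' < 0 → (0 < (s x y).im ↔ 0 < (s x' y').im) := by
    intro x y x' y' hv hv' h1 h2 p1 p2
    simpa using sgn (-Complex.I) x y x' y' hv hv' h1 h2 (by simpa using p1) (by simpa using p2)
  have sU : ∀ x y x' y' : ℤ, pt x y ∈ V → pt x' y' ∈ V → |x' - x| ≤ 1 → |y' - y| ≤ 1 →
      0 < y → 0 < y' → (0 < (s x y).re + (s x y).im ↔ 0 < (s x' y').re + (s x' y').im) := by
    intro x y x' y' hv hv' h1 h2 p1 p2
    have p1' : (0 : ℝ) < y := by exact_mod_cast p1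
    have p2' : (0 : ℝ) < y' := by exact_mod_cast p2
    simpa using sgn (1 - Complex.I) x y x' y' hv hv' h1 h2
      (by simp [sq]; linarith) (by simp [sq]; linarith)
  have sD : ∀ x y x' y' : ℤ, pt x y ∈ V → pt x' y' ∈ V → |x' - x| ≤ 1 → |y' - y| ≤ 1 →
      y < 0 → y' < 0 → (0 < (s x y).im - (s x y).re ↔ 0 < (s x' y').im - (s x' y').re) := by
    intro x y x' y' hv hv' h1 h2 p1 p2
    have p1' : (y : ℝ) < 0 := by exact_mod_cast p1
    have p2' : (y' : ℝ) < 0 := by exact_mod_cast p2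
    have := sgn (-1 - Complex.I) x y x' y' hv hv' h1 h2
      (by simp [sq]; linarith) (by simp [sq]; linarith)
    simp only [Complex.mul_re, Complex.sub_re, Complex.neg_re, Complex.one_re, Complex.I_re,
      Complex.sub_im, Complex.neg_im, Complex.one_im, Complex.I_im] at this
    ring_nf at this ⊢
    exact this
  have uR : ∀ x y : ℤ, 0 < x → 0 ≤ y → (upperSign (s x y) ↔ 0 < (s x y).re) := by
    intro x y hx hy
    have hx' : (0 : ℝ) < x := by exact_mod_cast hx
    have hy' : (0 : ℝ) ≤ y := by exact_mod_cast hy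
    refine upperSign_iff_re (by rw [(hsq x y).1]; positivity) ?_
    have := (hsq x y).2
    have : 0 ≤ δ * y := by positivity
    linarith
  -- Below the axis `upperSign` is opposite to the sign of the real part, above it they agree. The
  -- latter sign is continuous across the positive half axis, so `upperSign` switches exactly there.
  have uR' : ∀ x y : ℤ, y < 0 → (upperSign (s x y) ↔ ¬ 0 < (s x y).re) := by
    intro x y hy
    have hy' : (y : ℝ) < 0 := by exact_mod_cast hy
    apply upperSign_iff_not_re
    have := (hsq x y).2
    have : δ * y < 0 := mul_neg_of_pos_of_neg hδ hy'
    linarith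
  have uL : ∀ x y : ℤ, x < 0 → (upperSign (s x y) ↔ 0 < (s x y).im) := by
    intro x y hx
    have hx' : (x : ℝ) < 0 := by exact_mod_cast hx
    exact upperSign_iff_im (by rw [(hsq x y).1]; exact mul_neg_of_pos_of_neg hδ hx')
  have uU : ∀ x y : ℤ, 0 < y → (upperSign (s x y) ↔ 0 < (s x y).re + (s x y).im) := by
    intro x y hy
    have hy' : (0 : ℝ) < y := by exact_mod_cast hy
    apply upperSign_iff_add
    have := (hsq x y).2
    have : 0 < δ * y := by positivity
    linarith
  have uD : ∀ x y : ℤ, y < 0 → (upperSign (s x y) ↔ 0 < (s x y).im - (s x y).re) := by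
    intro x y hy
    have hy' : (y : ℝ) < 0 := by exact_mod_cast hy
    apply upperSign_iff_sub
    have := (hsq x y).2
    have : δ * y < 0 := mul_neg_of_pos_of_neg hδ hy'
    linarith
  refine ⟨fun x y => upperSign (s x y), ⟨fun x y h1 h2 => ?_, fun x y h1 h2 hn => ?_,
    fun x hx h1 h2 => ?_⟩⟩
  · have v1 := hmem x y h1
    have v2 := hmem _ _ h2
    have n1 := hne0 _ _ v1
    have n2 := hne0 _ _ v2
    rcases lt_trichotomy y 0 with hy | rfl | hy
    · rw [uD _ _ hy, uD _ _ hy, sD x y (x + 1) y v1 v2 (by simp) (by simp) hy hy]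
    · rcases lt_trichotomy x 0 with hx | rfl | hx
      · rw [uL _ _ hx, uL _ _ (by omega), sL x 0 (x + 1) 0 v1 v2 (by simp) (by simp) hx (by omega)]
      · omega
      · rw [uR _ _ hx le_rfl, uR _ _ (by omega) le_rfl,
          sR x 0 (x + 1) 0 v1 v2 (by simp) (by simp) hx (by omega)]
    · rw [uU _ _ hy, uU _ _ hy, sU x y (x + 1) y v1 v2 (by simp) (by simp) hy hy]
  · have v1 := hmem x y h1
    have v2 := hmem _ _ h2
    have n1 := hne0 _ _ v1
    have n2 := hne0 _ _ v2
    rcases lt_trichotomy x 0 with hx | rfl | hx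
    · rw [uL _ _ hx, uL _ _ hx, sL x y x (y + 1) v1 v2 (by simp) (by simp) hx hx]
    · rcases lt_or_ge y 0 with hy | hy
      · rw [uD _ _ hy, uD _ _ (by omega), sD 0 y 0 (y + 1) v1 v2 (by simp) (by simp) hy (by omega)]
      · rw [uU _ _ (by omega), uU _ _ (by omega),
          sU 0 y 0 (y + 1) v1 v2 (by simp) (by simp) (by omega) (by omega)]
    · rcases lt_or_ge y 0 with hy | hy
      · rw [uR' _ _ hy, uR' _ _ (by omega), sR x y x (y + 1) v1 v2 (by simp) (by simp) hx hx]
      · rw [uR _ _ hx hy, uR _ _ hx (by omega), sR x y x (y + 1) v1 v2 (by simp) (by simp) hx hx]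
  · have v1 := hmem x (-1) h1
    have v2 := hmem _ _ h2
    rw [uR' _ _ (by norm_num), uR _ _ hx le_rfl,
      sR x (-1) x 0 v1 v2 (by simp) (by simp) hx hx]

end

/-! ### First-step decomposition of path sums -/

noncomputable section

/-- The function `log (|p|² + 1)` is subharmonic on the grid. -/
theorem log_add_one_subharmonic (x y : ℤ) :
    Real.log ((x : ℝ) ^ 2 + (y : ℝ) ^ 2 + 1) + (if x = 0 ∧ y = 0 then Real.log 2 else 0) ≤
      nbrAvg (fun x y => Real.log ((x : ℝ) ^ 2 + (y : ℝ) ^ 2 + 1)) x y := by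
  split_ifs with h
  · obtain ⟨rfl, rfl⟩ := h
    simp only [nbrAvg]; norm_num; linarith
  · simp only [nbrAvg]
    push_cast
    generalize (x : ℝ) = X
    generalize (y : ℝ) = Y
    rw [add_zero]
    apply log_le_of_four <;> try positivity
    have e : ((X + 1) ^ 2 + Y ^ 2 + 1) * ((X - 1) ^ 2 + Y ^ 2 + 1) *
      (X ^ 2 + (Y + 1) ^ 2 + 1) * (X ^ 2 + (Y - 1) ^ 2 + 1) - (X ^ 2 + Y ^ 2 + 1) ^ 4 =
      2 * (X ^ 2 + Y ^ 2 + 2) ^ 2 + 4 * (X ^ 2 + Y ^ 2 + 2) - 1 + 16 * X ^ 2 * Y ^ 2 := by ring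
    have : 0 ≤ X ^ 2 * Y ^ 2 := by positivity
    nlinarith [sq_nonneg X, sq_nonneg Y]

/-- A walk is either trivial or a first step followed by a walk. -/
def walkEquiv {α : Type*} (G : SimpleGraph α) (p q : α) :
    G.Walk p q ≃ PLift (p = q) ⊕ (Σ p' : {p' // G.Adj p p'}, G.Walk p' q) where
  toFun
    | .nil => .inl ⟨rfl⟩
    | .cons h π => .inr ⟨⟨_, h⟩, π⟩
  invFun
    | .inl ⟨h⟩ => SimpleGraph.Walk.nil.copy rfl h
    | .inr ⟨⟨_, h⟩, π⟩ => .cons h π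
  left_inv π := by cases π <;> rfl
  right_inv x := by
    rcases x with ⟨⟨h⟩⟩ | ⟨⟨p', h⟩, π⟩
    · subst h; rfl
    · rfl

open scoped ENNReal

/-- Stated in `ℝ≥0∞` so that the sums can be rearranged before any convergence is known. -/
theorem tsum_walk_eq {α : Type*} [DecidableEq α] (G : SimpleGraph α) (p q : α) (w : ℕ → ℝ≥0∞) :
    ∑' π : G.Walk p q, w π.length = (if p = q then w 0 else 0) +
      ∑' p' : {p' // G.Adj p p'}, ∑' π : G.Walk p' q, w (π.length + 1) := by
  rw [← (walkEquiv G p q).symm.tsum_eq, ENNReal.summable.tsum_sum (by exact ENNReal.summable),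
    ← ENNReal.tsum_sigma (fun (p' : {p' // G.Adj p p'}) (π : G.Walk p' q) => w (π.length + 1))]
  congr 1
  by_cases h : p = q
  · rw [if_pos h]
    subst h
    rw [tsum_eq_single ⟨rfl⟩ (fun b hb => absurd (Subsingleton.elim _ _) hb)]
    rfl
  · rw [if_neg h]
    have : IsEmpty (PLift (p = q)) := ⟨fun x => h x.down⟩
    exact tsum_empty

/-- The sum of a function over the four neighbours. -/
theorem tsum_gridGraph_adj (V : Set (ℤ × ℤ)) {p : ℤ × ℤ} (hp : p ∈ V) (f : ℤ × ℤ → ℝ≥0∞)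
    (hf : ∀ q, q ∉ V → f q = 0) :
    ∑' p' : {p' // (gridGraph V).Adj p p'}, f p' =
      f (p.1 + 1, p.2) + f (p.1 - 1, p.2) + f (p.1, p.2 + 1) + f (p.1, p.2 - 1) := by
  obtain ⟨x, y⟩ := p
  have : ∑' p' : {p' // (gridGraph V).Adj (x, y) p'}, f p' =
      ∑' p' : ((({(x + 1, y), (x - 1, y), (x, y + 1), (x, y - 1)} : Finset (ℤ × ℤ)) :
        Set (ℤ × ℤ))), f p' := by
    refine (tsum_subtype {p' | (gridGraph V).Adj (x, y) p'} f).trans ?_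
    rw [tsum_subtype]
    congr 1
    ext ⟨x', y'⟩
    classical
    simp only [Set.indicator_apply, Set.mem_ofPred_eq, gridGraph, Finset.coe_insert,
      Finset.coe_singleton, Set.mem_insert_iff, Set.mem_singleton_iff, Prod.mk.injEq]
    have e : |x - x'| + |y - y'| = 1 ↔ (x' = x + 1 ∧ y' = y ∨ x' = x - 1 ∧ y' = y ∨
        x' = x ∧ y' = y + 1 ∨ x' = x ∧ y' = y - 1) := by
      rcases abs_cases (x - x') with h1 | h1 <;> rcases abs_cases (y - y') with h2 | h2 <;> omega
    by_cases hV : (x', y') ∈ V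
    · simp only [hp, hV, true_and, e]
    · simp [hf _ hV]
  rw [this, Finset.tsum_subtype', Finset.sum_insert (by simp; omega), Finset.sum_insert (by simp),
    Finset.sum_insert (by simp; omega), Finset.sum_singleton]
  simp only [add_assoc]

theorem isEmpty_walk_of_notMem {V : Set (ℤ × ℤ)} {p q : ℤ × ℤ} (hp : p ∉ V) (hpq : p ≠ q) :
    IsEmpty ((gridGraph V).Walk p q) := by
  refine ⟨fun π => ?_⟩
  cases π with
  | nil => exact hpq rfl
  | cons h _ => exact hp h.1

theorem tsum_gridGraph_walk {V : Set (ℤ × ℤ)} {p q : ℤ × ℤ} (hp : p ∈ V) (hq : q ∈ V)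
    (w : ℕ → ℝ≥0∞) :
    ∑' π : (gridGraph V).Walk p q, w π.length = (if p = q then w 0 else 0) +
      (∑' π : (gridGraph V).Walk (p.1 + 1, p.2) q, w (π.length + 1)
      + ∑' π : (gridGraph V).Walk (p.1 - 1, p.2) q, w (π.length + 1)
      + ∑' π : (gridGraph V).Walk (p.1, p.2 + 1) q, w (π.length + 1)
      + ∑' π : (gridGraph V).Walk (p.1, p.2 - 1) q, w (π.length + 1)) := by
  have key := tsum_gridGraph_adj V hp
    (fun p' => ∑' π : (gridGraph V).Walk p' q, w (π.length + 1)) fun q' hq' => by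
      have := isEmpty_walk_of_notMem hq' (q := q) (fun h => hq' (h ▸ hq))
      exact tsum_empty
  rw [tsum_walk_eq, key]

/-- Truncated partition functions stay below every superharmonic majorant. -/
theorem tsum_truncated_le {V : Set (ℤ × ℤ)} {q : ℤ × ℤ} (hq : q ∈ V) {a : ℝ} (ha0 : 0 ≤ a)
    (ha : a ≤ 1 / 4) {f : ℤ → ℤ → ℝ}
    (hf0 : ∀ x y, (∃ p ∈ V, |x - p.1| ≤ 1 ∧ |y - p.2| ≤ 1) → 0 ≤ f x y)
    (hf : ∀ x y, (if (x, y) = q then 1 else 0) + nbrAvg f x y ≤ f x y) (N : ℕ) (p : ℤ × ℤ)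
    (hp : ∃ p' ∈ V, |p.1 - p'.1| ≤ 1 ∧ |p.2 - p'.2| ≤ 1) :
    ∑' π : (gridGraph V).Walk p q, (if π.length < N then ENNReal.ofReal a ^ π.length else 0) ≤
      ENNReal.ofReal (f p.1 p.2) := by
  -- The first step turns the truncation at `N + 1` into `a` times the neighbouring truncations at
  -- `N`; superharmonicity of `f` and `a ≤ 1 / 4` close the induction. From a vertex off `V` there
  -- is no path to `q`.
  induction N generalizing p with
  | zero => simp
  | succ N ih =>
    by_cases hpV : p ∈ V
    · rw [tsum_gridGraph_walk hpV hq
        (fun n => if n < N + 1 then ENNReal.ofReal a ^ n else 0)]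
      have e : ∀ p' : ℤ × ℤ, ∑' π : (gridGraph V).Walk p' q,
          (if π.length + 1 < N + 1 then ENNReal.ofReal a ^ (π.length + 1) else 0) =
          ENNReal.ofReal a * ∑' π : (gridGraph V).Walk p' q,
            (if π.length < N then ENNReal.ofReal a ^ π.length else 0) := by
        intro p'
        rw [← ENNReal.tsum_mul_left]
        congr 1; ext π
        simp only [add_lt_add_iff_right, mul_ite, mul_zero, pow_succ']
      simp only [e, pow_zero]
      rw [← mul_add, ← mul_add, ← mul_add]
      have n1 : ∃ p' ∈ V, |p.1 + 1 - p'.1| ≤ 1 ∧ |p.2 - p'.2| ≤ 1 := ⟨p, hpV, by simp⟩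
      have n2 : ∃ p' ∈ V, |p.1 - 1 - p'.1| ≤ 1 ∧ |p.2 - p'.2| ≤ 1 := ⟨p, hpV, by simp⟩
      have n3 : ∃ p' ∈ V, |p.1 - p'.1| ≤ 1 ∧ |p.2 + 1 - p'.2| ≤ 1 := ⟨p, hpV, by simp⟩
      have n4 : ∃ p' ∈ V, |p.1 - p'.1| ≤ 1 ∧ |p.2 - 1 - p'.2| ≤ 1 := ⟨p, hpV, by simp⟩
      have h1 := ih (p.1 + 1, p.2) n1
      have h2 := ih (p.1 - 1, p.2) n2
      have h3 := ih (p.1, p.2 + 1) n3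
      have h4 := ih (p.1, p.2 - 1) n4
      have f1 := hf0 _ _ n1
      have f2 := hf0 _ _ n2
      have f3 := hf0 _ _ n3
      have f4 := hf0 _ _ n4
      calc _ ≤ (if p = q then 1 else 0) + ENNReal.ofReal a * (ENNReal.ofReal (f (p.1 + 1) p.2) +
            ENNReal.ofReal (f (p.1 - 1) p.2) + ENNReal.ofReal (f p.1 (p.2 + 1)) +
            ENNReal.ofReal (f p.1 (p.2 - 1))) := by
            simp only [Nat.zero_lt_succ, if_true]
            gcongr
        _ = ENNReal.ofReal ((if p = q then 1 else 0) + a * (f (p.1 + 1) p.2 + f (p.1 - 1) p.2 +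
            f p.1 (p.2 + 1) + f p.1 (p.2 - 1))) := by
            rw [ENNReal.ofReal_add (by split_ifs <;> norm_num) (by positivity),
              ENNReal.ofReal_mul ha0, ENNReal.ofReal_add (by positivity) f4,
              ENNReal.ofReal_add (by positivity) f3, ENNReal.ofReal_add f1 f2]
            congr 1
            split_ifs <;> simp
        _ ≤ _ := by
            apply ENNReal.ofReal_le_ofReal
            refine le_trans ?_ (hf p.1 p.2)
            have : a * (f (p.1 + 1) p.2 + f (p.1 - 1) p.2 + f p.1 (p.2 + 1) + f p.1 (p.2 - 1)) ≤
              1 / 4 * (f (p.1 + 1) p.2 + f (p.1 - 1) p.2 + f p.1 (p.2 + 1) + f p.1 (p.2 - 1)) :=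
              mul_le_mul_of_nonneg_right ha (by positivity)
            simp only [nbrAvg]
            linarith
    · have := isEmpty_walk_of_notMem hpV (q := q) (fun h => hpV (h ▸ hq))
      simp

theorem tsum_walk_le {V : Set (ℤ × ℤ)} {q : ℤ × ℤ} (hq : q ∈ V) {a : ℝ} (ha0 : 0 ≤ a)
    (ha : a ≤ 1 / 4) {f : ℤ → ℤ → ℝ}
    (hf0 : ∀ x y, (∃ p ∈ V, |x - p.1| ≤ 1 ∧ |y - p.2| ≤ 1) → 0 ≤ f x y)
    (hf : ∀ x y, (if (x, y) = q then 1 else 0) + nbrAvg f x y ≤ f x y) {p : ℤ × ℤ} (hp : p ∈ V) :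
    ∑' π : (gridGraph V).Walk p q, ENNReal.ofReal a ^ π.length ≤ ENNReal.ofReal (f p.1 p.2) := by
  rw [ENNReal.tsum_eq_iSup_sum]
  refine iSup_le fun s => ?_
  obtain ⟨N, hN⟩ := (s.image fun π => π.length).exists_nat_subset_range
  refine le_trans ?_ (tsum_truncated_le hq ha0 ha hf0 hf N p ⟨p, hp, by simp⟩)
  refine le_trans (Finset.sum_le_sum fun π hπ => ?_) (ENNReal.sum_le_tsum s)
  rw [if_pos (Finset.mem_range.1 (hN (Finset.mem_image_of_mem _ hπ)))]

end

/-! ### Logarithmic bound, convergence of the series, discrete Green equation -/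

noncomputable section

/-- A superharmonic majorant of the partition functions of walks in a ball of radius `R`. -/
def logMajorant (δ R : ℝ) (x y : ℤ) : ℝ :=
  (Real.log (19 * R ^ 2 / δ ^ 2) - Real.log ((x : ℝ) ^ 2 + (y : ℝ) ^ 2 + 1)) / Real.log 2

theorem logMajorant_eq {δ R : ℝ} (hδ : 0 < δ) (hR : 0 < R) (x y : ℤ) :
    logMajorant δ R x y =
      Real.log (19 * R ^ 2 / ((δ * x) ^ 2 + (δ * y) ^ 2 + δ ^ 2)) / Real.log 2 := by
  unfold logMajorant
  rw [← Real.log_div (by positivity) (by positivity), div_div]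
  congr 4
  ring

/-- At the origin `log (|p|² + 1)` lies below its average by exactly `log 2`; dividing by `log 2`
produces the unit source at `q`. -/
theorem logMajorant_superharmonic (δ R : ℝ) (q : ℤ × ℤ) (x y : ℤ) :
    (if (x, y) = q then 1 else 0) + nbrAvg (fun x y => logMajorant δ R (x - q.1) (y - q.2)) x y ≤
      logMajorant δ R (x - q.1) (y - q.2) := by
  have hl : 0 < Real.log 2 := Real.log_pos (by norm_num)
  have := log_add_one_subharmonic (x - q.1) (y - q.2)
  have e : (if (x, y) = q then (1 : ℝ) else 0) =
      (if x - q.1 = 0 ∧ y - q.2 = 0 then Real.log 2 else 0) / Real.log 2 := by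
    have : (x, y) = q ↔ x - q.1 = 0 ∧ y - q.2 = 0 := by
      rw [Prod.ext_iff, sub_eq_zero, sub_eq_zero]
    by_cases h : (x, y) = q
    · rw [if_pos h, if_pos (this.1 h), div_self hl.ne']
    · rw [if_neg h, if_neg (fun h' => h (this.2 h')), zero_div]
  rw [e]
  simp only [nbrAvg, logMajorant] at this ⊢
  rw [sub_add_eq_add_sub, sub_right_comm x, sub_add_eq_add_sub, sub_right_comm y] at this
  rw [← sub_nonneg] at this ⊢
  have h2 := div_nonneg this hl.le
  calc (0 : ℝ) ≤ _ := h2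
    _ = _ := by ring

theorem abs_sub_lt_of_mem_ball {δ R : ℝ} {p q : ℤ × ℤ}
    (hp : gridPoint δ p ∈ Metric.ball 0 R) (hq : gridPoint δ q ∈ Metric.ball 0 R) :
    |δ * (p.1 - q.1)| < 2 * R ∧ |δ * (p.2 - q.2)| < 2 * R := by
  rw [mem_ball_zero_iff] at hp hq
  have := norm_sub_le (gridPoint δ p) (gridPoint δ q)
  constructor
  · have h := Complex.abs_re_le_norm (gridPoint δ p - gridPoint δ q)
    simp only [gridPoint, Complex.sub_re, ← mul_sub] at h
    simp only [gridPoint] at this hp hq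
    linarith
  · have h := Complex.abs_im_le_norm (gridPoint δ p - gridPoint δ q)
    simp only [gridPoint, Complex.sub_im, ← mul_sub] at h
    simp only [gridPoint] at this hp hq
    linarith

/-- The mesh, mass and size conditions under which the partition functions are controlled. -/
structure IsBoundedMesh (m δ R : ℝ) (V : Set (ℤ × ℤ)) : Prop where
  pos : 0 < δ
  le : δ ≤ R
  mass : m ^ 2 * δ ^ 2 ≤ 1
  bdd : ∀ p ∈ V, gridPoint δ p ∈ Metric.ball 0 R

variable {m δ R : ℝ} {V : Set (ℤ × ℤ)}

/-- Source of `19`: from `q` to a vertex at most one step outside `V`, each coordinate changes by at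
most `2 * R + δ ≤ 3 * R`, and `9 + 9 + 1 = 19`. The neighbours of `V` are included because the
comparison with truncated sums evaluates the majorant there. -/
theorem IsBoundedMesh.logMajorant_nonneg (hV : IsBoundedMesh m δ R V) {q : ℤ × ℤ} (hq : q ∈ V)
    (x y : ℤ) (hxy : ∃ p ∈ V, |x - p.1| ≤ 1 ∧ |y - p.2| ≤ 1) :
    0 ≤ logMajorant δ R (x - q.1) (y - q.2) := by
  have hδ := hV.pos
  have hR : 0 < R := hδ.trans_le hV.le
  obtain ⟨p, hp, h1, h2⟩ := hxy
  obtain ⟨i1, i2⟩ := abs_sub_lt_of_mem_ball (hV.bdd p hp) (hV.bdd q hq)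
  have key : ∀ s t u : ℤ, |s - t| ≤ 1 → |δ * (t - u)| < 2 * R → (δ * ((s - u : ℤ) : ℝ)) ^ 2 ≤ (3 * R) ^ 2 := by
    intro s t u hst htu
    have hst' : |(s : ℝ) - t| ≤ 1 := by exact_mod_cast hst
    apply sq_le_sq.2
    rw [abs_of_pos (show 0 < 3 * R by positivity)]
    push_cast
    calc |δ * ((s : ℝ) - u)| = |δ * (s - t) + δ * (t - u)| := by ring_nf
      _ ≤ |δ * (s - t)| + |δ * (t - u)| := abs_add_le _ _
      _ ≤ δ * 1 + 2 * R := by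
        rw [abs_mul δ ((s : ℝ) - t), abs_of_pos hδ]
        exact add_le_add (mul_le_mul_of_nonneg_left hst' hδ.le) htu.le
      _ ≤ 3 * R := by linarith [hV.le]
  have k1 := key _ _ _ h1 i1
  have k2 := key _ _ _ h2 i2
  rw [logMajorant_eq hδ hR]
  apply div_nonneg _ (Real.log_pos (by norm_num)).le
  apply Real.log_nonneg
  rw [one_le_div (by positivity)]
  have : δ ^ 2 ≤ R ^ 2 := pow_le_pow_left₀ hδ.le hV.le 2
  nlinarith

theorem IsBoundedMesh.weight_nonneg (hV : IsBoundedMesh m δ R V) :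
    0 ≤ (1 - m ^ 2 * δ ^ 2) / 4 := by
  have := hV.mass; linarith

theorem IsBoundedMesh.weight_le (_ : IsBoundedMesh m δ R V) : (1 - m ^ 2 * δ ^ 2) / 4 ≤ 1 / 4 := by
  have : 0 ≤ m ^ 2 * δ ^ 2 := by positivity
  linarith

open scoped ENNReal

theorem IsBoundedMesh.tsum_le (hV : IsBoundedMesh m δ R V) {p q : ℤ × ℤ} (hp : p ∈ V)
    (hq : q ∈ V) :
    ∑' π : (gridGraph V).Walk p q, ENNReal.ofReal ((1 - m ^ 2 * δ ^ 2) / 4) ^ π.length ≤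
      ENNReal.ofReal (logMajorant δ R (p.1 - q.1) (p.2 - q.2)) :=
  tsum_walk_le hq hV.weight_nonneg hV.weight_le
    (f := fun x y => logMajorant δ R (x - q.1) (y - q.2)) (hV.logMajorant_nonneg hq)
    (logMajorant_superharmonic δ R q) hp

theorem IsBoundedMesh.ofReal_walkWeight (hV : IsBoundedMesh m δ R V) {p q : ℤ × ℤ}
    (π : (gridGraph V).Walk p q) : ENNReal.ofReal (walkWeight m δ V π) =
      ENNReal.ofReal ((1 - m ^ 2 * δ ^ 2) / 4) ^ π.length :=
  ENNReal.ofReal_pow hV.weight_nonneg _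

theorem IsBoundedMesh.walkWeight_nonneg (hV : IsBoundedMesh m δ R V) {p q : ℤ × ℤ}
    (π : (gridGraph V).Walk p q) : 0 ≤ walkWeight m δ V π :=
  pow_nonneg hV.weight_nonneg _

theorem IsBoundedMesh.summable (hV : IsBoundedMesh m δ R V) {p q : ℤ × ℤ} (hp : p ∈ V)
    (hq : q ∈ V) : Summable (walkWeight m δ V (p := p) (q := q)) := by
  have h : ∑' π : (gridGraph V).Walk p q, ENNReal.ofReal (walkWeight m δ V π) ≠ ⊤ := by
    simp only [hV.ofReal_walkWeight]
    exact ((hV.tsum_le hp hq).trans_lt ENNReal.ofReal_lt_top).ne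
  have := ENNReal.summable_toReal h
  simpa only [ENNReal.toReal_ofReal (hV.walkWeight_nonneg _)] using this

theorem IsBoundedMesh.walkPartition_nonneg (hV : IsBoundedMesh m δ R V) (p q : ℤ × ℤ) :
    0 ≤ walkPartition m δ V p q :=
  tsum_nonneg fun π => hV.walkWeight_nonneg π

theorem walkPartition_of_notMem (m δ : ℝ) {p q : ℤ × ℤ} (hp : p ∉ V) (hq : q ∈ V) :
    walkPartition m δ V p q = 0 := by
  have := isEmpty_walk_of_notMem hp (q := q) (fun h => hp (h ▸ hq))
  exact tsum_empty

theorem walkPartition_comm (m δ : ℝ) (V : Set (ℤ × ℤ)) (p q : ℤ × ℤ) :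
    walkPartition m δ V p q = walkPartition m δ V q p := by
  let e : (gridGraph V).Walk p q ≃ (gridGraph V).Walk q p :=
    ⟨SimpleGraph.Walk.reverse, SimpleGraph.Walk.reverse, SimpleGraph.Walk.reverse_reverse,
      SimpleGraph.Walk.reverse_reverse⟩
  unfold walkPartition
  rw [← e.tsum_eq]
  congr 1; ext π
  simp [walkWeight, e]

theorem IsBoundedMesh.ofReal_walkPartition (hV : IsBoundedMesh m δ R V) (p : ℤ × ℤ) {q : ℤ × ℤ}
    (hq : q ∈ V) : ENNReal.ofReal (walkPartition m δ V p q) =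
      ∑' π : (gridGraph V).Walk p q, ENNReal.ofReal ((1 - m ^ 2 * δ ^ 2) / 4) ^ π.length := by
  by_cases hp : p ∈ V
  · unfold walkPartition
    rw [ENNReal.ofReal_tsum_of_nonneg hV.walkWeight_nonneg (hV.summable hp hq)]
    simp only [hV.ofReal_walkWeight]
  · rw [walkPartition_of_notMem m δ hp hq]
    have := isEmpty_walk_of_notMem hp (q := q) (fun h => hp (h ▸ hq))
    simp

theorem IsBoundedMesh.walkPartition_le (hV : IsBoundedMesh m δ R V) {p q : ℤ × ℤ} (hp : p ∈ V)
    (hq : q ∈ V) : walkPartition m δ V p q ≤ logMajorant δ R (p.1 - q.1) (p.2 - q.2) := by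
  have := hV.tsum_le hp hq
  rw [← hV.ofReal_walkPartition p hq] at this
  exact (ENNReal.ofReal_le_ofReal_iff
    (hV.logMajorant_nonneg hq _ _ ⟨p, hp, by simp, by simp⟩)).1 this

theorem IsBoundedMesh.walkPartition_eq (hV : IsBoundedMesh m δ R V) {p q : ℤ × ℤ} (hp : p ∈ V)
    (hq : q ∈ V) : walkPartition m δ V p q = (if p = q then 1 else 0) +
      (1 - m ^ 2 * δ ^ 2) * nbrAvg (fun x y => walkPartition m δ V (x, y) q) p.1 p.2 := by
  have hz := hV.walkPartition_nonneg
  have h := tsum_gridGraph_walk hp hq (fun n => ENNReal.ofReal ((1 - m ^ 2 * δ ^ 2) / 4) ^ n)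
  simp only [pow_succ' (ENNReal.ofReal ((1 - m ^ 2 * δ ^ 2) / 4)), ENNReal.tsum_mul_left, ← hV.ofReal_walkPartition _ hq, pow_zero] at h
  rw [← ENNReal.ofReal_mul hV.weight_nonneg, ← ENNReal.ofReal_mul hV.weight_nonneg,
    ← ENNReal.ofReal_mul hV.weight_nonneg, ← ENNReal.ofReal_mul hV.weight_nonneg] at h
  have n1 := mul_nonneg hV.weight_nonneg (hz (p.1 + 1, p.2) q)
  have n2 := mul_nonneg hV.weight_nonneg (hz (p.1 - 1, p.2) q)
  have n3 := mul_nonneg hV.weight_nonneg (hz (p.1, p.2 + 1) q)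
  have n4 := mul_nonneg hV.weight_nonneg (hz (p.1, p.2 - 1) q)
  rw [← ENNReal.ofReal_add n1 n2, ← ENNReal.ofReal_add (by positivity) n3,
    ← ENNReal.ofReal_add (by positivity) n4,
    show (if p = q then (1 : ℝ≥0∞) else 0) = ENNReal.ofReal (if p = q then 1 else 0) by
      split_ifs <;> simp,
    ← ENNReal.ofReal_add (by split_ifs <;> norm_num) (by positivity),
    ENNReal.ofReal_eq_ofReal_iff (hz _ _)
      (add_nonneg (by split_ifs <;> norm_num) (by positivity))] at h
  rw [h]
  unfold nbrAvg
  ring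

end

/-! ### Second differences of smooth functions -/

noncomputable section

/-- The second difference, i.e. the unnormalized discrete Laplacian with mesh `t`. -/
def secondDiff (φ : ℂ → ℝ) (t : ℝ) (z : ℂ) : ℝ :=
  φ (z + t) + φ (z - t) + φ (z + t * Complex.I) + φ (z - t * Complex.I) - 4 * φ z

/-- Cauchy's mean value theorem against `x ^ 2`, followed by the mean value theorem for `f'` on
`[-c, c]`. -/
theorem exists_second_diff_eq {f f' f'' : ℝ → ℝ} (hf : ∀ x, HasDerivAt f (f' x) x)
    (hf' : ∀ x, HasDerivAt f' (f'' x) x) {t : ℝ} (ht : 0 < t) :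
    ∃ s, |s| ≤ t ∧ f t + f (-t) - 2 * f 0 = t ^ 2 * f'' s := by
  have hk : ∀ x, HasDerivAt (fun x => f x + f (-x) - 2 * f 0) (f' x - f' (-x)) x := by
    intro x
    have h1 := (hf (-x)).comp x (hasDerivAt_neg x)
    convert! ((hf x).add h1).sub_const (2 * f 0) using 1
    ring
  obtain ⟨c, hc, h1⟩ := exists_ratio_hasDerivAt_eq_ratio_slope
    (fun x => f x + f (-x) - 2 * f 0) (fun x => f' x - f' (-x)) ht
    (fun x _ => (hk x).continuousAt.continuousWithinAt) (fun x _ => hk x)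
    (fun x => x ^ 2) (fun x => 2 * x) (by fun_prop)
    (fun x _ => by simpa using hasDerivAt_pow 2 x)
  obtain ⟨s, hs, h2⟩ := exists_hasDerivAt_eq_slope f' f'' (show -c < c by linarith [hc.1])
    (fun x _ => (hf' x).continuousAt.continuousWithinAt) (fun x _ => hf' x)
  refine ⟨s, abs_le.2 ⟨by linarith [hs.1, hc.2], by linarith [hs.2, hc.2]⟩, ?_⟩
  have hc0 : 0 < c := hc.1
  rw [eq_div_iff (by linarith)] at h2
  have e : 2 * c * (f t + f (-t) - 2 * f 0) = 2 * c * (t ^ 2 * f'' s) := by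
    simp only [neg_zero] at h1
    have : f' c - f' (-c) = 2 * c * f'' s := by rw [← h2]; ring
    rw [this] at h1
    linarith
  exact mul_left_cancel₀ (by positivity) e

/-- The second derivative in the direction `e`. -/
def secondDeriv (φ : ℂ → ℝ) (e z : ℂ) : ℝ := fderiv ℝ (fderiv ℝ φ) z e e

theorem laplacian_eq_secondDeriv (φ : ℂ → ℝ) (z : ℂ) :
    Laplacian.laplacian φ z = secondDeriv φ 1 z + secondDeriv φ Complex.I z := by
  rw [InnerProductSpace.laplacian_eq_iteratedFDeriv_complexPlane]
  simp [iteratedFDeriv_two_apply, secondDeriv]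

theorem continuous_secondDeriv {φ : ℂ → ℝ} (hφ : ContDiff ℝ ∞ φ) (e : ℂ) : Continuous (secondDeriv φ e) := by
  have h : ContDiff ℝ 0 (fderiv ℝ (fderiv ℝ φ)) :=
    (hφ.fderiv_right (m := 1) (by decide)).fderiv_right (by norm_num)
  exact (h.continuous.clm_apply continuous_const).clm_apply continuous_const

theorem continuous_laplacian {φ : ℂ → ℝ} (hφ : ContDiff ℝ ∞ φ) : Continuous (Laplacian.laplacian φ) := by
  have : Laplacian.laplacian φ = fun z => secondDeriv φ 1 z + secondDeriv φ Complex.I z :=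
    funext (laplacian_eq_secondDeriv φ)
  rw [this]
  exact (continuous_secondDeriv hφ _).add (continuous_secondDeriv hφ _)

theorem exists_line_second_diff_eq {φ : ℂ → ℝ} (hφ : ContDiff ℝ ∞ φ) (z e : ℂ) {t : ℝ}
    (ht : 0 < t) : ∃ s : ℝ, |s| ≤ t ∧
      φ (z + t * e) + φ (z - t * e) - 2 * φ z = t ^ 2 * secondDeriv φ e (z + s * e) := by
  have hl : ∀ x : ℝ, HasDerivAt (fun x : ℝ => z + x * e) e x := fun x => by
    simpa using ((Complex.ofRealCLM.hasDerivAt (x := x)).mul_const e).const_add z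
  have d1 : ∀ x : ℝ, HasDerivAt (fun x : ℝ => φ (z + x * e)) (fderiv ℝ φ (z + x * e) e) x :=
    fun x => ((hφ.differentiable (by simp)) _).hasFDerivAt.comp_hasDerivAt x (hl x)
  have h2 : Differentiable ℝ (fderiv ℝ φ) :=
    (hφ.fderiv_right (m := 1) (by decide)).differentiable (by simp)
  have d2 : ∀ x : ℝ, HasDerivAt (fun x : ℝ => fderiv ℝ φ (z + x * e) e)
      (secondDeriv φ e (z + x * e)) x := fun x => by
    have := (h2 (z + x * e)).hasFDerivAt.comp_hasDerivAt x (hl x)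
    exact this.clm_apply (hasDerivAt_const x e) |>.congr_deriv (by simp [secondDeriv])
  obtain ⟨s, hs, h⟩ := exists_second_diff_eq d1 d2 ht
  refine ⟨s, hs, ?_⟩
  simpa [sub_eq_add_neg] using h

theorem exists_secondDiff_eq {φ : ℂ → ℝ} (hφ : ContDiff ℝ ∞ φ) (z : ℂ) {t : ℝ}
    (ht : 0 < t) : ∃ s₁ s₂ : ℝ, |s₁| ≤ t ∧ |s₂| ≤ t ∧ secondDiff φ t z =
      t ^ 2 * (secondDeriv φ 1 (z + s₁) + secondDeriv φ Complex.I (z + s₂ * Complex.I)) := by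
  obtain ⟨s₁, h1, e1⟩ := exists_line_second_diff_eq hφ z 1 ht
  obtain ⟨s₂, h2, e2⟩ := exists_line_second_diff_eq hφ z Complex.I ht
  refine ⟨s₁, s₂, h1, h2, ?_⟩
  simp only [mul_one] at e1
  rw [mul_add, ← e1, ← e2, secondDiff]
  ring

theorem exists_abs_secondDiff_le {φ : ℂ → ℝ} (hφ : ContDiff ℝ ∞ φ)
    (hc : HasCompactSupport φ) :
    ∃ C, 0 ≤ C ∧ ∀ z t, 0 < t → |secondDiff φ t z| ≤ C * t ^ 2 := by
  have hs : ∀ e, HasCompactSupport (secondDeriv φ e) := by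
    intro e
    have := (hc.fderiv ℝ).fderiv ℝ
    exact this.mono' (by
      refine (Function.support_subset_iff'.2 fun z hz => ?_).trans subset_closure
      rw [Function.notMem_support] at hz
      simp [secondDeriv, hz])
  obtain ⟨C₁, h1⟩ := (continuous_secondDeriv hφ 1).bounded_above_of_compact_support (hs 1)
  obtain ⟨C₂, h2⟩ :=
    (continuous_secondDeriv hφ Complex.I).bounded_above_of_compact_support (hs Complex.I)
  have p1 := (norm_nonneg _).trans (h1 0)
  have p2 := (norm_nonneg _).trans (h2 0)
  refine ⟨C₁ + C₂, by positivity, fun z t ht => ?_⟩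
  obtain ⟨s₁, s₂, -, -, e⟩ := exists_secondDiff_eq hφ z ht
  rw [e, abs_mul, abs_of_pos (by positivity : 0 < t ^ 2), mul_comm]
  have := (abs_add_le _ _).trans (add_le_add (h1 (z + s₁)) (h2 (z + s₂ * Complex.I)))
  gcongr

/-- The base point moves with the mesh, as is needed when second differences are taken at lattice
points. -/
theorem tendsto_secondDiff {φ : ℂ → ℝ} (hφ : ContDiff ℝ ∞ φ) {ι : Type*}
    {l : Filter ι} {t : ι → ℝ} {z : ι → ℂ} {z₀ : ℂ}
    (ht : Tendsto t l (𝓝[>] 0)) (hz : Tendsto z l (𝓝 z₀)) :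
    Tendsto (fun i => secondDiff φ (t i) (z i) / t i ^ 2) l (𝓝 (Laplacian.laplacian φ z₀)) := by
  have hpos : ∀ᶠ i in l, 0 < t i := ht.eventually self_mem_nhdsWithin
  have ht0 : Tendsto t l (𝓝 0) := ht.mono_right nhdsWithin_le_nhds
  have : ∀ i, ∃ s : ℝ × ℝ, |s.1| ≤ |t i| ∧ |s.2| ≤ |t i| ∧ (0 < t i →
      secondDiff φ (t i) (z i) = t i ^ 2 * (secondDeriv φ 1 (z i + s.1) +
        secondDeriv φ Complex.I (z i + s.2 * Complex.I))) := by
    intro i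
    by_cases h : 0 < t i
    · obtain ⟨s₁, s₂, h1, h2, e⟩ := exists_secondDiff_eq hφ (z i) h
      exact ⟨(s₁, s₂), h1.trans (le_abs_self _), h2.trans (le_abs_self _), fun _ => e⟩
    · exact ⟨(0, 0), by simp, by simp, fun h' => absurd h' h⟩
  choose s h1 h2 e using this
  have s1 : Tendsto (fun i => ((s i).1 : ℂ)) l (𝓝 0) := by
    have : Tendsto (fun i => (s i).1) l (𝓝 0) :=
      squeeze_zero_norm h1 (by simpa using ht0.abs)
    simpa [Function.comp_def] using (Complex.continuous_ofReal.tendsto 0).comp this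
  have s2 : Tendsto (fun i => ((s i).2 : ℂ)) l (𝓝 0) := by
    have : Tendsto (fun i => (s i).2) l (𝓝 0) :=
      squeeze_zero_norm h2 (by simpa using ht0.abs)
    simpa [Function.comp_def] using (Complex.continuous_ofReal.tendsto 0).comp this
  have l1 : Tendsto (fun i => secondDeriv φ 1 (z i + (s i).1)) l (𝓝 (secondDeriv φ 1 z₀)) :=
    ((continuous_secondDeriv hφ 1).tendsto z₀).comp (by simpa using hz.add s1)
  have l2 : Tendsto (fun i => secondDeriv φ Complex.I (z i + (s i).2 * Complex.I)) l
      (𝓝 (secondDeriv φ Complex.I z₀)) :=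
    ((continuous_secondDeriv hφ Complex.I).tendsto z₀).comp
      (by simpa using hz.add (s2.mul_const Complex.I))
  rw [laplacian_eq_secondDeriv]
  refine (l1.add l2).congr' ?_
  filter_upwards [hpos] with i hi
  rw [e i hi, mul_div_cancel_left₀ _ (by positivity)]

end

/-! ### Uniqueness of the massive Green function -/

noncomputable section

variable {m : ℝ} {Ω : Set ℂ} {u : ℂ}

theorem mem_of_infDist_compl_pos {z : ℂ} (h : 0 < Metric.infDist z Ωᶜ) : z ∈ Ω := by
  by_contra hz
  rw [Metric.infDist_zero_of_mem (show z ∈ Ωᶜ from hz)] at h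
  exact lt_irrefl _ h

theorem ne_univ_of_subset_ball {R : ℝ} (hΩR : Ω ⊆ Metric.ball 0 R) : Ω ≠ Set.univ := by
  rintro rfl
  have : ((|R| : ℝ) : ℂ) ∈ Metric.ball (0 : ℂ) R := hΩR trivial
  rw [mem_ball_zero_iff] at this
  simp only [Complex.norm_real, Real.norm_eq_abs, abs_abs] at this
  exact absurd this (not_lt.2 (le_abs_self R))

theorem infDist_compl_pos {R : ℝ} (hΩ : IsOpen Ω) (hΩR : Ω ⊆ Metric.ball 0 R) {z : ℂ} (hz : z ∈ Ω) :
    0 < Metric.infDist z Ωᶜ :=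
  (hΩ.isClosed_compl.notMem_iff_infDist_pos
    (Set.nonempty_compl.2 (ne_univ_of_subset_ball hΩR))).1 (by simpa using hz)

theorem isCompact_le_infDist_compl {R : ℝ} (hΩR : Ω ⊆ Metric.ball 0 R) {η : ℝ} (hη : 0 < η) :
    IsCompact {z | η ≤ Metric.infDist z Ωᶜ} := by
  refine Metric.isCompact_of_isClosed_isBounded
    (isClosed_le continuous_const (Metric.continuous_infDist_pt _))
    (Metric.isBounded_ball.subset (fun z hz => hΩR (mem_of_infDist_compl_pos (hη.trans_le hz))))

theorem infDist_sub_le (z w : ℂ) (s : Set ℂ) : Metric.infDist z s - dist z w ≤ Metric.infDist w s := by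
  have := Metric.infDist_le_infDist_add_dist (s := s) (x := z) (y := w)
  linarith

/-- Dirichlet boundary conditions hold uniformly near the boundary of a bounded domain. -/
theorem exists_uniform_dirichlet {R : ℝ} (hΩR : Ω ⊆ Metric.ball 0 R) {g : ℂ → ℝ}
    (hg : ∀ ζ ∈ frontier Ω, Tendsto g (𝓝[Ω] ζ) (𝓝 0)) {ε : ℝ} (hε : 0 < ε) :
    ∃ η > 0, ∀ z ∈ Ω, Metric.infDist z Ωᶜ < η → |g z| < ε := by
  have hcomp : IsCompact (frontier Ω) :=
    Metric.isCompact_of_isClosed_isBounded isClosed_frontier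
      ((Metric.isBounded_ball.subset hΩR).closure.subset frontier_subset_closure)
  have : ∀ ζ : frontier Ω, ∃ ρ > 0, ∀ z ∈ Ω, z ∈ Metric.ball (ζ : ℂ) ρ → |g z| < ε := by
    rintro ⟨ζ, hζ⟩
    have := (hg ζ hζ).eventually (Metric.ball_mem_nhds 0 hε)
    rw [eventually_nhdsWithin_iff, Metric.eventually_nhds_iff] at this
    obtain ⟨ρ, hρ, h⟩ := this
    refine ⟨ρ, hρ, fun z hz hzρ => by simpa using h hzρ hz⟩
  choose ρ hρ h using this
  obtain ⟨η, hη, hleb⟩ := lebesgue_number_lemma_of_metric hcomp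
    (c := fun ζ : frontier Ω => Metric.ball (ζ : ℂ) (ρ ζ)) (fun ζ => Metric.isOpen_ball)
    (fun ζ hζ => Set.mem_iUnion.2 ⟨⟨ζ, hζ⟩, Metric.mem_ball_self (hρ _)⟩)
  refine ⟨η, hη, fun z hz hzη => ?_⟩
  obtain ⟨y, hy, hyd⟩ := exists_mem_frontier_infDist_compl_eq_dist hz (ne_univ_of_subset_ball hΩR)
  obtain ⟨ζ, hζ⟩ := hleb y hy
  exact h ζ z hz (hζ (by rw [Metric.mem_ball, ← hyd]; exact hzη))

theorem laplacian_eq_zero_of_notMem_tsupport {φ : ℂ → ℝ} {z : ℂ} (hz : z ∉ tsupport φ) :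
    Laplacian.laplacian φ z = 0 := by
  have : φ =ᶠ[𝓝 z] fun _ => 0 := notMem_tsupport_iff_eventuallyEq.1 hz
  rw [laplacian_eq_secondDeriv]
  have h2 : fderiv ℝ φ =ᶠ[𝓝 z] fun _ => 0 := by
    filter_upwards [this.eventuallyEq_nhds] with w hw
    rw [hw.fderiv_eq]; simp
  simp [secondDeriv, h2.fderiv_eq]

theorem integrableOn_mul_of_compact {g ψ : ℂ → ℝ} {K : Set ℂ} (hΩ : IsOpen Ω)
    (hg : LocallyIntegrableOn g Ω volume) (hK : IsCompact K) (hKΩ : K ⊆ Ω) (hψ : Continuous ψ)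
    (h0 : ∀ z ∉ K, ψ z = 0) : IntegrableOn (fun z => g z * ψ z) Ω := by
  refine ((hg.integrableOn_compact_subset hKΩ hK).mul_continuousOn hψ.continuousOn hK).of_forall_sdiff_eq_zero
    hΩ.measurableSet fun z hz => ?_
  rw [h0 z hz.2, mul_zero]

theorem tendsto_integral_mul_secondDiff {k φ : ℂ → ℝ} (hk : Integrable k) (hφ : ContDiff ℝ ∞ φ)
    (hφc : HasCompactSupport φ) {t : ℕ → ℝ} (htpos : ∀ n, 0 < t n) (ht0 : Tendsto t atTop (𝓝 0)) :
    Tendsto (fun n => ∫ z, k z * (secondDiff φ (t n) z / t n ^ 2)) atTop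
      (𝓝 (∫ z, k z * Laplacian.laplacian φ z)) := by
  obtain ⟨C, hC0, hC⟩ := exists_abs_secondDiff_le hφ hφc
  have ht0' : Tendsto t atTop (𝓝[>] 0) :=
    tendsto_nhdsWithin_iff.2 ⟨ht0, Eventually.of_forall htpos⟩
  refine tendsto_integral_of_dominated_convergence (fun z => ‖k z‖ * C) (fun n => ?_)
    (hk.norm.mul_const C) (fun n => Eventually.of_forall fun z => ?_)
    (Eventually.of_forall fun z => ?_)
  · have : Continuous fun z => secondDiff φ (t n) z / t n ^ 2 := by
      have := hφ.continuous
      unfold secondDiff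
      fun_prop
    exact hk.aestronglyMeasurable.mul this.aestronglyMeasurable
  · rw [norm_mul]
    refine mul_le_mul_of_nonneg_left ?_ (norm_nonneg _)
    have := htpos n
    rw [norm_div, Real.norm_eq_abs, norm_pow, Real.norm_eq_abs, abs_of_pos this,
      div_le_iff₀ (by positivity)]
    exact hC z _ this
  · exact (tendsto_secondDiff hφ ht0' tendsto_const_nhds).const_mul _

/-- A second difference of a convolution falls on the kernel, so a maximum of the mollified function
yields information on `∫ k Δφ` without differentiating under the integral. -/
theorem secondDiff_integral {k ρ H : ℂ → ℝ} (hk : Integrable k) (hρ : Continuous ρ)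
    (hρc : HasCompactSupport ρ) (hH : ∀ z, H z = ∫ w, k w * ρ (z - w)) (s : ℝ) (z₀ : ℂ) :
    secondDiff H s z₀ = ∫ z, k z * secondDiff (fun w => ρ (z₀ - w)) s z := by
  obtain ⟨C, hC⟩ := hρ.bounded_above_of_compact_support hρc
  set J : ℂ → ℂ → ℝ := fun z w => k w * ρ (z - w) with hJ
  have int : ∀ z, Integrable (J z) := fun z =>
    hk.mul_bdd (hρ.comp (continuous_const.sub continuous_id)).aestronglyMeasurable
      (Eventually.of_forall fun w => hC _)
  have e : (fun z => k z * secondDiff (fun w => ρ (z₀ - w)) s z) = fun w =>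
      J (z₀ + s) w + J (z₀ - s) w + J (z₀ + s * Complex.I) w + J (z₀ - s * Complex.I) w
        - 4 * J z₀ w := by
    ext w
    simp only [hJ, secondDiff]
    rw [show z₀ + s - w = z₀ - (w - s) by ring, show z₀ - s - w = z₀ - (w + s) by ring,
      show z₀ + s * Complex.I - w = z₀ - (w - s * Complex.I) by ring,
      show z₀ - s * Complex.I - w = z₀ - (w + s * Complex.I) by ring]
    ring
  have i2 := (int (z₀ + s)).add (int (z₀ - s))
  have i3 := i2.add (int (z₀ + s * Complex.I))
  have i4 := i3.add (int (z₀ - s * Complex.I))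
  have r1 := integral_sub i4 ((int z₀).const_mul 4)
  have r2 := integral_add i3 (int (z₀ - s * Complex.I))
  have r3 := integral_add i2 (int (z₀ + s * Complex.I))
  have r4 := integral_add (int (z₀ + s)) (int (z₀ - s))
  have r5 := integral_const_mul (μ := volume) 4 (J z₀)
  simp only [Pi.add_apply] at r1 r2 r3 r4
  rw [e, r1, r2, r3, r4, r5]
  simp only [secondDiff, hH]
  rfl

-- Weak maximum principle. In `h = g₁ - g₂` the sources cancel, so the pole needs no special
-- treatment. Mollify `h` to `H` and maximise `H + ε |z|²` on a compact subset of `Ω`. At an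
-- interior maximum the equation tested against the translated mollifier gives `m² H ≤ -ε`; at its
-- edge `h`, hence `H`, is small by the Dirichlet condition.
set_option maxHeartbeats 800000 in
theorem IsMassiveGreen.le {R : ℝ} (hΩ : IsOpen Ω) (hΩR : Ω ⊆ Metric.ball 0 R) {g₁ g₂ : ℂ → ℝ}
    (h₁ : IsMassiveGreen m Ω u g₁) (h₂ : IsMassiveGreen m Ω u g₂) {v : ℂ} (hv : v ∈ Ω)
    (hvu : v ≠ u) : g₁ v ≤ g₂ v := by
  have hR : 0 < R := Metric.pos_of_mem_ball (hΩR hv)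
  set h : ℂ → ℝ := fun z => g₁ z - g₂ z with hh
  have hli : LocallyIntegrableOn h Ω volume := h₁.locallyIntegrableOn.sub h₂.locallyIntegrableOn
  have hdir : ∀ ζ ∈ frontier Ω, Tendsto h (𝓝[Ω] ζ) (𝓝 0) := fun ζ hζ => by
    simpa using (h₁.dirichlet ζ hζ).sub (h₂.dirichlet ζ hζ)
  have hcont : ContinuousAt h v := by
    have : Ω \ {u} ∈ 𝓝 v := (hΩ.sdiff isClosed_singleton).mem_nhds ⟨hv, hvu⟩
    exact (h₁.continuousOn.sub h₂.continuousOn).continuousAt this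
  have heq : ∀ φ : ℂ → ℝ, ContDiff ℝ ∞ φ → HasCompactSupport φ → tsupport φ ⊆ Ω →
      ∫ z in Ω, h z * (m ^ 2 * φ z - 1 / 4 * Laplacian.laplacian φ z) = 0 := by
    intro φ hφ hc hs
    have hψ : Continuous fun z => m ^ 2 * φ z - 1 / 4 * Laplacian.laplacian φ z :=
      (hφ.continuous.const_mul _).sub ((continuous_laplacian hφ).const_mul _)
    have h0 : ∀ z ∉ tsupport φ, m ^ 2 * φ z - 1 / 4 * Laplacian.laplacian φ z = 0 := fun z hz => by
      rw [laplacian_eq_zero_of_notMem_tsupport hz, image_eq_zero_of_notMem_tsupport hz]; ring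
    have e1 := h₁.equation φ hφ hc hs
    have e2 := h₂.equation φ hφ hc hs
    have := integral_sub (integrableOn_mul_of_compact hΩ h₁.locallyIntegrableOn hc hs hψ h0)
      (integrableOn_mul_of_compact hΩ h₂.locallyIntegrableOn hc hs hψ h0)
    rw [e1, e2, sub_self] at this
    rw [← this]
    congr 1; ext z; simp only [hh]; ring
  suffices H : ∀ ε > 0, h v ≤ 4 * ε + ε * R ^ 2 by
    have : Tendsto (fun ε : ℝ => 4 * ε + ε * R ^ 2) (𝓝[>] 0) (𝓝 (4 * 0 + 0 * R ^ 2)) :=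
      (Continuous.tendsto (by fun_prop) 0).mono_left nhdsWithin_le_nhds
    have := ge_of_tendsto this (eventually_nhdsWithin_of_forall fun ε hε => H ε hε)
    simp only [hh] at this
    linarith
  intro ε hε
  obtain ⟨η₀, hη₀, hbd⟩ := exists_uniform_dirichlet hΩR hdir hε
  set η := min η₀ (Metric.infDist v Ωᶜ) with hη
  have hηpos : 0 < η := lt_min hη₀ (infDist_compl_pos hΩ hΩR hv)
  obtain ⟨r₀, hr₀, hr₀v⟩ := Metric.continuousAt_iff.1 hcont ε hε
  set r := min r₀ (η / 8) with hr
  have hrpos : 0 < r := lt_min hr₀ (by positivity)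
  have hrη : r ≤ η / 8 := min_le_right _ _
  set K : ℝ → Set ℂ := fun η => {z | η ≤ Metric.infDist z Ωᶜ} with hKdef
  have hKc : ∀ s, 0 < s → IsCompact (K s) := fun s hs => isCompact_le_infDist_compl hΩR hs
  have hKΩ : ∀ s, 0 < s → K s ⊆ Ω := fun s hs z hz => mem_of_infDist_compl_pos (hs.trans_le hz)
  have hKm : ∀ s, MeasurableSet (K s) := fun s =>
    (isClosed_le continuous_const (Metric.continuous_infDist_pt _)).measurableSet
  -- The cut-off makes `h` globally integrable. The mollifier has radius at most `η / 8`, so over `K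
  -- (η / 2)` the convolution sees only points where `k = h`.
  set k : ℂ → ℝ := (K (η / 4)).indicator h with hk
  have hkint : Integrable k :=
    (integrable_indicator_iff (hKm _)).2
      (hli.integrableOn_compact_subset (hKΩ _ (by positivity)) (hKc _ (by positivity)))
  have hkK : ∀ z, η / 4 ≤ Metric.infDist z Ωᶜ → k z = h z := fun z hz =>
    Set.indicator_of_mem (show z ∈ K (η / 4) from hz) h
  let B : ContDiffBump (0 : ℂ) := ⟨r / 2, r, by positivity, by linarith⟩
  set ρ : ℂ → ℝ := B.normed volume with hρ
  have hρs : ContDiff ℝ ∞ ρ := B.contDiff_normed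
  have hρc : HasCompactSupport ρ := B.hasCompactSupport_normed
  set H : ℂ → ℝ := convolution ρ k (ContinuousLinearMap.lsmul ℝ ℝ) volume with hH
  have hHc : Continuous H := hρc.continuous_convolution_left _ hρs.continuous hkint.locallyIntegrable
  have hHint : ∀ z, H z = ∫ w, k w * ρ (z - w) := fun z => by
    rw [hH, convolution_eq_swap]
    simp [mul_comm]
  have hvK : v ∈ K (η / 2) := by
    have : η ≤ Metric.infDist v Ωᶜ := min_le_right _ _
    simp only [hKdef, Set.mem_ofPred_eq]; linarith
  obtain ⟨z₀, hz₀, hmax⟩ := (hKc (η / 2) (by positivity)).exists_isMaxOn ⟨v, hvK⟩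
    (f := fun z => H z + ε * Complex.normSq z)
    (hHc.add (Complex.continuous_normSq.const_mul _)).continuousOn
  have hz₀' : η / 2 ≤ Metric.infDist z₀ Ωᶜ := hz₀
  have hz₀R : Complex.normSq z₀ ≤ R ^ 2 := by
    have := hΩR (hKΩ _ (by positivity) hz₀)
    rw [mem_ball_zero_iff] at this
    rw [Complex.normSq_eq_norm_sq]
    exact pow_le_pow_left₀ (norm_nonneg _) this.le 2
  have hHz₀ : H z₀ ≤ 3 * ε := by
    -- Either `z₀` is at distance exactly `η / 2` from the complement, where `h` is within `ε` of
    -- zero nearby, or all small translates of `z₀` stay in `K (η / 2)`.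
    rcases hz₀'.eq_or_lt with hz₀e | hz₀l
    · have near : ∀ x ∈ Metric.ball z₀ B.rOut, |k x| < ε := by
        intro x hx
        have hx' : dist x z₀ < r := hx
        have i1 := infDist_sub_le z₀ x Ωᶜ
        have i2 := infDist_sub_le x z₀ Ωᶜ
        rw [dist_comm] at i1
        rw [hkK x (by linarith)]
        refine hbd x (mem_of_infDist_compl_pos (by linarith)) ?_
        have : η ≤ η₀ := min_le_left _ _
        linarith
      have n0 := near z₀ (Metric.mem_ball_self B.rOut_pos)
      have := B.dist_normed_convolution_le (μ := volume) (g := k) (x₀ := z₀) (ε := 2 * ε)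
        hkint.aestronglyMeasurable (fun x hx => by
          have := near x hx
          rw [Real.dist_eq]
          exact (abs_sub _ _).trans (by linarith))
      rw [Real.dist_eq] at this
      have a1 := (abs_le.1 this).2
      have a2 := (abs_lt.1 n0).2
      change H z₀ - k z₀ ≤ _ at a1
      linarith
    · set φ : ℂ → ℝ := fun w => ρ (z₀ - w) with hφ
      have hφs : ContDiff ℝ ∞ φ := hρs.comp (contDiff_const.sub contDiff_id)
      have hsupp : tsupport φ ⊆ Metric.closedBall z₀ r := by
        refine closure_minimal (fun w hw => ?_) Metric.isClosed_closedBall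
        have : z₀ - w ∈ Function.support ρ := hw
        rw [hρ, B.support_normed_eq, mem_ball_zero_iff] at this
        rw [Metric.mem_closedBall, dist_comm, dist_eq_norm]
        exact this.le
      have hφc : HasCompactSupport φ :=
        (isCompact_closedBall z₀ r).of_isClosed_subset (isClosed_tsupport _) hsupp
      have hsK : Metric.closedBall z₀ r ⊆ K (η / 4) := by
        intro w hw
        rw [Metric.mem_closedBall, dist_comm] at hw
        have := infDist_sub_le z₀ w Ωᶜ
        simp only [hKdef, Set.mem_ofPred_eq]; linarith
      have hsΩ : tsupport φ ⊆ Ω := hsupp.trans (hsK.trans (hKΩ _ (by positivity)))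
      have restr : ∀ ψ : ℂ → ℝ, (∀ z ∉ tsupport φ, ψ z = 0) →
          ∫ z in Ω, h z * ψ z = ∫ z, k z * ψ z := by
        intro ψ hψ
        rw [← integral_indicator hΩ.measurableSet]
        congr 1; ext z
        by_cases hz : z ∈ tsupport φ
        · rw [Set.indicator_of_mem (hsΩ hz), hkK z (hsK (hsupp hz))]
        · simp [hψ z hz, Set.indicator]
      have e1 := heq φ hφs hφc hsΩ
      rw [restr _ (fun z hz => by
        rw [laplacian_eq_zero_of_notMem_tsupport hz, image_eq_zero_of_notMem_tsupport hz]
        ring)] at e1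
      obtain ⟨Cφ, hCφ⟩ := hφs.continuous.bounded_above_of_compact_support hφc
      have hlapc : HasCompactSupport (Laplacian.laplacian φ) :=
        hφc.mono' fun z hz => by
          by_contra hn
          exact hz (laplacian_eq_zero_of_notMem_tsupport hn)
      obtain ⟨CL, hCL⟩ := (continuous_laplacian hφs).bounded_above_of_compact_support hlapc
      have int1 : Integrable fun z => k z * φ z :=
        hkint.mul_bdd hφs.continuous.aestronglyMeasurable (Eventually.of_forall hCφ)
      have int2 : Integrable fun z => k z * Laplacian.laplacian φ z :=
        hkint.mul_bdd (continuous_laplacian hφs).aestronglyMeasurable (Eventually.of_forall hCL)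
      have e2 : m ^ 2 * H z₀ - 1 / 4 * ∫ z, k z * Laplacian.laplacian φ z = 0 := by
        rw [← e1, hHint, ← integral_const_mul, ← integral_const_mul,
          ← integral_sub (int1.const_mul _) (int2.const_mul _)]
        congr 1; ext z; simp only [hφ]; ring
      set t : ℕ → ℝ := fun n => 1 / ((n : ℝ) + 1) with ht
      have htpos : ∀ n, 0 < t n := fun n => by simp only [ht]; positivity
      have ht0 : Tendsto t atTop (𝓝 0) := tendsto_one_div_add_atTop_nhds_zero_nat
      have hlim := tendsto_integral_mul_secondDiff hkint hφs hφc htpos ht0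
      have hsd := fun s => secondDiff_integral hkint hρs.continuous hρc hHint s z₀
      -- The second difference of `ε |z|²` with step `t` is `4 ε t²`, so maximality forces that of
      -- `H` to be at most `-4 ε t²`.
      have hle : ∀ᶠ n in atTop, ∫ z, k z * (secondDiff φ (t n) z / t n ^ 2) ≤ -(4 * ε) := by
        have hsm : ∀ᶠ n in atTop, t n < Metric.infDist z₀ Ωᶜ - η / 2 :=
          ht0.eventually_lt_const (by linarith)
        filter_upwards [hsm] with n hn
        have htn := htpos n
        have mem : ∀ e : ℂ, ‖e‖ = t n → H (z₀ + e) + ε * Complex.normSq (z₀ + e) ≤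
            H z₀ + ε * Complex.normSq z₀ := by
          intro e he
          apply hmax
          have := infDist_sub_le z₀ (z₀ + e) Ωᶜ
          rw [dist_self_add_right, he] at this
          simp only [hKdef, Set.mem_ofPred_eq]; linarith
        have m1 := mem (t n) (by simp [abs_of_pos htn])
        have m2 := mem (-t n) (by simp [abs_of_pos htn])
        have m3 := mem (t n * Complex.I) (by simp [abs_of_pos htn])
        have m4 := mem (-(t n * Complex.I)) (by simp [abs_of_pos htn])
        have e3 : ∫ z, k z * (secondDiff φ (t n) z / t n ^ 2) = secondDiff H (t n) z₀ / t n ^ 2 := by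
          rw [hsd, ← integral_div]
          congr 1; ext z; ring
        rw [e3, div_le_iff₀ (by positivity)]
        unfold secondDiff
        simp only [← sub_eq_add_neg] at m2 m4
        simp only [Complex.normSq_apply, Complex.add_re, Complex.add_im, Complex.sub_re,
          Complex.sub_im, Complex.mul_re, Complex.mul_im, Complex.ofReal_re, Complex.ofReal_im,
          Complex.I_re, Complex.I_im] at m1 m2 m3 m4
        linarith
      have e4 := le_of_tendsto hlim hle
      have e5 : m ^ 2 * H z₀ ≤ -ε := by linarith
      by_contra! hlt
      have : 0 ≤ m ^ 2 * H z₀ := mul_nonneg (sq_nonneg m) (by linarith)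
      linarith
  have hHv : |H v - h v| ≤ ε := by
    rw [← hkK v (by have : η ≤ Metric.infDist v Ωᶜ := min_le_right _ _; linarith), ← Real.dist_eq]
    refine B.dist_normed_convolution_le (μ := volume) hkint.aestronglyMeasurable fun x hx => ?_
    have hx' : dist x v < r := hx
    have i1 := infDist_sub_le v x Ωᶜ
    rw [dist_comm] at i1
    have : η ≤ Metric.infDist v Ωᶜ := min_le_right _ _
    rw [hkK x (by linarith), hkK v (by linarith)]
    exact (hr₀v (hx'.trans_le (min_le_left _ _))).le
  have hm := hmax hvK
  simp only [Set.mem_ofPred_eq] at hm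
  have := (abs_le.1 hHv).1
  have hn := Complex.normSq_nonneg v
  have := mul_nonneg hε.le hn
  have := mul_le_mul_of_nonneg_left hz₀R hε.le
  linarith

theorem IsMassiveGreen.unique {R : ℝ} (hΩ : IsOpen Ω) (hΩR : Ω ⊆ Metric.ball 0 R) {g₁ g₂ : ℂ → ℝ}
    (h₁ : IsMassiveGreen m Ω u g₁) (h₂ : IsMassiveGreen m Ω u g₂) {v : ℂ} (hv : v ∈ Ω)
    (hvu : v ≠ u) : g₁ v = g₂ v :=
  le_antisymm (h₁.le hΩ hΩR h₂ hv hvu) (h₂.le hΩ hΩR h₁ hv hvu)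

end

/-! ### Estimates for partition functions uniform in the mesh -/

noncomputable section

variable {m δ R : ℝ} {V : Set (ℤ × ℤ)}

/-- An upper bound for partition functions between points at distance at least `r`. -/
def farBound (R r : ℝ) : ℝ := max 0 (Real.log (19 * R ^ 2 / r ^ 2) / Real.log 2)

theorem farBound_nonneg (R r : ℝ) : 0 ≤ farBound R r := le_max_left _ _

theorem dist_gridPoint_sq (δ : ℝ) (p q : ℤ × ℤ) : dist (gridPoint δ p) (gridPoint δ q) ^ 2 =
    (δ * (p.1 - q.1)) ^ 2 + (δ * (p.2 - q.2)) ^ 2 := by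
  rw [dist_eq_norm, ← Complex.normSq_eq_norm_sq, Complex.normSq_apply]
  simp only [gridPoint, Complex.sub_re, Complex.sub_im]
  ring

theorem dist_gridPoint_le (hδ : 0 ≤ δ) (p q : ℤ × ℤ) : dist (gridPoint δ p) (gridPoint δ q) ≤
    δ * (|p.1 - q.1| + |p.2 - q.2| : ℤ) := by
  rw [dist_eq_norm]
  refine (Complex.norm_le_abs_re_add_abs_im _).trans ?_
  simp only [gridPoint, Complex.sub_re, Complex.sub_im, ← mul_sub, abs_mul, abs_of_nonneg hδ]
  push_cast
  rw [mul_add]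

theorem abs_sub_le_dist_gridPoint (hδ : 0 ≤ δ) (p q : ℤ × ℤ) :
    δ * |(p.1 : ℝ) - q.1| ≤ dist (gridPoint δ p) (gridPoint δ q) ∧
    δ * |(p.2 : ℝ) - q.2| ≤ dist (gridPoint δ p) (gridPoint δ q) := by
  rw [dist_eq_norm]
  constructor
  · refine le_trans (le_of_eq ?_) (Complex.abs_re_le_norm _)
    simp only [gridPoint, Complex.sub_re, ← mul_sub, abs_mul, abs_of_nonneg hδ]
  · refine le_trans (le_of_eq ?_) (Complex.abs_im_le_norm _)
    simp only [gridPoint, Complex.sub_im, ← mul_sub, abs_mul, abs_of_nonneg hδ]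

theorem IsBoundedMesh.le_farBound (hV : IsBoundedMesh m δ R V) {p q : ℤ × ℤ} (hp : p ∈ V) {r : ℝ}
    (hr : 0 < r) (h : r ≤ dist (gridPoint δ q) (gridPoint δ p)) :
    walkPartition m δ V q p ≤ farBound R r := by
  by_cases hq : q ∈ V
  · refine (hV.walkPartition_le hq hp).trans ((le_max_right _ _).trans' ?_)
    have hδ := hV.pos
    have hR : 0 < R := hδ.trans_le hV.le
    rw [logMajorant_eq hδ hR]
    have e := dist_gridPoint_sq δ q p
    have h2 := pow_le_pow_left₀ hr.le h 2
    have : 0 < Real.log 2 := Real.log_pos (by norm_num)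
    have hδ2 : 0 < δ ^ 2 := by positivity
    push_cast
    gcongr
    linarith
  · rw [walkPartition_of_notMem m δ hq hp]; exact farBound_nonneg _ _

theorem IsBoundedMesh.nbrAvg_sub (hV : IsBoundedMesh m δ R V) {p : ℤ × ℤ} (hp : p ∈ V) {q : ℤ × ℤ}
    (hq : q ∈ V) (hqp : q ≠ p) : walkPartition m δ V q p =
      (1 - m ^ 2 * δ ^ 2) * nbrAvg (fun x y => walkPartition m δ V (x, y) p) q.1 q.2 := by
  have := hV.walkPartition_eq hq hp
  rwa [if_neg hqp, zero_add] at this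

/-- The mass only strengthens the inequality, and extension by zero preserves it off `V`. So
subharmonicity holds on the whole grid except at the pole, as the Beurling estimate requires. -/
theorem IsBoundedMesh.subMean (hV : IsBoundedMesh m δ R V) {p : ℤ × ℤ} (hp : p ∈ V) {q : ℤ × ℤ}
    (hqp : q ≠ p) : walkPartition m δ V q p ≤
      nbrAvg (fun x y => walkPartition m δ V (x, y) p) q.1 q.2 := by
  have h0 : 0 ≤ nbrAvg (fun x y => walkPartition m δ V (x, y) p) q.1 q.2 := by
    have := hV.walkPartition_nonneg
    unfold nbrAvg
    have a1 := this (q.1 + 1, q.2) p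
    have a2 := this (q.1 - 1, q.2) p
    have a3 := this (q.1, q.2 + 1) p
    have a4 := this (q.1, q.2 - 1) p
    positivity
  by_cases hq : q ∈ V
  · rw [hV.nbrAvg_sub hp hq hqp]
    have : 0 ≤ m ^ 2 * δ ^ 2 := by positivity
    nlinarith
  · rw [walkPartition_of_notMem m δ hq hp]; exact h0

/-- Lipschitz constant of partition functions at scale `ρ` away from the pole. -/
def lipConst (m R ρ : ℝ) : ℝ := 16 * farBound R ρ / ρ + 16 * m ^ 2 * farBound R ρ * ρ

theorem lipConst_nonneg (m R : ℝ) {ρ : ℝ} (hρ : 0 < ρ) : 0 ≤ lipConst m R ρ := by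
  have := farBound_nonneg R ρ
  unfold lipConst; positivity

/-- The box estimate at lattice radius `ρ / δ`: off the pole the defect from the average is at most
`m² δ² M`, so a lattice step changes the value by `O(δ)`, uniformly in the mesh. -/
theorem IsBoundedMesh.abs_walkPartition_sub_le (hV : IsBoundedMesh m δ R V) {p : ℤ × ℤ}
    (hp : p ∈ V) {v : ℂ} {ρ : ℝ} (hδρ : 2 * δ ≤ ρ)
    (hD : Metric.ball v (8 * ρ) ⊆ polygonalDomain δ V) (hpv : 9 * ρ ≤ dist (gridPoint δ p) v)
    {q q' : ℤ × ℤ} (hq : dist (gridPoint δ q) v < ρ) (hq' : dist (gridPoint δ q') v < ρ) :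
    |walkPartition m δ V q' p - walkPartition m δ V q p| ≤
      lipConst m R ρ * dist (gridPoint δ q') (gridPoint δ q) := by
  have hδ := hV.pos
  have hρ : 0 < ρ := by linarith
  set M := farBound R ρ with hM
  have hM0 : 0 ≤ M := farBound_nonneg _ _
  set N : ℕ := ⌊ρ / δ⌋₊ with hN
  set n : ℕ := max (q'.1 - q.1).natAbs (q'.2 - q.2).natAbs with hn
  set d := dist (gridPoint δ q') (gridPoint δ q) with hd
  have hdρ : d < 2 * ρ := by
    have := dist_triangle_right (gridPoint δ q') (gridPoint δ q) v; linarith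
  obtain ⟨c1, c2⟩ := abs_sub_le_dist_gridPoint hδ.le q' q
  have hNδ : (N : ℝ) * δ ≤ ρ := by
    rw [← le_div_iff₀ hδ]; exact Nat.floor_le (by positivity)
  have hNδ' : ρ / 2 ≤ (N : ℝ) * δ := by
    have : ρ / δ < N + 1 := Nat.lt_floor_add_one _
    rw [div_lt_iff₀ hδ] at this
    linarith
  have hN1 : 1 ≤ N := by
    rw [hN, Nat.one_le_floor_iff, one_le_div hδ]; linarith
  have hNpos : (0 : ℝ) < N := by exact_mod_cast hN1
  have e1 : ((q'.1 - q.1).natAbs : ℝ) = |(q'.1 : ℝ) - q.1| := by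
    rw [Nat.cast_natAbs]; push_cast; rfl
  have e2 : ((q'.2 - q.2).natAbs : ℝ) = |(q'.2 : ℝ) - q.2| := by
    rw [Nat.cast_natAbs]; push_cast; rfl
  have hnδ : δ * (n : ℝ) ≤ d := by
    rcases max_cases (q'.1 - q.1).natAbs (q'.2 - q.2).natAbs with h | h
    · rw [hn, h.1, e1]; exact c1
    · rw [hn, h.1, e2]; exact c2
  -- Since `N δ ≤ ρ` and `n δ < 2 ρ`, two coordinates contribute less than `6 ρ`, and `q` is within
  -- `ρ` of `v`.
  have far : ∀ x y : ℤ, |x - q.1| ≤ N + n → |y - q.2| ≤ N + n →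
      dist (gridPoint δ (x, y)) v < 8 * ρ := by
    intro x y hx hy
    have h1 := dist_gridPoint_le hδ.le (x, y) q
    have hx' : |(x : ℝ) - q.1| ≤ N + n := by exact_mod_cast hx
    have hy' : |(y : ℝ) - q.2| ≤ N + n := by exact_mod_cast hy
    push_cast at h1
    have h2 : δ * (|(x : ℝ) - q.1| + |(y : ℝ) - q.2|) ≤ δ * ((N + n) + (N + n)) := by gcongr
    have h3 := dist_triangle (gridPoint δ (x, y)) (gridPoint δ q) v
    linarith
  have hpole : ∀ x y : ℤ, dist (gridPoint δ (x, y)) v < 8 * ρ →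
      ρ ≤ dist (gridPoint δ (x, y)) (gridPoint δ p) := by
    intro x y h
    have := dist_triangle_left (gridPoint δ p) v (gridPoint δ (x, y))
    linarith
  have hbd : ∀ x y : ℤ, |x - q.1| ≤ N + n → |y - q.2| ≤ N + n →
      |walkPartition m δ V (x, y) p| ≤ M := by
    intro x y hx hy
    rw [abs_of_nonneg (hV.walkPartition_nonneg _ _)]
    exact hV.le_farBound hp hρ (hpole x y (far x y hx hy))
  have main := abs_sub_le_of_nbrAvg (h := fun x y => walkPartition m δ V (x, y) p) hN1 (M := M)
    (C := m ^ 2 * δ ^ 2 * M) (a := q.1) (b := q.2) (a' := q'.1) (b' := q'.2) (n := n) hbd ?_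
    (by rw [abs_le]; omega) (by rw [abs_le]; omega)
  · refine main.trans ?_
    have hs : δ * (|q'.1 - q.1| + |q'.2 - q.2| : ℤ) ≤ 2 * d := by
      push_cast; linarith
    have k1 : 4 * M / N ≤ 8 * M / ρ * δ := by
      rw [div_le_iff₀ hNpos]
      have : 8 * M / ρ * δ * N = 8 * M / ρ * (N * δ) := by ring
      rw [this]
      calc 4 * M = 8 * M / ρ * (ρ / 2) := by field_simp; ring
        _ ≤ _ := by gcongr
    have k2 : 8 * (m ^ 2 * δ ^ 2 * M) * N ≤ 8 * m ^ 2 * M * ρ * δ := by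
      have : 8 * (m ^ 2 * δ ^ 2 * M) * N = 8 * m ^ 2 * M * δ * (N * δ) := by ring
      rw [this]
      calc _ ≤ 8 * m ^ 2 * M * δ * ρ := by gcongr
        _ = _ := by ring
    have hsum : (0 : ℝ) ≤ (|q'.1 - q.1| + |q'.2 - q.2| : ℤ) := by positivity
    calc _ ≤ (8 * M / ρ * δ + 8 * m ^ 2 * M * ρ * δ) * (|q'.1 - q.1| + |q'.2 - q.2| : ℤ) := by
          gcongr
      _ = (8 * M / ρ + 8 * m ^ 2 * M * ρ) * (δ * (|q'.1 - q.1| + |q'.2 - q.2| : ℤ)) := by ring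
      _ ≤ (8 * M / ρ + 8 * m ^ 2 * M * ρ) * (2 * d) := by gcongr
      _ = lipConst m R ρ * d := by unfold lipConst; ring
  · intro x y hx hy
    have hf := far x y hx.le hy.le
    have hxV : (x, y) ∈ V := (gridPoint_mem_polygonalDomain hδ).1 (hD hf)
    have hne : (x, y) ≠ p := by
      rintro rfl
      have := hpole x y hf
      rw [dist_self] at this; linarith
    have e := hV.nbrAvg_sub hp hxV hne
    have n0 := fun q => hV.walkPartition_nonneg q p
    rw [abs_lt] at hx hy
    have b1 := (le_abs_self _).trans (hbd (x + 1) y (by rw [abs_le]; omega) (by rw [abs_le]; omega))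
    have b2 := (le_abs_self _).trans (hbd (x - 1) y (by rw [abs_le]; omega) (by rw [abs_le]; omega))
    have b3 := (le_abs_self _).trans (hbd x (y + 1) (by rw [abs_le]; omega) (by rw [abs_le]; omega))
    have b4 := (le_abs_self _).trans (hbd x (y - 1) (by rw [abs_le]; omega) (by rw [abs_le]; omega))
    have hA0 : 0 ≤ nbrAvg (fun x y => walkPartition m δ V (x, y) p) x y := by
      unfold nbrAvg
      have a1 := n0 (x + 1, y)
      have a2 := n0 (x - 1, y)
      have a3 := n0 (x, y + 1)
      have a4 := n0 (x, y - 1)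
      positivity
    have hAM : nbrAvg (fun x y => walkPartition m δ V (x, y) p) x y ≤ M := by
      unfold nbrAvg; linarith
    have : walkPartition m δ V (x, y) p - nbrAvg (fun x y => walkPartition m δ V (x, y) p) x y =
        -(m ^ 2 * δ ^ 2 * nbrAvg (fun x y => walkPartition m δ V (x, y) p) x y) := by
      rw [e]; ring
    simp only [this, abs_neg]
    rw [abs_of_nonneg (by positivity)]
    gcongr

/-- Decay of partition functions near the boundary of a simply connected discrete domain. -/
theorem IsBoundedMesh.walkPartition_le_near_boundary (hV : IsBoundedMesh m δ R V)
    (hs : IsSimplyConnected (polygonalDomain δ V)) {p : ℤ × ℤ} (hp : p ∈ V) {ξ : ℂ}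
    (hξ : ξ ∉ polygonalDomain δ V) {ρ : ℝ} (hpξ : 4 * ρ ≤ dist (gridPoint δ p) ξ) (k : ℕ)
    (hδρ : δ ≤ ρ / 64 ^ k / 4) {q : ℤ × ℤ} (hq : dist (gridPoint δ q) ξ ≤ ρ / 64 ^ k / 4) :
    walkPartition m δ V q p ≤ decayConst ^ k * farBound R ρ := by
  have hδ := hV.pos
  have h64 : (1 : ℝ) ≤ 64 ^ k := one_le_pow₀ (by norm_num)
  set s := ρ / 64 ^ k / 4 with hsdef
  have hρs : ρ = 64 ^ k * (4 * s) := by rw [hsdef]; field_simp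
  have hs0 : 0 < s := hδ.trans_le hδρ
  have hsρ : 4 * s ≤ ρ := by rw [hρs]; nlinarith
  -- The vertex nearest to `ξ` cannot belong to `V`, as its open square contains `ξ`; it serves as
  -- the branch point.
  set p₀ : ℤ × ℤ := (round (ξ.re / δ), round (ξ.im / δ)) with hp₀
  have hr1 : |ξ.re - δ * p₀.1| ≤ δ / 2 := by
    have := abs_sub_round (ξ.re / δ)
    have e : ξ.re - δ * p₀.1 = δ * (ξ.re / δ - round (ξ.re / δ)) := by
      simp only [hp₀]; field_simp
    rw [e, abs_mul, abs_of_pos hδ]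
    nlinarith
  have hr2 : |ξ.im - δ * p₀.2| ≤ δ / 2 := by
    have := abs_sub_round (ξ.im / δ)
    have e : ξ.im - δ * p₀.2 = δ * (ξ.im / δ - round (ξ.im / δ)) := by
      simp only [hp₀]; field_simp
    rw [e, abs_mul, abs_of_pos hδ]
    nlinarith
  have hp₀V : p₀ ∉ V := fun h => hξ ⟨p₀, h, by linarith, by linarith⟩
  have hdξ : dist (gridPoint δ p₀) ξ ≤ δ := by
    rw [dist_comm, dist_eq_norm]
    refine (Complex.norm_le_abs_re_add_abs_im _).trans ?_
    simp only [gridPoint, Complex.sub_re, Complex.sub_im]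
    linarith
  -- With `4 * s = ρ / 64 ^ k`, the largest box of the iteration, of lattice radius `64 ^ k * n`,
  -- has size at most `ρ` and stays away from the pole.
  set n : ℕ := ⌊4 * s / δ⌋₊ with hn
  have hnδ : (n : ℝ) * δ ≤ 4 * s := by
    rw [← le_div_iff₀ hδ]; exact Nat.floor_le (by positivity)
  have hnδ' : 4 * s < (n + 1) * δ := by
    rw [← div_lt_iff₀ hδ]; exact Nat.lt_floor_add_one _
  obtain ⟨P, hP⟩ := exists_isSheet hδ hs hp₀V (h := fun q => walkPartition m δ V q p)
    (fun q hq => walkPartition_of_notMem m δ hq hp)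
  have far : ∀ x y : ℤ, |x| ≤ 64 ^ k * n → |y| ≤ 64 ^ k * n →
      ρ ≤ dist (gridPoint δ (p₀.1 + x, p₀.2 + y)) (gridPoint δ p) := by
    intro x y hx hy
    have h1 := dist_gridPoint_le hδ.le (p₀.1 + x, p₀.2 + y) p₀
    simp only [add_sub_cancel_left] at h1
    have hx' : |(x : ℝ)| ≤ 64 ^ k * n := by exact_mod_cast hx
    have hy' : |(y : ℝ)| ≤ 64 ^ k * n := by exact_mod_cast hy
    have h2 : δ * ((|x| + |y| : ℤ) : ℝ) ≤ 2 * ρ := by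
      push_cast
      calc δ * (|(x : ℝ)| + |(y : ℝ)|) ≤ δ * (64 ^ k * n + 64 ^ k * n) := by gcongr
        _ = 2 * (64 ^ k * (n * δ)) := by ring
        _ ≤ 2 * (64 ^ k * (4 * s)) := by gcongr
        _ = 2 * ρ := by rw [← hρs]
    have t1 := dist_triangle (gridPoint δ p) (gridPoint δ p₀) ξ
    have t2 := dist_triangle_left (gridPoint δ p) (gridPoint δ p₀) (gridPoint δ (p₀.1 + x, p₀.2 + y))
    linarith
  have := hP.le_decayConst_pow_mul (n := n) (M := farBound R ρ)
    (fun x y => hV.walkPartition_nonneg _ _)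
    (walkPartition_of_notMem m δ (by simpa using hp₀V) hp) k
    (fun x y hx hy => hV.le_farBound hp (by linarith) (far x y hx hy))
    (fun x y hx hy => by
      have := hV.subMean hp (q := (p₀.1 + x, p₀.2 + y)) (by
        intro h
        have := far x y hx.le hy.le
        rw [h, dist_self] at this
        linarith)
      simpa only [nbrAvg, add_assoc, add_sub_assoc] using this)
    (q.1 - p₀.1) (q.2 - p₀.2) ?_ ?_
  · simpa using this
  all_goals
    obtain ⟨c1, c2⟩ := abs_sub_le_dist_gridPoint hδ.le q p₀
    have t := dist_triangle_right (gridPoint δ q) (gridPoint δ p₀) ξ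
    have hlt : δ * (n : ℝ) + δ > 2 * s + δ := by linarith
  · have : δ * |(q.1 : ℝ) - p₀.1| < δ * (n + 1) := by linarith
    have := lt_of_mul_lt_mul_left this hδ.le
    have : |q.1 - p₀.1| < n + 1 := by exact_mod_cast this
    omega
  · have : δ * |(q.2 : ℝ) - p₀.2| < δ * (n + 1) := by linarith
    have := lt_of_mul_lt_mul_left this hδ.le
    have : |q.2 - p₀.2| < n + 1 := by exact_mod_cast this
    omega

end

/-! ### Approximating sequences and compactness -/

noncomputable section

/-- The vertex of the grid at the lower left corner of the cell containing a point. -/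
def cell (δ : ℝ) (z : ℂ) : ℤ × ℤ := (⌊z.re / δ⌋, ⌊z.im / δ⌋)

theorem floor_mul_bounds {δ : ℝ} (hδ : 0 < δ) (x : ℝ) :
    δ * ⌊x / δ⌋ ≤ x ∧ x < δ * ⌊x / δ⌋ + δ := by
  have h1 := Int.floor_le (x / δ)
  have h2 := Int.lt_floor_add_one (x / δ)
  rw [le_div_iff₀ hδ] at h1
  rw [div_lt_iff₀ hδ] at h2
  constructor <;> linarith

theorem dist_cell_le {δ : ℝ} (hδ : 0 < δ) (z : ℂ) : dist (gridPoint δ (cell δ z)) z ≤ 2 * δ := by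
  rw [dist_comm, dist_eq_norm]
  refine (Complex.norm_le_abs_re_add_abs_im _).trans ?_
  obtain ⟨a1, a2⟩ := floor_mul_bounds hδ z.re
  obtain ⟨b1, b2⟩ := floor_mul_bounds hδ z.im
  simp only [gridPoint, cell, Complex.sub_re, Complex.sub_im]
  rw [abs_of_nonneg (by linarith), abs_of_nonneg (by linarith)]
  linarith

theorem tendsto_cell {ι : Type*} {l : Filter ι} {δ : ι → ℝ} (hδ : Tendsto δ l (𝓝[>] 0)) (z : ℂ) :
    Tendsto (fun i => gridPoint (δ i) (cell (δ i) z)) l (𝓝 z) := by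
  rw [tendsto_iff_dist_tendsto_zero]
  have h0 : Tendsto (fun i => 2 * δ i) l (𝓝 0) := by
    simpa using (hδ.mono_right nhdsWithin_le_nhds).const_mul 2
  refine squeeze_zero' (Eventually.of_forall fun _ => dist_nonneg) ?_ h0
  filter_upwards [hδ.eventually self_mem_nhdsWithin] with i hi
  exact dist_cell_le hi z

theorem gridPoint_add (δ : ℝ) (p q : ℤ × ℤ) : gridPoint δ (p + q) = gridPoint δ p + gridPoint δ q := by
  apply Complex.ext <;> simp [gridPoint, mul_add]

theorem measurable_cell (δ : ℝ) : Measurable (cell δ) :=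
  (Complex.measurable_re.div_const δ).floor.prodMk (Complex.measurable_im.div_const δ).floor

theorem volume_cell {δ : ℝ} (hδ : 0 < δ) (q : ℤ × ℤ) :
    volume.real {z : ℂ | cell δ z = q} = δ ^ 2 := by
  have : {z : ℂ | cell δ z = q} = Complex.measurableEquivRealProd ⁻¹'
      (Set.Ico (δ * q.1) (δ * q.1 + δ) ×ˢ Set.Ico (δ * q.2) (δ * q.2 + δ)) := by
    ext z
    simp only [Set.mem_ofPred_eq, cell, Prod.ext_iff, Int.floor_eq_iff, Set.mem_preimage,
      Complex.measurableEquivRealProd_apply, Set.mem_prod, Set.mem_Ico, le_div_iff₀ hδ,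
      div_lt_iff₀ hδ, add_mul, one_mul, mul_comm δ]
  rw [Measure.real, this, Complex.volume_preserving_equiv_real_prod.measure_preimage_equiv,
    Measure.volume_eq_prod, Measure.prod_prod, Real.volume_Ico, Real.volume_Ico]
  simp only [add_sub_cancel_left]
  rw [← ENNReal.ofReal_mul hδ.le, ENNReal.toReal_ofReal (by positivity), sq]

theorem integral_cell {δ : ℝ} (hδ : 0 < δ) {F : ℤ × ℤ → ℝ} (hF : F.support.Finite) :
    ∫ z, F (cell δ z) = δ ^ 2 * ∑' q, F q := by
  have hms : ∀ q, MeasurableSet {z : ℂ | cell δ z = q} := fun q =>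
    measurable_cell δ (measurableSet_singleton q)
  have e : (fun z => F (cell δ z)) = fun z =>
      ∑ q ∈ hF.toFinset, Set.indicator {z : ℂ | cell δ z = q} (fun _ => F q) z := by
    ext z
    by_cases h : F (cell δ z) = 0
    · rw [h, Finset.sum_eq_zero]
      intro q _
      by_cases hq : cell δ z = q
      · rw [Set.indicator_of_mem (show z ∈ {z : ℂ | cell δ z = q} from hq), ← hq, h]
      · exact Set.indicator_of_notMem (show z ∉ {z : ℂ | cell δ z = q} from hq) _
    · rw [Finset.sum_eq_single (cell δ z)]
      · exact (Set.indicator_of_mem (show z ∈ {w : ℂ | cell δ w = cell δ z} from rfl)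
          (fun _ => F (cell δ z))).symm
      · intro q _ hq
        exact Set.indicator_of_notMem (show z ∉ {z : ℂ | cell δ z = q} from Ne.symm hq) _
      · intro hn
        exact absurd (by simpa using h) hn
  have hvol : ∀ q, volume {z : ℂ | cell δ z = q} ≠ ⊤ := fun q h => by
    have := volume_cell hδ q
    rw [Measure.real, h] at this
    simp at this
    exact (pow_pos hδ 2).ne this
  rw [e, integral_finsetSum]
  · rw [tsum_eq_sum (s := hF.toFinset) (fun q hq => by simpa using hq), Finset.mul_sum]
    refine Finset.sum_congr rfl fun q _ => ?_
    rw [integral_indicator_const _ (hms q), volume_cell hδ q, smul_eq_mul]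
  · intro q _
    exact (integrable_indicator_iff (hms q)).2 (integrableOn_const (hvol q))

/-- Discrete domains converging to `Ω` together with vertices converging to a pole `u`. -/
structure IsApproximation (m R : ℝ) (Ω : Set ℂ) (u : ℂ) (δ : ℕ → ℝ) (V : ℕ → Set (ℤ × ℤ))
    (p : ℕ → ℤ × ℤ) : Prop where
  isOpen : IsOpen Ω
  subset : Ω ⊆ Metric.ball 0 R
  mem : u ∈ Ω
  mesh : Tendsto δ atTop (𝓝[>] 0)
  bounded : ∀ᶠ n in atTop, IsBoundedMesh m (δ n) R (V n)
  simplyConnected : ∀ᶠ n in atTop, IsSimplyConnected (polygonalDomain (δ n) (V n))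
  converges : CaratheodoryConverges atTop (fun n => polygonalDomain (δ n) (V n)) Ω
  pole : Tendsto (fun n => gridPoint (δ n) (p n)) atTop (𝓝 u)

theorem CaratheodoryConverges.eventually_subset {ι : Type*} {l : Filter ι} {D : ι → Set ℂ}
    {Ω K : Set ℂ} (h : CaratheodoryConverges l D Ω) (hK : IsCompact K) (hKΩ : K ⊆ Ω) :
    ∀ᶠ i in l, K ⊆ D i := by
  refine hK.induction_on (p := fun K => ∀ᶠ i in l, K ⊆ D i) (by simp) ?_ ?_ ?_
  · intro s t hst ht
    filter_upwards [ht] with i hi using hst.trans hi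
  · intro s t hs ht
    filter_upwards [hs, ht] with i h1 h2 using Set.union_subset h1 h2
  · intro z hz
    obtain ⟨U, hU, hU'⟩ := h.interior z (hKΩ hz)
    exact ⟨U, mem_nhdsWithin_of_mem_nhds hU, hU'⟩

theorem CaratheodoryConverges.comp {ι κ : Type*} {l : Filter ι} {l' : Filter κ} {D : ι → Set ℂ}
    {Ω : Set ℂ} (h : CaratheodoryConverges l D Ω) {f : κ → ι} (hf : Tendsto f l' l) :
    CaratheodoryConverges l' (fun k => D (f k)) Ω where
  interior z hz := by
    obtain ⟨U, hU, h'⟩ := h.interior z hz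
    exact ⟨U, hU, hf.eventually h'⟩
  boundary ζ hζ ε hε := hf.eventually (h.boundary ζ hζ ε hε)

theorem CaratheodoryConverges.eventually_mem {ι : Type*} {l : Filter ι} {δ : ι → ℝ}
    {V : ι → Set (ℤ × ℤ)} {Ω : Set ℂ}
    (h : CaratheodoryConverges l (fun i => polygonalDomain (δ i) (V i)) Ω)
    (hδ : Tendsto δ l (𝓝[>] 0)) {z : ℂ} (hz : z ∈ Ω) {p : ι → ℤ × ℤ}
    (hp : Tendsto (fun i => gridPoint (δ i) (p i)) l (𝓝 z)) : ∀ᶠ i in l, p i ∈ V i := by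
  obtain ⟨U, hU, h'⟩ := h.interior z hz
  filter_upwards [h', hp.eventually hU, hδ.eventually self_mem_nhdsWithin] with i h1 h2 h3
  exact (gridPoint_mem_polygonalDomain h3).1 (h1 h2)

variable {m R : ℝ} {Ω : Set ℂ} {u : ℂ} {δ : ℕ → ℝ} {V : ℕ → Set (ℤ × ℤ)} {p : ℕ → ℤ × ℤ}

theorem IsApproximation.comp (h : IsApproximation m R Ω u δ V p) {f : ℕ → ℕ}
    (hf : Tendsto f atTop atTop) : IsApproximation m R Ω u (δ ∘ f) (V ∘ f) (p ∘ f) where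
  isOpen := h.isOpen
  subset := h.subset
  mem := h.mem
  mesh := h.mesh.comp hf
  bounded := hf.eventually h.bounded
  simplyConnected := hf.eventually h.simplyConnected
  converges := h.converges.comp hf
  pole := h.pole.comp hf

theorem IsApproximation.pole_mem (h : IsApproximation m R Ω u δ V p) :
    ∀ᶠ n in atTop, p n ∈ V n :=
  h.converges.eventually_mem h.mesh h.mem h.pole

theorem IsApproximation.lt (h : IsApproximation m R Ω u δ V p) {s : ℝ} (hs : 0 < s) :
    ∀ᶠ n in atTop, δ n < s :=
  (h.mesh.mono_right nhdsWithin_le_nhds).eventually_lt_const hs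

theorem IsApproximation.exists_lipschitz (h : IsApproximation m R Ω u δ V p) {v : ℂ} (hv : v ∈ Ω)
    (hvu : v ≠ u) : ∃ ρ > 0, Metric.ball v ρ ⊆ Ω \ {u} ∧ ∃ L, 0 ≤ L ∧ ∀ᶠ n in atTop,
      ∀ q q', dist (gridPoint (δ n) q) v < ρ → dist (gridPoint (δ n) q') v < ρ →
        |walkPartition m (δ n) (V n) q' (p n) - walkPartition m (δ n) (V n) q (p n)| ≤
          L * dist (gridPoint (δ n) q') (gridPoint (δ n) q) := by
  obtain ⟨r, hr, hrΩ⟩ := Metric.isOpen_iff.1 h.isOpen v hv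
  have hd : 0 < dist u v := dist_pos.2 hvu.symm
  -- The ball of radius `8 ρ` then lies in `Ω` and `u` is at least `10 ρ` away, leaving `9 ρ` for
  -- the lattice pole once it is close to `u`.
  set ρ := min (r / 9) (dist u v / 10) with hρ
  have hρ0 : 0 < ρ := by positivity
  have h1 : ρ ≤ r / 9 := min_le_left _ _
  have h2 : ρ ≤ dist u v / 10 := min_le_right _ _
  refine ⟨ρ, hρ0, fun z hz => ⟨hrΩ ?_, ?_⟩, lipConst m R ρ, lipConst_nonneg m R hρ0, ?_⟩
  · exact Metric.ball_subset_ball (by linarith) hz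
  · rintro rfl
    rw [Metric.mem_ball] at hz
    linarith
  · have hK : Metric.closedBall v (8 * ρ) ⊆ Ω :=
      (Metric.closedBall_subset_ball (by linarith)).trans hrΩ
    have hpole : ∀ᶠ n in atTop, 9 * ρ < dist (gridPoint (δ n) (p n)) v :=
      (h.pole.dist tendsto_const_nhds).eventually_const_lt (by linarith)
    filter_upwards [h.converges.eventually_subset (isCompact_closedBall v (8 * ρ)) hK, hpole,
      h.bounded, h.pole_mem, h.lt (half_pos hρ0)] with n hD hp hb hpm hlt q q' hq hq'
    exact hb.abs_walkPartition_sub_le hpm (by linarith) (Metric.ball_subset_closedBall.trans hD)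
      hp.le hq hq'

/-- The limit of the partition functions at a point does not depend on its lattice approximation. -/
theorem IsApproximation.tendsto_sub_cell (h : IsApproximation m R Ω u δ V p) {v : ℂ} (hv : v ∈ Ω)
    (hvu : v ≠ u) {q : ℕ → ℤ × ℤ} (hq : Tendsto (fun n => gridPoint (δ n) (q n)) atTop (𝓝 v)) :
    Tendsto (fun n => walkPartition m (δ n) (V n) (q n) (p n) -
      walkPartition m (δ n) (V n) (cell (δ n) v) (p n)) atTop (𝓝 0) := by
  obtain ⟨ρ, hρ, -, L, hL, hlip⟩ := h.exists_lipschitz hv hvu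
  have hc := tendsto_cell h.mesh v
  have hd : Tendsto (fun n => L * dist (gridPoint (δ n) (q n)) (gridPoint (δ n) (cell (δ n) v)))
      atTop (𝓝 0) := by
    simpa using (hq.dist hc).const_mul L
  refine squeeze_zero_norm' ?_ hd
  filter_upwards [hlip, hq.eventually (Metric.ball_mem_nhds v hρ),
    hc.eventually (Metric.ball_mem_nhds v hρ)] with n h1 h2 h3
  exact h1 _ _ h3 h2

theorem IsApproximation.eventually_le (h : IsApproximation m R Ω u δ V p) {v : ℂ} {r : ℝ}
    (hr : 0 < r) (hrv : r < dist v u) {q : ℕ → ℤ × ℤ}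
    (hq : Tendsto (fun n => gridPoint (δ n) (q n)) atTop (𝓝 v)) :
    ∀ᶠ n in atTop, walkPartition m (δ n) (V n) (q n) (p n) ≤ farBound R r := by
  filter_upwards [h.bounded, h.pole_mem, (hq.dist h.pole).eventually_const_lt hrv] with n h1 h2 h3
  exact h1.le_farBound h2 hr h3.le

/-- Compactness: partition functions converge along a subsequence. -/
theorem IsApproximation.exists_subseq (h : IsApproximation m R Ω u δ V p) :
    ∃ f : ℕ → ℕ, StrictMono f ∧ ∃ g : ℂ → ℝ, ∀ v ∈ Ω, v ≠ u → ∀ q : ℕ → ℤ × ℤ,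
      Tendsto (fun n => gridPoint (δ (f n)) (q n)) atTop (𝓝 v) →
      Tendsto (fun n => walkPartition m (δ (f n)) (V (f n)) (q n) (p (f n))) atTop (𝓝 (g v)) := by
  set d : ℕ → ℂ := TopologicalSpace.denseSeq ℂ with hd
  -- The values at a dense sequence are clamped to intervals so that all indices `n` give points of
  -- a compact product. For points other than `u` the clamp is eventually inactive.
  set b : ℕ → ℕ → ℝ := fun n j =>
    max 0 (min (farBound R (dist (d j) u / 2))
      (walkPartition m (δ n) (V n) (cell (δ n) (d j)) (p n))) with hb
  have hcomp : IsCompact (Set.univ.pi fun j => Set.Icc 0 (farBound R (dist (d j) u / 2))) :=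
    isCompact_univ_pi fun j => isCompact_Icc
  obtain ⟨B, -, f, hf, hlim⟩ := hcomp.tendsto_subseq (x := b) (fun n j _ => by
    simp only [hb]
    exact ⟨le_max_left _ _, max_le (farBound_nonneg _ _) (min_le_left _ _)⟩)
  have h' := h.comp hf.tendsto_atTop
  have hdense : ∀ j, d j ≠ u → Tendsto (fun n =>
      walkPartition m (δ (f n)) (V (f n)) (cell (δ (f n)) (d j)) (p (f n))) atTop (𝓝 (B j)) := by
    intro j hju
    have hdist : 0 < dist (d j) u := dist_pos.2 hju
    refine ((tendsto_pi_nhds.1 hlim) j).congr' ?_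
    filter_upwards [h'.eventually_le (half_pos hdist) (half_lt_self hdist)
      (tendsto_cell h'.mesh (d j)), h'.bounded] with n h1 h2
    simp only [hb, Function.comp_apply] at h1 h2 ⊢
    rw [min_eq_right h1, max_eq_right (h2.walkPartition_nonneg _ _)]
  have hex : ∀ v, ∃ g : ℝ, v ∈ Ω → v ≠ u → Tendsto (fun n =>
      walkPartition m (δ (f n)) (V (f n)) (cell (δ (f n)) v) (p (f n))) atTop (𝓝 g) := by
    intro v
    by_cases hv : v ∈ Ω ∧ v ≠ u
    -- Equicontinuity carries the Cauchy property from a nearby point of the dense sequence to `v`.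
    · obtain ⟨ρ, hρ, hρΩ, L, hL, hlip⟩ := h'.exists_lipschitz hv.1 hv.2
      suffices hC : CauchySeq (fun n =>
          walkPartition m (δ (f n)) (V (f n)) (cell (δ (f n)) v) (p (f n))) by
        obtain ⟨g, hg⟩ := cauchySeq_tendsto_of_complete hC
        exact ⟨g, fun _ _ => hg⟩
      rw [Metric.cauchySeq_iff']
      intro ε hε
      set s := min ρ (ε / (8 * (L + 1))) with hs
      have hs0 : 0 < s := by positivity
      obtain ⟨j, hj⟩ : ∃ j, dist v (d j) < s :=
        Metric.denseRange_iff.1 (TopologicalSpace.denseRange_denseSeq ℂ) v s hs0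
      have hju : d j ≠ u := by
        have : d j ∈ Metric.ball v ρ := by
          rw [Metric.mem_ball, dist_comm]; exact hj.trans_le (min_le_left _ _)
        exact (hρΩ this).2
      have hcv := tendsto_cell h'.mesh v
      have hcj := tendsto_cell h'.mesh (d j)
      have e1 : ∀ᶠ n in atTop,
          |walkPartition m (δ (f n)) (V (f n)) (cell (δ (f n)) v) (p (f n)) -
            walkPartition m (δ (f n)) (V (f n)) (cell (δ (f n)) (d j)) (p (f n))| ≤ ε / 8 := by
        filter_upwards [hlip, hcv.eventually (Metric.ball_mem_nhds v hρ),
          (hcj.dist tendsto_const_nhds).eventually_lt_const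
            (show dist (d j) v < ρ by rw [dist_comm]; exact hj.trans_le (min_le_left _ _)),
          (hcv.dist hcj).eventually_lt_const hj] with n k1 k2 k3 k4
        refine (k1 _ _ k3 k2).trans ?_
        have : s ≤ ε / (8 * (L + 1)) := min_le_right _ _
        calc L * dist (gridPoint (δ (f n)) (cell (δ (f n)) v))
              (gridPoint (δ (f n)) (cell (δ (f n)) (d j)))
            ≤ (L + 1) * (ε / (8 * (L + 1))) := by
              apply mul_le_mul (by linarith) (k4.le.trans this) dist_nonneg (by positivity)
          _ = ε / 8 := by field_simp
      have e2 := Metric.cauchySeq_iff'.1 (hdense j hju).cauchySeq (ε / 4) (by positivity)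
      obtain ⟨N₁, hN₁⟩ := eventually_atTop.1 e1
      obtain ⟨N₂, hN₂⟩ := e2
      refine ⟨max N₁ N₂, fun n hn => ?_⟩
      have a1 := hN₁ n ((le_max_left _ _).trans hn)
      have a2 := hN₁ (max N₁ N₂) (le_max_left _ _)
      have a3 := hN₂ n ((le_max_right _ _).trans hn)
      have a4 := hN₂ (max N₁ N₂) (le_max_right _ _)
      rw [Real.dist_eq] at a3 a4 ⊢
      rw [abs_le] at a1 a2
      rw [abs_lt] at a3 a4 ⊢
      constructor <;> linarith
    · exact ⟨0, fun h1 h2 => absurd ⟨h1, h2⟩ hv⟩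
  choose g hg using hex
  refine ⟨f, hf, g, fun v hv hvu q hq => ?_⟩
  have := (h'.tendsto_sub_cell hv hvu hq).add (hg v hv hvu)
  simpa using this

end

/-! ### Integrable majorant and summation by parts -/

noncomputable section

/-- An integrable function dominating the partition functions on cells, recentred at the pole. -/
def cellMajorant (R : ℝ) (w : ℂ) : ℝ :=
  (Set.Icc (-(3 * R)) (3 * R)).indicator
      (fun x => |Real.log (38 * R ^ 2) - 2 * Real.log x| / Real.log 2) w.re *
    (Set.Icc (-(3 * R)) (3 * R)).indicator (fun _ => 1) w.im

theorem cellMajorant_nonneg (R : ℝ) (w : ℂ) : 0 ≤ cellMajorant R w := by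
  have hl : 0 < Real.log 2 := Real.log_pos (by norm_num)
  refine mul_nonneg (Set.indicator_nonneg (fun x _ => by positivity) _)
    (Set.indicator_nonneg (fun x _ => zero_le_one) _)

theorem integrable_cellMajorant (R : ℝ) : Integrable (cellMajorant R) := by
  have h1 : Integrable ((Set.Icc (-(3 * R)) (3 * R)).indicator
      (fun x => |Real.log (38 * R ^ 2) - 2 * Real.log x| / Real.log 2)) := by
    rw [integrable_indicator_iff measurableSet_Icc]
    by_cases h : -(3 * R) ≤ 3 * R
    · rw [← intervalIntegrable_iff_integrableOn_Icc_of_le h]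
      exact ((intervalIntegrable_const.sub
        (intervalIntegral.intervalIntegrable_log'.const_mul 2)).abs).div_const _
    · rw [Set.Icc_eq_empty h]; exact integrableOn_empty
  have h2 : Integrable ((Set.Icc (-(3 * R)) (3 * R)).indicator (fun _ => (1 : ℝ))) := by
    rw [integrable_indicator_iff measurableSet_Icc]
    exact integrableOn_const (by simp)
  exact Complex.volume_preserving_equiv_real_prod.integrable_comp_of_integrable (h1.mul_prod h2)

variable {m δ R : ℝ} {V : Set (ℤ × ℤ)}

theorem IsBoundedMesh.finite (hV : IsBoundedMesh m δ R V) : V.Finite := by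
  have hδ := hV.pos
  refine finite_box (fun x y => (x, y) ∈ V) ⌈R / δ⌉ fun x y h => ?_
  have h0 := hV.bdd _ h
  rw [mem_ball_zero_iff] at h0
  have a1 := (Complex.abs_re_le_norm _).trans h0.le
  have a2 := (Complex.abs_im_le_norm _).trans h0.le
  simp only [gridPoint, abs_mul, abs_of_pos hδ] at a1 a2
  have hc := Int.le_ceil (R / δ)
  rw [mul_comm, ← le_div_iff₀ hδ] at a1 a2
  constructor
  · exact_mod_cast a1.trans hc
  · exact_mod_cast a2.trans hc

/-- A logarithmic singularity in the real part alone is already integrable in the plane, which keeps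
the majorant a product of functions of one variable. -/
theorem IsBoundedMesh.walkPartition_le_cellMajorant (hV : IsBoundedMesh m δ R V) {p : ℤ × ℤ}
    (hp : p ∈ V) {w : ℂ} (hw : w.re ≠ 0) :
    walkPartition m δ V (p + cell δ w) p ≤ cellMajorant R w := by
  by_cases hq : p + cell δ w ∈ V
  · have hδ := hV.pos
    have hδR := hV.le
    have hR : 0 < R := hδ.trans_le hδR
    obtain ⟨i1, i2⟩ := abs_sub_lt_of_mem_ball (hV.bdd _ hq) (hV.bdd p hp)
    obtain ⟨a1, a2⟩ := floor_mul_bounds hδ w.re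
    obtain ⟨b1, b2⟩ := floor_mul_bounds hδ w.im
    have e := hV.walkPartition_le hq hp
    rw [logMajorant_eq hδ hR] at e
    simp only [Prod.fst_add, Prod.snd_add, cell, add_sub_cancel_left, Int.cast_add] at i1 i2 e
    set X := δ * (⌊w.re / δ⌋ : ℝ)
    set Y := δ * (⌊w.im / δ⌋ : ℝ)
    rw [abs_lt] at i1 i2
    have m1 : w.re ∈ Set.Icc (-(3 * R)) (3 * R) := ⟨by linarith, by linarith⟩
    have m2 : w.im ∈ Set.Icc (-(3 * R)) (3 * R) := ⟨by linarith, by linarith⟩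
    unfold cellMajorant
    rw [Set.indicator_of_mem m1, Set.indicator_of_mem m2, mul_one]
    refine e.trans ?_
    have hl : 0 < Real.log 2 := Real.log_pos (by norm_num)
    refine div_le_div_of_nonneg_right (le_trans ?_ (le_abs_self _)) hl.le
    have hw2 : 0 < w.re ^ 2 := by positivity
    have : Real.log (38 * R ^ 2) - 2 * Real.log w.re = Real.log (38 * R ^ 2 / w.re ^ 2) := by
      rw [Real.log_div (by positivity) hw2.ne', Real.log_pow]; norm_num
    rw [this]
    refine Real.log_le_log (by positivity) ?_
    rw [div_le_div_iff₀ (by positivity) hw2]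
    -- The corner of the cell is within `δ` of `w` in the real direction; the factor `2` turns `19`
    -- into the `38` of `cellMajorant`.
    have : w.re ^ 2 ≤ 2 * (X ^ 2 + Y ^ 2 + δ ^ 2) := by
      nlinarith [sq_nonneg (X - δ), sq_nonneg Y, sq_nonneg X, mul_nonneg (sub_nonneg.2 a1) (sub_nonneg.2 a2.le), sq_nonneg (X + (w.re - X)), sq_nonneg (X - (w.re - X))]
    nlinarith [mul_le_mul_of_nonneg_left this (show 0 ≤ R ^ 2 by positivity)]
  · rw [walkPartition_of_notMem m δ hq hp]
    exact cellMajorant_nonneg R w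

theorem tsum_mul_nbr {A Φ : ℤ × ℤ → ℝ} (hA : A.support.Finite) (e : ℤ × ℤ) :
    Summable (fun q => A q * Φ (q + e)) ∧ Summable (fun q => A (q - e) * Φ q) ∧
      ∑' q, A q * Φ (q + e) = ∑' q, A (q - e) * Φ q := by
  have s1 : Summable (fun q => A q * Φ (q + e)) :=
    summable_of_hasFiniteSupport (hA.subset (Function.support_mul_subset_left _ _))
  have h : (fun q => A q * Φ (q + e)) = (fun q => A (q - e) * Φ q) ∘ Equiv.addRight e := by
    ext q; simp
  refine ⟨s1, ?_, ?_⟩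
  · rwa [h, Equiv.summable_iff] at s1
  · rw [h]
    exact (Equiv.addRight e).tsum_eq (fun q => A (q - e) * Φ q)

/-- Summation by parts: the partition function is the Green function of the massive discrete
Laplacian. -/
theorem IsBoundedMesh.tsum_mul (hV : IsBoundedMesh m δ R V) {p : ℤ × ℤ} (hp : p ∈ V) {φ : ℂ → ℝ}
    (hφ : ∀ q, gridPoint δ q ∈ tsupport φ → q ∈ V) :
    ∑' q, walkPartition m δ V q p * (m ^ 2 * δ ^ 2 * φ (gridPoint δ q) -
      (1 - m ^ 2 * δ ^ 2) / 4 * secondDiff φ δ (gridPoint δ q)) = φ (gridPoint δ p) := by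
  set A : ℤ × ℤ → ℝ := fun q => walkPartition m δ V q p with hAdef
  set Φ : ℤ × ℤ → ℝ := fun q => φ (gridPoint δ q) with hΦ
  have hA : A.support.Finite := hV.finite.subset fun q hq => by
    by_contra h
    exact hq (walkPartition_of_notMem m δ h hp)
  have hgrid : ∀ q, secondDiff φ δ (gridPoint δ q) =
      Φ (q + (1, 0)) + Φ (q + (-1, 0)) + Φ (q + (0, 1)) + Φ (q + (0, -1)) - 4 * Φ q := by
    intro q
    have e1 : gridPoint δ (1, 0) = δ := by apply Complex.ext <;> simp [gridPoint]
    have e2 : gridPoint δ (-1, 0) = -δ := by apply Complex.ext <;> simp [gridPoint]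
    have e3 : gridPoint δ (0, 1) = δ * Complex.I := by apply Complex.ext <;> simp [gridPoint]
    have e4 : gridPoint δ (0, -1) = -(δ * Complex.I) := by apply Complex.ext <;> simp [gridPoint]
    simp only [hΦ, gridPoint_add, e1, e2, e3, e4, secondDiff, sub_eq_add_neg]
  obtain ⟨s1, t1, h1⟩ := tsum_mul_nbr (Φ := Φ) hA (1, 0)
  obtain ⟨s2, t2, h2⟩ := tsum_mul_nbr (Φ := Φ) hA (-1, 0)
  obtain ⟨s3, t3, h3⟩ := tsum_mul_nbr (Φ := Φ) hA (0, 1)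
  obtain ⟨s4, t4, h4⟩ := tsum_mul_nbr (Φ := Φ) hA (0, -1)
  have s0 : Summable (fun q => A q * Φ q) :=
    summable_of_hasFiniteSupport (hA.subset (Function.support_mul_subset_left _ _))
  set a := (1 - m ^ 2 * δ ^ 2) / 4 with ha
  have l1 : ∑' q, A q * (m ^ 2 * δ ^ 2 * φ (gridPoint δ q) - a * secondDiff φ δ (gridPoint δ q)) =
      ∑' q, A q * Φ q - a * (∑' q, A q * Φ (q + (1, 0)) + ∑' q, A q * Φ (q + (-1, 0)) +
        ∑' q, A q * Φ (q + (0, 1)) + ∑' q, A q * Φ (q + (0, -1))) := by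
    rw [← s1.tsum_add s2, ← (s1.add s2).tsum_add s3, ← ((s1.add s2).add s3).tsum_add s4,
      ← tsum_mul_left, ← s0.tsum_sub ((((s1.add s2).add s3).add s4).mul_left a)]
    refine tsum_congr fun q => ?_
    rw [hgrid, show m ^ 2 * δ ^ 2 = 1 - 4 * a by rw [ha]; ring]
    ring
  have l2 : ∑' q, A q * Φ q - a * (∑' q, A q * Φ (q + (1, 0)) + ∑' q, A q * Φ (q + (-1, 0)) +
        ∑' q, A q * Φ (q + (0, 1)) + ∑' q, A q * Φ (q + (0, -1))) =
      ∑' q, (if q = p then Φ p else 0) := by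
    rw [h1, h2, h3, h4, ← t1.tsum_add t2, ← (t1.add t2).tsum_add t3,
      ← ((t1.add t2).add t3).tsum_add t4,
      ← tsum_mul_left, ← s0.tsum_sub ((((t1.add t2).add t3).add t4).mul_left a)]
    refine tsum_congr fun q => ?_
    by_cases hq : q ∈ V
    · have := hV.walkPartition_eq hq hp
      simp only [hAdef]
      rw [this]
      have e : a * (walkPartition m δ V (q - (1, 0)) p * Φ q +
          walkPartition m δ V (q - (-1, 0)) p * Φ q + walkPartition m δ V (q - (0, 1)) p * Φ q +
          walkPartition m δ V (q - (0, -1)) p * Φ q) = (1 - m ^ 2 * δ ^ 2) *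
            nbrAvg (fun x y => walkPartition m δ V (x, y) p) q.1 q.2 * Φ q := by
        have f1 : q - (1, 0) = (q.1 - 1, q.2) := by ext <;> simp
        have f2 : q - (-1, 0) = (q.1 + 1, q.2) := by ext <;> simp
        have f3 : q - (0, 1) = (q.1, q.2 - 1) := by ext <;> simp
        have f4 : q - (0, -1) = (q.1, q.2 + 1) := by ext <;> simp
        rw [f1, f2, f3, f4, ha, nbrAvg]
        ring
      rw [e]
      split_ifs with h
      · rw [h]; ring
      · ring
    · have h0 : Φ q = 0 := image_eq_zero_of_notMem_tsupport (f := φ) fun h => hq (hφ q h)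
      have hqp : q ≠ p := fun h => hq (by rw [h]; exact hp)
      rw [h0, if_neg hqp]
      simp
  rw [l1, l2, tsum_ite_eq]

/-- Summation by parts written as an exact integral of a step function. Recentring at `p` keeps the
singularity at `w = 0` for every mesh, so that one majorant serves them all. -/
theorem IsBoundedMesh.integral_cell_mul (hV : IsBoundedMesh m δ R V) {p : ℤ × ℤ} (hp : p ∈ V)
    {φ : ℂ → ℝ} (hφ : ∀ q, gridPoint δ q ∈ tsupport φ → q ∈ V) :
    ∫ w, walkPartition m δ V (p + cell δ w) p * (m ^ 2 * φ (gridPoint δ (p + cell δ w)) -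
      (1 - m ^ 2 * δ ^ 2) / 4 * (secondDiff φ δ (gridPoint δ (p + cell δ w)) / δ ^ 2)) =
        φ (gridPoint δ p) := by
  have hδ := hV.pos
  rw [← hV.tsum_mul hp hφ]
  set F : ℤ × ℤ → ℝ := fun q => walkPartition m δ V q p * (m ^ 2 * φ (gridPoint δ q) -
      (1 - m ^ 2 * δ ^ 2) / 4 * (secondDiff φ δ (gridPoint δ q) / δ ^ 2)) with hF
  have hF0 : F.support.Finite := hV.finite.subset fun q hq => by
    by_contra h
    exact hq (by simp only [hF]; rw [walkPartition_of_notMem m δ h hp, zero_mul])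
  have := integral_cell hδ (F := fun q => F (p + q))
    (hF0.preimage (add_right_injective p).injOn)
  refine this.trans ?_
  have e : ∑' q, F (p + q) = ∑' q, F q := (Equiv.addLeft p).tsum_eq F
  rw [e, ← tsum_mul_left]
  refine tsum_congr fun q => ?_
  simp only [hF]
  field_simp

end

/-! ### Limits of partition functions are Green functions -/

noncomputable section

variable {m R : ℝ} {Ω : Set ℂ} {u : ℂ} {δ : ℕ → ℝ} {V : ℕ → Set (ℤ × ℤ)} {p : ℕ → ℤ × ℤ}

/-- `g` is the limit of the partition functions along all lattice approximations. -/
def IsLimit (m : ℝ) (Ω : Set ℂ) (u : ℂ) (δ : ℕ → ℝ) (V : ℕ → Set (ℤ × ℤ)) (p : ℕ → ℤ × ℤ)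
    (g : ℂ → ℝ) : Prop :=
  ∀ v ∈ Ω, v ≠ u → ∀ q : ℕ → ℤ × ℤ, Tendsto (fun n => gridPoint (δ n) (q n)) atTop (𝓝 v) →
    Tendsto (fun n => walkPartition m (δ n) (V n) (q n) (p n)) atTop (𝓝 (g v))

variable {g : ℂ → ℝ}

theorem IsLimit.nonneg (hg : IsLimit m Ω u δ V p g) (h : IsApproximation m R Ω u δ V p) {v : ℂ}
    (hv : v ∈ Ω) (hvu : v ≠ u) : 0 ≤ g v := by
  refine ge_of_tendsto (hg v hv hvu _ (tendsto_cell h.mesh v)) ?_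
  filter_upwards [h.bounded] with n hn using hn.walkPartition_nonneg _ _

theorem IsLimit.continuousOn (hg : IsLimit m Ω u δ V p g) (h : IsApproximation m R Ω u δ V p) :
    ContinuousOn g (Ω \ {u}) := by
  rintro v ⟨hv, hvu⟩
  refine ContinuousAt.continuousWithinAt ?_
  obtain ⟨ρ, hρ, hρΩ, L, hL, hlip⟩ := h.exists_lipschitz hv hvu
  refine Metric.continuousAt_iff.2 fun ε hε => ⟨min ρ (ε / (L + 1)), by positivity, fun z hz => ?_⟩
  have hzρ : z ∈ Metric.ball v ρ := hz.trans_le (min_le_left _ _)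
  have hcz := tendsto_cell h.mesh z
  have hcv := tendsto_cell h.mesh v
  have key : |g z - g v| ≤ L * dist z v := by
    refine le_of_tendsto_of_tendsto ((hg z (hρΩ hzρ).1 (hρΩ hzρ).2 _ hcz).sub
      (hg v hv hvu _ hcv)).abs ((hcz.dist hcv).const_mul L) ?_
    filter_upwards [hlip, hcz.eventually (Metric.isOpen_ball.mem_nhds hzρ),
      hcv.eventually (Metric.ball_mem_nhds v hρ)] with n h1 h2 h3
    exact h1 _ _ h3 h2
  rw [Real.dist_eq]
  refine key.trans_lt ?_
  have h2 : dist z v < ε / (L + 1) := hz.trans_le (min_le_right _ _)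
  rw [lt_div_iff₀ (by positivity)] at h2
  nlinarith [dist_nonneg (x := z) (y := v)]

/-- Near `ζ` there are boundary points of the discrete domains, and the Beurling estimate around
them bounds `g` by `decayConst ^ k` times a constant; `k` is chosen first, then the neighbourhood.
-/
theorem IsLimit.dirichlet (hg : IsLimit m Ω u δ V p g) (h : IsApproximation m R Ω u δ V p) {ζ : ℂ}
    (hζ : ζ ∈ frontier Ω) : Tendsto g (𝓝[Ω] ζ) (𝓝 0) := by
  have hζΩ : ζ ∉ Ω := by
    rw [h.isOpen.frontier_eq] at hζ
    exact hζ.2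
  have hd : 0 < dist u ζ := dist_pos.2 fun e => hζΩ (e ▸ h.mem)
  set ρ := dist u ζ / 8 with hρ
  have hρ0 : 0 < ρ := by positivity
  rw [Metric.tendsto_nhdsWithin_nhds]
  intro ε hε
  have hk : Tendsto (fun k : ℕ => decayConst ^ k * farBound R ρ) atTop (𝓝 0) := by
    simpa using (tendsto_pow_atTop_nhds_zero_of_lt_one decayConst_nonneg
      decayConst_lt_one).mul_const (farBound R ρ)
  obtain ⟨k, hk⟩ := (hk.eventually_lt_const hε).exists
  set s := ρ / 64 ^ k / 4 with hs
  have hs0 : 0 < s := by positivity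
  have hsρ : s ≤ ρ / 4 := by
    rw [hs]
    gcongr
    exact div_le_self hρ0.le (one_le_pow₀ (by norm_num))
  refine ⟨s / 4, by positivity, fun {z} hz hzζ => ?_⟩
  have hzu : z ≠ u := by
    rintro rfl
    linarith
  have hcz := tendsto_cell h.mesh z
  rw [Real.dist_0_eq_abs, abs_of_nonneg (hg.nonneg h hz hzu)]
  refine lt_of_le_of_lt (le_of_tendsto (hg z hz hzu _ hcz) ?_) hk
  filter_upwards [h.converges.boundary ζ hζ (s / 4) (by positivity), h.bounded, h.simplyConnected,
    h.pole_mem, h.lt hs0, hcz.eventually (Metric.ball_mem_nhds z (show 0 < s / 4 by positivity)),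
    h.pole.eventually (Metric.ball_mem_nhds u (show 0 < s / 4 by positivity))]
    with n ⟨ξ, hξ, hξζ⟩ h1 h2 h3 h4 h5 h6
  have hξD : ξ ∉ polygonalDomain (δ n) (V n) := by
    rw [(isOpen_polygonalDomain _ _).frontier_eq] at hξ
    exact hξ.2
  refine h1.walkPartition_le_near_boundary h2 h3 hξD ?_ k h4.le ?_
  · have a1 := dist_triangle u (gridPoint (δ n) (p n)) ζ
    have a2 := dist_triangle (gridPoint (δ n) (p n)) ξ ζ
    rw [dist_comm u (gridPoint (δ n) (p n))] at a1
    linarith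
  · have a1 := dist_triangle (gridPoint (δ n) (cell (δ n) z)) z ξ
    have a2 := dist_triangle z ζ ξ
    rw [dist_comm ζ ξ] at a2
    linarith

theorem tendsto_gridPoint_add_cell (h : IsApproximation m R Ω u δ V p) (w : ℂ) :
    Tendsto (fun n => gridPoint (δ n) (p n + cell (δ n) w)) atTop (𝓝 (u + w)) := by
  simp only [gridPoint_add]
  exact h.pole.add (tendsto_cell h.mesh w)

theorem IsLimit.le_cellMajorant (hg : IsLimit m Ω u δ V p g) (h : IsApproximation m R Ω u δ V p)
    {w : ℂ} (hw : u + w ∈ Ω) (hw0 : w.re ≠ 0) : g (u + w) ≤ cellMajorant R w := by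
  have hne : u + w ≠ u := by
    intro e
    rw [add_eq_left] at e
    exact hw0 (by simp [e])
  refine le_of_tendsto (hg _ hw hne _ (tendsto_gridPoint_add_cell h w)) ?_
  filter_upwards [h.bounded, h.pole_mem] with n h1 h2
  exact h1.walkPartition_le_cellMajorant h2 hw0

theorem ae_re_ne_zero : ∀ᵐ w : ℂ, w.re ≠ 0 := by
  have : (volume : Measure ℝ) {x | ¬ x ≠ 0} = 0 := by
    simp
  have h2 := Complex.volume_preserving_equiv_real_prod.quasiMeasurePreserving
  have h3 : Measure.QuasiMeasurePreserving (fun w : ℂ => w.re) volume volume :=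
    Measure.quasiMeasurePreserving_fst.comp h2
  exact h3.ae (ae_iff.2 this)

theorem IsLimit.integrableOn (hg : IsLimit m Ω u δ V p g) (h : IsApproximation m R Ω u δ V p) :
    IntegrableOn g Ω := by
  have hm : AEStronglyMeasurable g (volume.restrict Ω) := by
    have := (hg.continuousOn h).aestronglyMeasurable (μ := volume)
      (h.isOpen.measurableSet.diff (measurableSet_singleton u))
    rwa [Measure.restrict_congr_set (sdiff_null_ae_eq_self (measure_singleton u))] at this
  have hi : IntegrableOn (fun z => cellMajorant R (z - u)) Ω :=
    ((integrable_cellMajorant R).comp_sub_right u).integrableOn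
  refine Integrable.mono' hi hm ?_
  rw [ae_restrict_iff' h.isOpen.measurableSet]
  have hae : ∀ᵐ z : ℂ, (z - u).re ≠ 0 :=
    (measurePreserving_sub_right volume u).quasiMeasurePreserving.ae ae_re_ne_zero
  filter_upwards [hae] with z hz hzΩ
  have hzu : z ≠ u := by
    rintro rfl
    simp at hz
  have := hg.le_cellMajorant h (w := z - u) (by simpa using hzΩ) hz
  rw [add_sub_cancel] at this
  rwa [Real.norm_eq_abs, abs_of_nonneg (hg.nonneg h hzΩ hzu)]

/-- Dominated convergence in the discrete identity: the second difference tends to the Laplacian at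
the moving lattice points, and the weight `(1 - m²δ²) / 4` tends to `1 / 4`. -/
theorem IsLimit.equation (hg : IsLimit m Ω u δ V p g) (h : IsApproximation m R Ω u δ V p)
    {φ : ℂ → ℝ} (hφ : ContDiff ℝ ∞ φ) (hφc : HasCompactSupport φ) (hφΩ : tsupport φ ⊆ Ω) :
    ∫ z in Ω, g z * (m ^ 2 * φ z - 1 / 4 * Laplacian.laplacian φ z) = φ u := by
  set ψ : ℂ → ℝ := fun z => m ^ 2 * φ z - 1 / 4 * Laplacian.laplacian φ z with hψ
  set c : ℕ → ℂ → ℂ := fun n w => gridPoint (δ n) (p n + cell (δ n) w) with hc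
  set Ψ : ℕ → ℂ → ℝ := fun n w => m ^ 2 * φ (c n w) -
      (1 - m ^ 2 * δ n ^ 2) / 4 * (secondDiff φ (δ n) (c n w) / δ n ^ 2) with hΨ
  set F : ℕ → ℂ → ℝ := fun n w =>
    walkPartition m (δ n) (V n) (p n + cell (δ n) w) (p n) * Ψ n w with hF
  set G : ℂ → ℝ := fun w => Ω.indicator (fun z => g z * ψ z) (u + w) with hG
  have e1 : ∫ z in Ω, g z * ψ z = ∫ w, G w := by
    rw [← integral_indicator h.isOpen.measurableSet]
    exact (integral_add_left_eq_self _ u).symm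
  obtain ⟨C₂, hC₂0, hC₂⟩ := exists_abs_secondDiff_le hφ hφc
  obtain ⟨C₁, hC₁⟩ := hφ.continuous.bounded_above_of_compact_support hφc
  have hΨb : ∀ᶠ n in atTop, ∀ w, |Ψ n w| ≤ m ^ 2 * C₁ + 1 / 4 * C₂ := by
    filter_upwards [h.bounded] with n hn w
    have hδ := hn.pos
    have a1 := hC₂ (c n w) (δ n) hδ
    have a2 := hC₁ (c n w)
    refine (abs_sub _ _).trans ?_
    rw [abs_mul, abs_mul, abs_of_nonneg (sq_nonneg m), abs_of_nonneg hn.weight_nonneg, abs_div,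
      abs_of_pos (pow_pos hδ 2)]
    have a3 : |secondDiff φ (δ n) (c n w)| / δ n ^ 2 ≤ C₂ := by
      rwa [div_le_iff₀ (pow_pos hδ 2)]
    have a4 := hn.weight_le
    exact add_le_add (mul_le_mul_of_nonneg_left a2 (sq_nonneg m))
      (mul_le_mul a4 a3 (by positivity) (by norm_num))
  have hlim : Tendsto (fun n => ∫ w, F n w) atTop (𝓝 (∫ w, G w)) := by
    refine tendsto_integral_filter_of_dominated_convergence
      (fun w => cellMajorant R w * (m ^ 2 * C₁ + 1 / 4 * C₂)) (Eventually.of_forall fun n => ?_) ?_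
      ((integrable_cellMajorant R).mul_const _) ?_
    · set f : ℤ × ℤ → ℝ := fun k => walkPartition m (δ n) (V n) (p n + k) (p n) *
        (m ^ 2 * φ (gridPoint (δ n) (p n + k)) - (1 - m ^ 2 * δ n ^ 2) / 4 *
          (secondDiff φ (δ n) (gridPoint (δ n) (p n + k)) / δ n ^ 2)) with hf
      exact ((Measurable.of_discrete (f := f)).comp (measurable_cell (δ n))).aestronglyMeasurable
    · filter_upwards [hΨb, h.bounded, h.pole_mem] with n h1 h2 h3
      filter_upwards [ae_re_ne_zero] with w hw
      simp only [hF, Real.norm_eq_abs, abs_mul, abs_of_nonneg (h2.walkPartition_nonneg _ _)]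
      exact mul_le_mul (h2.walkPartition_le_cellMajorant h3 hw) (h1 w) (abs_nonneg _)
        (cellMajorant_nonneg _ _)
    · filter_upwards [ae_re_ne_zero] with w hw
      have hw0 : w ≠ 0 := by
        rintro rfl
        simp at hw
      have hcw : Tendsto (fun n => c n w) atTop (𝓝 (u + w)) := tendsto_gridPoint_add_cell h w
      have hδ0 : Tendsto δ atTop (𝓝 0) := h.mesh.mono_right nhdsWithin_le_nhds
      have hΨlim : Tendsto (fun n => Ψ n w) atTop (𝓝 (ψ (u + w))) := by
        have t1 := ((hφ.continuous.tendsto (u + w)).comp hcw).const_mul (m ^ 2)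
        have t2 : Tendsto (fun n => (1 - m ^ 2 * δ n ^ 2) / 4) atTop (𝓝 (1 / 4)) := by
          simpa using (((hδ0.pow 2).const_mul (m ^ 2)).const_sub 1).div_const 4
        exact t1.sub (t2.mul (tendsto_secondDiff hφ h.mesh hcw))
      by_cases hwΩ : u + w ∈ Ω
      · simp only [hG, Set.indicator_of_mem hwΩ]
        exact (hg _ hwΩ (by simpa using hw0) _ hcw).mul hΨlim
      · simp only [hG, Set.indicator_of_notMem hwΩ]
        -- Outside `Ω` the partition functions need not converge, but they stay bounded while the
        -- test factor tends to `0`.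
        have hns : u + w ∉ tsupport φ := fun hs => hwΩ (hφΩ hs)
        have hψ0 : ψ (u + w) = 0 := by
          simp only [hψ]
          rw [image_eq_zero_of_notMem_tsupport hns, laplacian_eq_zero_of_notMem_tsupport hns]
          simp
        rw [hψ0] at hΨlim
        have hr : 0 < dist (u + w) u / 2 := by
          have : 0 < dist (u + w) u := dist_pos.2 (by simpa using hw0)
          positivity
        refine squeeze_zero_norm' ?_ (a := fun n => farBound R (dist (u + w) u / 2) * |Ψ n w|)
          (by simpa using Tendsto.const_mul (farBound R (dist (u + w) u / 2)) (Tendsto.abs hΨlim))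
        filter_upwards [h.bounded, h.eventually_le hr (by linarith) hcw] with n h1 h2
        simp only [hF, Real.norm_eq_abs, abs_mul, abs_of_nonneg (h1.walkPartition_nonneg _ _)]
        exact mul_le_mul_of_nonneg_right h2 (abs_nonneg _)
  have hval : (fun n => φ (gridPoint (δ n) (p n))) =ᶠ[atTop] fun n => ∫ w, F n w := by
    filter_upwards [h.bounded, h.pole_mem, h.converges.eventually_subset hφc.isCompact hφΩ]
      with n h1 h2 h3
    exact (h1.integral_cell_mul h2 fun q hq =>
      (gridPoint_mem_polygonalDomain h1.pos).1 (h3 hq)).symm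
  rw [e1]
  exact tendsto_nhds_unique hlim
    ((((hφ.continuous.tendsto u).comp h.pole)).congr' hval)

theorem IsLimit.isMassiveGreen (hg : IsLimit m Ω u δ V p g) (h : IsApproximation m R Ω u δ V p) :
    IsMassiveGreen m Ω u g where
  continuousOn := hg.continuousOn h
  locallyIntegrableOn := (hg.integrableOn h).locallyIntegrableOn
  dirichlet _ hζ := hg.dirichlet h hζ
  equation _ hφ hφc hφΩ := hg.equation h hφ hφc hφΩ

theorem massiveGreen_spec (h : ∃ g, IsMassiveGreen m Ω u g) :
    IsMassiveGreen m Ω u (massiveGreen m Ω u) := by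
  have : massiveGreen m Ω u = h.choose := by
    ext v
    simp [massiveGreen, h]
  rw [this]
  exact h.choose_spec

theorem IsApproximation.isMassiveGreen (h : IsApproximation m R Ω u δ V p) :
    IsMassiveGreen m Ω u (massiveGreen m Ω u) := by
  obtain ⟨f, hf, g, hg⟩ := h.exists_subseq
  exact massiveGreen_spec ⟨g, IsLimit.isMassiveGreen (δ := δ ∘ f) (V := V ∘ f) (p := p ∘ f) hg
    (h.comp hf.tendsto_atTop)⟩

/-- Partition functions converge to the massive Green function. -/
theorem IsApproximation.tendsto (h : IsApproximation m R Ω u δ V p) {v : ℂ} (hv : v ∈ Ω)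
    (hvu : v ≠ u) {q : ℕ → ℤ × ℤ} (hq : Tendsto (fun n => gridPoint (δ n) (q n)) atTop (𝓝 v)) :
    Tendsto (fun n => walkPartition m (δ n) (V n) (p n) (q n)) atTop (𝓝 (massiveGreen m Ω u v)) := by
  -- Every subsequence has a further subsequence converging to some Green function, and uniqueness
  -- identifies that limit.
  refine tendsto_of_subseq_tendsto fun a ha => ?_
  have h' := h.comp ha
  obtain ⟨f, hf, g, hg⟩ := h'.exists_subseq
  have hG : IsMassiveGreen m Ω u g :=
    IsLimit.isMassiveGreen (δ := (δ ∘ a) ∘ f) (V := (V ∘ a) ∘ f) (p := (p ∘ a) ∘ f) hg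
      (h'.comp hf.tendsto_atTop)
  refine ⟨f, ?_⟩
  rw [← hG.unique h.isOpen h.subset h.isMassiveGreen hv hvu]
  simp only [walkPartition_comm m _ _ (p _)]
  exact hg v hv hvu (fun n => q (a (f n))) (hq.comp (ha.comp hf.tendsto_atTop))

end

/-! ### From filters to sequences, and uniformity -/

noncomputable section

variable {m R : ℝ} {Ω : Set ℂ}

/-- The discrete domain with vertex set `V` approximates `Ω` up to the error `s`. -/
structure IsClose (m R : ℝ) (Ω : Set ℂ) (s δ : ℝ) (V : Set (ℤ × ℤ)) : Prop where
  bounded : IsBoundedMesh m δ R V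
  simplyConnected : IsSimplyConnected (polygonalDomain δ V)
  mesh : δ < s
  interior : {z | s ≤ Metric.infDist z Ωᶜ} ⊆ polygonalDomain δ V
  boundary : ∀ ζ ∈ frontier Ω, ∃ ξ ∈ frontier (polygonalDomain δ V), dist ξ ζ < s

theorem CaratheodoryConverges.eventually_boundary {ι : Type*} {l : Filter ι} {D : ι → Set ℂ}
    (h : CaratheodoryConverges l D Ω) (hΩR : Ω ⊆ Metric.ball 0 R) {s : ℝ} (hs : 0 < s) :
    ∀ᶠ i in l, ∀ ζ ∈ frontier Ω, ∃ ξ ∈ frontier (D i), dist ξ ζ < s := by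
  have hcomp : IsCompact (frontier Ω) :=
    Metric.isCompact_of_isClosed_isBounded isClosed_frontier
      ((Metric.isBounded_ball.subset hΩR).closure.subset frontier_subset_closure)
  refine hcomp.induction_on
    (p := fun K => ∀ᶠ i in l, ∀ ζ ∈ K, ∃ ξ ∈ frontier (D i), dist ξ ζ < s) (by simp) ?_ ?_ ?_
  · intro K L hKL hL
    filter_upwards [hL] with i hi ζ hζ using hi ζ (hKL hζ)
  · intro K L hK hL
    filter_upwards [hK, hL] with i h1 h2 ζ hζ using hζ.elim (h1 ζ) (h2 ζ)
  · intro ζ hζ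
    refine ⟨Metric.ball ζ (s / 2), mem_nhdsWithin_of_mem_nhds (Metric.ball_mem_nhds ζ (half_pos hs)),
      ?_⟩
    filter_upwards [h.boundary ζ hζ (s / 2) (half_pos hs)] with i ⟨ξ, hξ, hd⟩ ζ' hζ'
    refine ⟨ξ, hξ, ?_⟩
    have := dist_triangle ξ ζ ζ'
    rw [Metric.mem_ball, dist_comm] at hζ'
    linarith

/-- `IsClose` packs both convergence conditions into a single scale, so that choosing one index for
each scale `1 / (n + 1)` extracts approximating sequences from an arbitrary filter. -/
theorem eventually_isClose {ι : Type*} {l : Filter ι} (hΩR : Ω ⊆ Metric.ball 0 R) (hR : 0 < R)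
    {δ : ι → ℝ} (hδ : Tendsto δ l (𝓝[>] 0)) {V : ι → Set (ℤ × ℤ)}
    (hV : ∀ᶠ i in l, IsSimplyConnectedDiscreteDomain (δ i) (V i))
    (hVR : ∀ᶠ i in l, ∀ p ∈ V i, gridPoint (δ i) p ∈ Metric.ball 0 R)
    (hconv : CaratheodoryConverges l (fun i => polygonalDomain (δ i) (V i)) Ω) {s : ℝ}
    (hs : 0 < s) : ∀ᶠ i in l, IsClose m R Ω s (δ i) (V i) := by
  have hδ0 : Tendsto δ l (𝓝 0) := hδ.mono_right nhdsWithin_le_nhds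
  have hmass : Tendsto (fun i => m ^ 2 * δ i ^ 2) l (𝓝 0) := by
    simpa using (hδ0.pow 2).const_mul (m ^ 2)
  filter_upwards [hV, hVR, hδ.eventually self_mem_nhdsWithin, hδ0.eventually_lt_const hR,
    hδ0.eventually_lt_const hs, hmass.eventually_lt_const one_pos,
    hconv.eventually_subset (isCompact_le_infDist_compl hΩR hs)
      (fun z hz => mem_of_infDist_compl_pos (hs.trans_le hz)),
    hconv.eventually_boundary hΩR hs] with i h1 h2 h3 h4 h5 h6 h7 h8
  exact ⟨⟨h3, h4.le, h6.le, h2⟩, h1.simplyConnected, h5, h7, h8⟩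

theorem IsApproximation.of_isClose (hΩ : IsOpen Ω) (hΩR : Ω ⊆ Metric.ball 0 R) {u : ℂ} (hu : u ∈ Ω)
    {s : ℕ → ℝ} (hs : Tendsto s atTop (𝓝 0)) {δ : ℕ → ℝ} {V : ℕ → Set (ℤ × ℤ)}
    (h : ∀ n, IsClose m R Ω (s n) (δ n) (V n)) {p : ℕ → ℤ × ℤ}
    (hp : Tendsto (fun n => gridPoint (δ n) (p n)) atTop (𝓝 u)) :
    IsApproximation m R Ω u δ V p where
  isOpen := hΩ
  subset := hΩR
  mem := hu
  mesh := tendsto_nhdsWithin_iff.2 ⟨squeeze_zero (fun n => (h n).bounded.pos.le)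
    (fun n => (h n).mesh.le) hs, Eventually.of_forall fun n => (h n).bounded.pos⟩
  bounded := Eventually.of_forall fun n => (h n).bounded
  simplyConnected := Eventually.of_forall fun n => (h n).simplyConnected
  converges :=
    { interior := fun z hz => by
        have h0 := infDist_compl_pos hΩ hΩR hz
        refine ⟨{w | Metric.infDist z Ωᶜ / 2 < Metric.infDist w Ωᶜ},
          (isOpen_lt continuous_const (Metric.continuous_infDist_pt _)).mem_nhds
            (half_lt_self h0), ?_⟩
        filter_upwards [hs.eventually_lt_const (half_pos h0)] with n hn w hw
        exact (h n).interior (hn.le.trans (le_of_lt hw))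
      boundary := fun ζ hζ ε hε => by
        filter_upwards [hs.eventually_lt_const hε] with n hn
        obtain ⟨ξ, hξ, hd⟩ := (h n).boundary ζ hζ
        exact ⟨ξ, hξ, hd.trans hn⟩ }
  pole := hp

/-- A segment from `z` to a point outside `Ω` meets the frontier, so the distance to the frontier
controls the distance to the complement. -/
theorem le_infDist_compl_of_lt_infDist_frontier (hΩ : IsOpen Ω) (hΩR : Ω ⊆ Metric.ball 0 R) {z : ℂ}
    (hz : z ∈ Ω) {r : ℝ} (hr : r < Metric.infDist z (frontier Ω)) : r ≤ Metric.infDist z Ωᶜ := by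
  rw [Metric.le_infDist (Set.nonempty_compl.2 (ne_univ_of_subset_ball hΩR))]
  intro y hy
  obtain ⟨x, hx, hxf⟩ : (segment ℝ z y ∩ frontier Ω).Nonempty := by
    by_contra hn
    rw [Set.not_nonempty_iff_eq_empty] at hn
    have hnf : ∀ x ∈ segment ℝ z y, x ∉ Ω → x ∉ closure Ω := fun x hx hxΩ hxc =>
      Set.notMem_empty x (hn ▸ ⟨hx, by rw [hΩ.frontier_eq]; exact ⟨hxc, hxΩ⟩⟩)
    obtain ⟨x, -, hx1, hx2⟩ := (convex_segment z y).isPreconnected Ω (closure Ω)ᶜ hΩ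
      isClosed_closure.isOpen_compl (fun x hx => (em (x ∈ Ω)).imp id (hnf x hx))
      ⟨z, left_mem_segment ℝ z y, hz⟩
      ⟨y, right_mem_segment ℝ z y, hnf y (right_mem_segment ℝ z y) hy⟩
    exact hx2 (subset_closure hx1)
  have h1 := Metric.infDist_le_dist_of_mem (x := z) hxf
  have h2 : dist z x ≤ dist z y := by
    have := dist_add_dist_of_mem_segment hx
    linarith [dist_nonneg (x := x) (y := y)]
  linarith

end

theorem proposition3p9 {ι : Type*} (l : Filter ι) [l.NeBot] (m R : ℝ) (hm : 0 ≤ m)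
    (Ω : Set ℂ) (hΩo : IsOpen Ω) (hΩs : IsSimplyConnected Ω) (hΩR : Ω ⊆ Metric.ball 0 R)
    (δ : ι → ℝ) (hδ : Tendsto δ l (𝓝[>] 0)) (V : ι → Set (ℤ × ℤ))
    (hV : ∀ᶠ i in l, IsSimplyConnectedDiscreteDomain (δ i) (V i))
    (hVR : ∀ᶠ i in l, ∀ p ∈ V i, gridPoint (δ i) p ∈ Metric.ball 0 R)
    (hconv : CaratheodoryConverges l (fun i => polygonalDomain (δ i) (V i)) Ω) :
    -- the massive Green function of `Ω` exists and is unique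
    (∀ u ∈ Ω, IsMassiveGreen m Ω u (massiveGreen m Ω u) ∧
      ∀ g, IsMassiveGreen m Ω u g → ∀ v ∈ Ω, v ≠ u → g v = massiveGreen m Ω u v) ∧
    -- the series defining the partition functions converge
    (∀ᶠ i in l, ∀ p ∈ V i, ∀ q ∈ V i, Summable (walkWeight m (δ i) (V i) (p := p) (q := q))) ∧
    -- convergence for fixed distinct points, along any lattice approximations of these points
    (∀ u ∈ Ω, ∀ v ∈ Ω, u ≠ v → ∀ p q : ι → ℤ × ℤ,
      Tendsto (fun i => gridPoint (δ i) (p i)) l (𝓝 u) →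
      Tendsto (fun i => gridPoint (δ i) (q i)) l (𝓝 v) →
      Tendsto (fun i => walkPartition m (δ i) (V i) (p i) (q i)) l (𝓝 (massiveGreen m Ω u v))) ∧
    -- uniform convergence for pairs jointly `r`-inside `Ω` at distance at least `r`
    (∀ r > 0, ∀ ε > 0, ∃ η > 0, ∀ᶠ i in l, ∀ u v : ℂ, JointlyInside r Ω u v → r ≤ dist u v →
      ∀ p q : ℤ × ℤ, dist (gridPoint (δ i) p) u < η → dist (gridPoint (δ i) q) v < η →
        p ∈ V i ∧ q ∈ V i ∧
          |walkPartition m (δ i) (V i) p q - massiveGreen m Ω u v| < ε) := by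
  obtain ⟨z₀, hz₀⟩ := hΩs.nonempty
  have hR : 0 < R := Metric.pos_of_mem_ball (hΩR hz₀)
  have hclose : ∀ n : ℕ, ∀ᶠ i in l, IsClose m R Ω (1 / ((n : ℝ) + 1)) (δ i) (V i) := fun n =>
    eventually_isClose hΩR hR hδ hV hVR hconv (by positivity)
  have hs : Tendsto (fun n : ℕ => 1 / ((n : ℝ) + 1)) atTop (𝓝 0) :=
    tendsto_one_div_add_atTop_nhds_zero_nat
  have hpt : ∀ u ∈ Ω, ∀ v ∈ Ω, u ≠ v → ∀ p q : ι → ℤ × ℤ,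
      Tendsto (fun i => gridPoint (δ i) (p i)) l (𝓝 u) →
      Tendsto (fun i => gridPoint (δ i) (q i)) l (𝓝 v) →
      Tendsto (fun i => walkPartition m (δ i) (V i) (p i) (q i)) l (𝓝 (massiveGreen m Ω u v)) := by
    intro u hu v hv huv p q hp hq
    -- If convergence failed, indices with error at least `ε` would occur at every scale and form an
    -- approximating sequence contradicting the sequential result.
    rw [Metric.tendsto_nhds]
    by_contra! hcon
    obtain ⟨ε, hε, hcon⟩ := hcon
    have hex : ∀ n : ℕ, ∃ i, IsClose m R Ω (1 / ((n : ℝ) + 1)) (δ i) (V i) ∧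
        dist (gridPoint (δ i) (p i)) u < 1 / ((n : ℝ) + 1) ∧
        dist (gridPoint (δ i) (q i)) v < 1 / ((n : ℝ) + 1) ∧
        ε ≤ dist (walkPartition m (δ i) (V i) (p i) (q i)) (massiveGreen m Ω u v) := by
      intro n
      have hn : 0 < 1 / ((n : ℝ) + 1) := by positivity
      obtain ⟨i, h1, h2, h3, h4⟩ := (hcon.and_eventually ((hclose n).and
        ((hp.eventually (Metric.ball_mem_nhds u hn)).and
          (hq.eventually (Metric.ball_mem_nhds v hn))))).exists
      exact ⟨i, h2, h3, h4, h1⟩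
    choose i h1 h2 h3 h4 using hex
    have hp' : Tendsto (fun n => gridPoint (δ (i n)) (p (i n))) atTop (𝓝 u) :=
      tendsto_iff_dist_tendsto_zero.2
        (squeeze_zero (fun _ => dist_nonneg) (fun n => (h2 n).le) hs)
    have hq' : Tendsto (fun n => gridPoint (δ (i n)) (q (i n))) atTop (𝓝 v) :=
      tendsto_iff_dist_tendsto_zero.2
        (squeeze_zero (fun _ => dist_nonneg) (fun n => (h3 n).le) hs)
    have happ := IsApproximation.of_isClose hΩo hΩR hu hs h1 hp'
    obtain ⟨n, hn⟩ := ((happ.tendsto hv huv.symm hq').eventually (Metric.ball_mem_nhds _ hε)).exists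
    exact absurd hn (not_lt.2 (h4 n))
  refine ⟨fun u hu => ?_, ?_, hpt, ?_⟩
  · choose i h1 using fun n => (hclose n).exists
    have hδ' : Tendsto (fun n => δ (i n)) atTop (𝓝[>] 0) :=
      tendsto_nhdsWithin_iff.2 ⟨squeeze_zero (fun n => (h1 n).bounded.pos.le)
        (fun n => (h1 n).mesh.le) hs, Eventually.of_forall fun n => (h1 n).bounded.pos⟩
    have hG := (IsApproximation.of_isClose hΩo hΩR hu hs h1 (tendsto_cell hδ' u)).isMassiveGreen
    exact ⟨hG, fun g hg v hv hvu => hg.unique hΩo hΩR hG hv hvu⟩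
  · filter_upwards [hclose 0] with i hi p hp q hq using hi.bounded.summable hp hq
  · intro r hr ε hε
    by_contra! hcon
    have hex : ∀ n : ℕ, ∃ i, IsClose m R Ω (1 / ((n : ℝ) + 1)) (δ i) (V i) ∧ ∃ u v,
        JointlyInside r Ω u v ∧ r ≤ dist u v ∧ ∃ p q : ℤ × ℤ,
          dist (gridPoint (δ i) p) u < 1 / ((n : ℝ) + 1) ∧
          dist (gridPoint (δ i) q) v < 1 / ((n : ℝ) + 1) ∧
          (p ∈ V i → q ∈ V i →
            ε ≤ |walkPartition m (δ i) (V i) p q - massiveGreen m Ω u v|) := by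
      intro n
      obtain ⟨i, ⟨u, v, h1, h2, p, q, h3, h4, h5⟩, h6⟩ :=
        ((hcon (1 / ((n : ℝ) + 1)) (by positivity)).and_eventually (hclose n)).exists
      exact ⟨i, h6, u, v, h1, h2, p, q, h3, h4, h5⟩
    choose i h1 u v huv hr' p q hp hq hfar using hex
    have hK := isCompact_le_infDist_compl hΩR hr
    have hKΩ : ∀ z, z ∈ {z | r ≤ Metric.infDist z Ωᶜ} → z ∈ Ω := fun z hz =>
      mem_of_infDist_compl_pos (hr.trans_le hz)
    have hu : ∀ n, u n ∈ {z | r ≤ Metric.infDist z Ωᶜ} := fun n =>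
      le_infDist_compl_of_lt_infDist_frontier hΩo hΩR (huv n).mem.1.1 (huv n).mem.1.2
    have hv : ∀ n, v n ∈ {z | r ≤ Metric.infDist z Ωᶜ} := fun n =>
      le_infDist_compl_of_lt_infDist_frontier hΩo hΩR (huv n).mem.2.1 (huv n).mem.2.2
    -- The offending pairs accumulate at a pair `(a, b)` of points of `Ω`, distinct because their
    -- distance is at least `r`.
    obtain ⟨⟨a, b⟩, ⟨ha, hb⟩, f, hf, hlim⟩ :=
      (hK.prod hK).tendsto_subseq (x := fun n => (u n, v n)) (fun n => ⟨hu n, hv n⟩)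
    have hua : Tendsto (fun n => u (f n)) atTop (𝓝 a) := hlim.fst_nhds
    have hvb : Tendsto (fun n => v (f n)) atTop (𝓝 b) := hlim.snd_nhds
    have hab : b ≠ a := by
      have : r ≤ dist a b := ge_of_tendsto (hua.dist hvb) (Eventually.of_forall fun n => hr' _)
      rintro rfl
      rw [dist_self] at this
      linarith
    have hsf : Tendsto (fun n => 1 / ((f n : ℝ) + 1)) atTop (𝓝 0) := hs.comp hf.tendsto_atTop
    have shift : ∀ {x y : ℕ → ℂ} {c : ℂ} {t : ℕ → ℝ}, Tendsto y atTop (𝓝 c) →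
        Tendsto t atTop (𝓝 0) → (∀ n, dist (x n) (y n) ≤ t n) → Tendsto x atTop (𝓝 c) := by
      intro x y c t hy ht hxy
      exact (tendsto_iff_of_dist (squeeze_zero (fun _ => dist_nonneg) hxy ht)).2 hy
    have hpa := shift hua hsf (fun n => (hp (f n)).le)
    have hqb := shift hvb hsf (fun n => (hq (f n)).le)
    have happ := IsApproximation.of_isClose hΩo hΩR (hKΩ a ha) hsf (fun n => h1 (f n)) hpa
    have hZ := happ.tendsto (hKΩ b hb) hab hqb
    -- To see that the Green function at `(u n, v n)` converges to its value at `(a, b)`, it is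
    -- replaced by a partition function within `1 / (n + 1)` of it, on a possibly different index `j
    -- n`; the sequential convergence then applies a second time.
    have hjex : ∀ n : ℕ, ∃ j, IsClose m R Ω (1 / ((n : ℝ) + 1)) (δ j) (V j) ∧
        dist (walkPartition m (δ j) (V j) (cell (δ j) (u n)) (cell (δ j) (v n)))
          (massiveGreen m Ω (u n) (v n)) < 1 / ((n : ℝ) + 1) := by
      intro n
      have hne : u n ≠ v n := dist_pos.1 (hr.trans_le (hr' n))
      have := (hpt _ (hKΩ _ (hu n)) _ (hKΩ _ (hv n)) hne _ _ (tendsto_cell hδ (u n))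
        (tendsto_cell hδ (v n))).eventually (Metric.ball_mem_nhds _
          (show 0 < 1 / ((n : ℝ) + 1) by positivity))
      exact ((hclose n).and this).exists
    choose j hj1 hj2 using hjex
    have hcell : ∀ w : ℕ → ℂ, ∀ n, dist (gridPoint (δ (j (f n))) (cell (δ (j (f n))) (w (f n))))
        (w (f n)) ≤ 2 * (1 / ((f n : ℝ) + 1)) := fun w n =>
      (dist_cell_le (hj1 (f n)).bounded.pos _).trans
        (mul_le_mul_of_nonneg_left (hj1 (f n)).mesh.le zero_le_two)
    have hsf2 : Tendsto (fun n => 2 * (1 / ((f n : ℝ) + 1))) atTop (𝓝 0) := by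
      simpa using hsf.const_mul 2
    have happ2 := IsApproximation.of_isClose hΩo hΩR (hKΩ a ha) hsf (fun n => hj1 (f n))
      (shift hua hsf2 (hcell u))
    have hZ2 := happ2.tendsto (hKΩ b hb) hab (shift hvb hsf2 (hcell v))
    have hG : Tendsto (fun n => massiveGreen m Ω (u (f n)) (v (f n))) atTop
        (𝓝 (massiveGreen m Ω a b)) :=
      (tendsto_iff_of_dist (squeeze_zero (fun _ => dist_nonneg)
        (fun n => (hj2 (f n)).le) hsf)).1 hZ2
    have hdiff := (hZ.sub hG).abs
    rw [sub_self, abs_zero] at hdiff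
    obtain ⟨n, k1, k2, k3⟩ := ((hdiff.eventually_lt_const hε).and (happ.pole_mem.and
      (happ.converges.eventually_mem happ.mesh (hKΩ b hb) hqb))).exists
    exact absurd (hfar (f n) k2 k3) (not_le.2 k1)
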